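/- \textbf{Theorem (error rate of TCSC).} \emph{Model.} For each number of nodes $n$ (from some $N_0$ on) let $K=K_n\ge 2$, let $c^*\in[K]^n$ be a label vector with community sizes $n_k=|\{i:c^*(i)=k\}|$, let $\rho_n\in(0,1]$, $\Lambda_0\in(0,1)^{n\times K}$, $\Lambda=(\lambda_{ik})=\rho_n\Lambda_0$ with rows $\lambda_{i\cdot}$, and $\Theta=(\theta_{ij})_{n\times n}$ with $\theta_{ij}=\lambda_{i c^*(j)}\lambda_{j c^*(i)}$. The random matrix $A\in\{0,1\}^{n\times n}$ is symmetric with zero diagonal, and its entries $A_{ij}$, $i<j$, are independent with $A_{ij}\sim\mathrm{Bern}(\theta_{ij})$. All of these may depend on $n$. \emph{Algorithm (TCSC) with threshold $d_n$ and accuracy $\varepsilon>0$.} Let $\hat\Xi\in\mathbb R^{n\times K^2}$ consist of orthonormal eigenvectors of $A$ for the $K^2$ eigenvalues largest in absolute value, with rows $\hat\xi_{i\cdot}$; put $\hat\tau_{ij}=|\cos(\hat\xi_{i\cdot},\hat\xi_{j\cdot})|$ (equal to $0$ if a row vanishes) and $\tilde\tau_i=(\mathbb I\{\hat\tau_{ij}\ge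 d_n\})_{j\in[n]}\in\mathbb R^n$. The output is any $\hat c^{(0)}\in[K]^n$ with $Q(\hat c^{(0)})\le(1+\varepsilon)\min_{c\in[K]^n}Q(c)$, where $Q(c)=\sum_{k=1}^K\min_{\nu\in\mathbb R^n}\sum_{i:c(i)=k}\|\tilde\tau_i-\nu\|^2$. The misclustering proportion is $\ell(c^*,\hat c)=\min_\pi\frac1n\sum_{i=1}^n\mathbb I\{c^*(i)\ne\pi(\hat c(i))\}$, the minimum being over permutations $\pi$ of $[K]$. \emph{Hypotheses.} Given constants $C_0\ge1$ and $C_1,C_3,C_4,\varepsilon>0$, there are (large) constants $C_2,C_5>0$ and a constant $C>0$, depending only on these, such that the following holds. Assume that, for all $n\ge N_0$, $\Theta$ has exactly $K^2$ nonzero singular values $\sigma_{1,n}\ge\dots\ge\sigma_{K^2,n}$, with $\sigma_{1,n}/\sigma_{K^2,n}\le C_1\sqrt{\log n}$. Let $\Theta=\Xi\,\mathrm{diag}(\delta)\,\Xi^\top$ with $\Xi\in\mathbb R^{n\times K^2}$, $\Xi^\top\Xi=I$ and $\delta\in\mathbb R^{K^2}$, be its eigenvalue decomposition, $\xi_{i\cdot}$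 the rows of $\Xi$, $\tau_{ij}=|\cos(\xi_{i\cdot},\xi_{j\cdot})|$, and $D_i=\lambda_{i\cdot}^\top\big(\Lambda^{(k,\cdot)\top}\Lambda^{(k,\cdot)}\big)^{-1}\lambda_{i\cdot}$ for $k=c^*(i)$, where $\Lambda^{(k,\cdot)}=(\lambda_{jl})_{j:c^*(j)=k,\;l\in[K]}$. Assume, for all $n\ge N_0$: \begin{enumerate} \item $\frac{n}{C_0K}\le n_k\le\frac{C_0n}{K}$ for all $k\in[K]$; \item $n\rho_n^2/K^2\ge C_5(\log n)^2$; \item for some $\phi_{1,n}\in(0,1]$, with $\mathcal G_i=\{j:c^*(j)=c^*(i),\ \tau_{ij}\ge\phi_{1,n}\}$ and $\mathcal H=\{i:|\mathcal G_i|\ge n_{c^*(i)}(1-\tilde\eta_{n,0})\}$, one has $|[n]\setminus\mathcal H|\le\tilde\eta_{n,1}n$, where $\tilde\eta_{n,1}=o((n\rho_n^2)^{-1}(\log n)^2)$ and $\tilde\eta_{n,0}=o((n\rho_n^2)^{-1/2}\log n)$; \item for some $\phi_{2,n}$, $|\{i:D_i^{1/2}\ge\phi_{2,n}\}|>n(1-\tilde\eta_{n,2})$,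 where $\tilde\eta_{n,2}=o((\log n)^2(n\rho_n^2)^{-1})$, and $\max_iD_i\le C_4K^2/n$; \item $C_3\dfrac{K}{\sqrt n}\ \ge\ \phi_{1,n}\phi_{2,n}\ \ge\ C_2\dfrac{\rho_nK\sqrt{\log n}}{\sigma_{K^2,n}}$. \end{enumerate} \emph{Conclusion.} There is a sequence $\tilde\eta_n=o(1)$ such that, for every $n\ge N_0$ and every output $\hat c^{(0)}$ of TCSC on $A$ with threshold $d_n=\phi_{1,n}/2$ and accuracy $\varepsilon$, $$\mathbb P\{\ell(c^*,\hat c^{(0)})\le\tilde\eta_n\}\ \ge\ 1-Cn^{-4}.$$ -/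

import Mathlib

open Matrix MeasureTheory ProbabilityTheory Filter Topology Asymptotics

namespace PABM

noncomputable section

/-! ### The Popularity Adjusted Block Model -/

/-- The edge probability matrix `θ i j = Λ i (c j) * Λ j (c i)` (diagonal included) of the PABM with
popularity matrix `Λ` and community labels `c`. -/
def edgeProb {n K : ℕ} (Λ : Matrix (Fin n) (Fin K) ℝ) (c : Fin n → Fin K) :
    Matrix (Fin n) (Fin n) ℝ :=
  Matrix.of fun i j => Λ i (c j) * Λ j (c i)

/-- The random matrix `A` is the adjacency matrix of an undirected random graph without self-loops
whose edges are independent, the edge `{i, j}` being present with probability `Θ i j`. -/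
structure IsRandomGraph {Ω : Type*} [MeasurableSpace Ω] (P : Measure Ω) {n : ℕ}
    (Θ : Matrix (Fin n) (Fin n) ℝ) (A : Ω → Matrix (Fin n) (Fin n) ℝ) : Prop where
  measurable_entry : ∀ i j, Measurable fun ω => A ω i j
  zero_or_one : ∀ ω i j, A ω i j = 0 ∨ A ω i j = 1
  symm : ∀ ω i j, A ω i j = A ω j i
  diag_eq_zero : ∀ ω i, A ω i i = 0
  prob_edge : ∀ i j, i < j → P {ω | A ω i j = 1} = ENNReal.ofReal (Θ i j)
  indep : iIndepFun
    (fun (e : {e : Fin n × Fin n // e.1 < e.2}) (ω : Ω) => A ω e.1.1 e.1.2) P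

/-- The size `n_k(c)` of the community `k`. -/
def communitySize {n K : ℕ} (c : Fin n → Fin K) (k : Fin K) : ℕ :=
  (Finset.univ.filter fun i => c i = k).card

/-- The misclustering proportion, minimised over permutations of the labels. -/
def loss {n K : ℕ} (c chat : Fin n → Fin K) : ℝ :=
  ⨅ π : Equiv.Perm (Fin K),
    ((Finset.univ.filter fun i => c i ≠ π (chat i)).card : ℝ) / (n : ℝ)

/-! ### Spectral quantities -/

/-- The singular values of a square matrix, in decreasing order, indexed from `0` (the largest one
is `singVal M 0`), and continued by zeros. -/
def singVal {n : ℕ} (M : Matrix (Fin n) (Fin n) ℝ) : ℕ →₀ ℝ :=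
  (Matrix.toEuclideanLin M).singularValues

/-- The cosine of the angle between two real vectors (`0` if one of them vanishes). -/
def cosine {m : ℕ} (u v : Fin m → ℝ) : ℝ :=
  (u ⬝ᵥ v) / (Real.sqrt (u ⬝ᵥ u) * Real.sqrt (v ⬝ᵥ v))

/-- The angle-based similarity `|cos (ξ i, ξ j)|` of the rows `i` and `j` of the matrix `Ξ`. -/
def tau {n m : ℕ} (Ξ : Matrix (Fin n) (Fin m) ℝ) (i j : Fin n) : ℝ :=
  |cosine (Ξ i) (Ξ j)|

/-- `M = Ξ * diag(D) * Ξᵀ` is a (reduced) eigenvalue decomposition, with orthonormal eigenvectors as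
the columns of `Ξ`. -/
def IsEigendecomposition {n m : ℕ} (M : Matrix (Fin n) (Fin n) ℝ) (Ξ : Matrix (Fin n) (Fin m) ℝ)
    (D : Fin m → ℝ) : Prop :=
  Ξᵀ * Ξ = 1 ∧ M = Ξ * Matrix.diagonal D * Ξᵀ

/-- The columns of `Ξ` are `m` of the vectors of an orthonormal eigenbasis of `M`, corresponding to
the `m` eigenvalues that are largest in absolute value (ties are broken arbitrarily). -/
def IsLeadingEigenvectors {n m : ℕ} (M : Matrix (Fin n) (Fin n) ℝ)
    (Ξ : Matrix (Fin n) (Fin m) ℝ) : Prop :=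
  ∃ (V : Matrix (Fin n) (Fin n) ℝ) (D : Fin n → ℝ) (s : Fin m ↪ Fin n),
    IsEigendecomposition M V D ∧
    (∀ (r : Fin m) (j : Fin n), j ∉ Set.range s → |D j| ≤ |D (s r)|) ∧
    ∀ i r, Ξ i r = V i (s r)

/-! ### Thresholded cosine spectral clustering -/

/-- The thresholded similarities `1{|cos (ξ i, ξ j)| ≥ d}`. -/
def thresholded {n m : ℕ} (Ξ : Matrix (Fin n) (Fin m) ℝ) (d : ℝ) (i : Fin n) : Fin n → ℝ :=
  Set.indicator {j | d ≤ tau Ξ i j} 1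

/-- The K-means objective of the labelling `c` for the points `x 1, …, x n` of `ℝ ^ n`. -/
def kmeansCost {n K : ℕ} (x : Fin n → Fin n → ℝ) (c : Fin n → Fin K) : ℝ :=
  ∑ k : Fin K, ⨅ ν : Fin n → ℝ,
    ∑ i ∈ Finset.univ.filter (fun i => c i = k), ∑ j : Fin n, (x i j - ν j) ^ 2

/-- `chat` is a possible output of the TCSC algorithm with threshold `d` and accuracy `ε` on the
adjacency matrix `A`: it is a `(1 + ε)`-approximate solution of the K-means problem for the
thresholded similarities of the rows of the matrix of the `K ^ 2` leading eigenvectors of `A`. -/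
def IsTCSCOutput {n K : ℕ} (A : Matrix (Fin n) (Fin n) ℝ) (d ε : ℝ)
    (chat : Fin n → Fin K) : Prop :=
  ∃ Ξhat : Matrix (Fin n) (Fin (K ^ 2)) ℝ, IsLeadingEigenvectors A Ξhat ∧
    ∀ c' : Fin n → Fin K,
      kmeansCost (thresholded Ξhat d) chat ≤ (1 + ε) * kmeansCost (thresholded Ξhat d) c'

/-! ### The quantities in the assumptions -/

/-- The block `Λ^(k,·)` of the rows of `Λ` that belong to the community `k`. -/
def block {n K : ℕ} (Λ : Matrix (Fin n) (Fin K) ℝ) (c : Fin n → Fin K) (k : Fin K) :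
    Matrix {i : Fin n // c i = k} (Fin K) ℝ :=
  Λ.submatrix Subtype.val id

/-- `D_{P_k}(λ_i, λ_i) = λ_iᵀ P_k λ_i` with `k = c i` and `P_k = (Λ^(k,·)ᵀ Λ^(k,·))⁻¹`. -/
def selfForm {n K : ℕ} (Λ : Matrix (Fin n) (Fin K) ℝ) (c : Fin n → Fin K) (i : Fin n) : ℝ :=
  Λ i ⬝ᵥ (((block Λ c (c i))ᵀ * block Λ c (c i))⁻¹ *ᵥ Λ i)

/-- The set `G_i` of the nodes of the community of `i` whose similarity to `i` is at least `φ`. -/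
def similarNodes {n K m : ℕ} (c : Fin n → Fin K) (Ξ : Matrix (Fin n) (Fin m) ℝ) (φ : ℝ)
    (i : Fin n) : Set (Fin n) :=
  {j | c j = c i ∧ φ ≤ tau Ξ i j}

/-- The set `H` of the nodes that are similar to all but a proportion `η` of their community. -/
def clearNodes {n K m : ℕ} (c : Fin n → Fin K) (Ξ : Matrix (Fin n) (Fin m) ℝ) (φ η : ℝ) :
    Set (Fin n) :=
  {i | (communitySize c (c i) : ℝ) * (1 - η) ≤ ((similarNodes c Ξ φ i).ncard : ℝ)}

/-- The set `I` of the nodes `i` with `D_{P_k}(λ_i, λ_i) ^ (1/2) ≥ φ`, where `k = c i`. -/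
def strongNodes {n K : ℕ} (Λ : Matrix (Fin n) (Fin K) ℝ) (c : Fin n → Fin K) (φ : ℝ) :
    Set (Fin n) :=
  {i | φ ≤ Real.sqrt (selfForm Λ c i)}

end

end PABM

/-!
A cosine of two rows of a matrix `X` with orthonormal columns only depends on the projection
`X * Xᵀ`, because `X i ⬝ᵥ X j` is an inner product of two of its columns (`tau_eq`). So the
eigenvectors of `A` need not be aligned with those of `Θ` by a rotation: the projections
`Ξhat * Ξhatᵀ` and `Ξ * Ξᵀ` are compared column by column.

*The population projection.* `Θ = U * Π * Uᵀ`, where `Π` is a permutation matrix and `U` holds the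
rows of `Λ` in one block of columns per community. As `Θ` has rank `K ^ 2`, the range of `Θ` is that
of `U`, and `Ξ * Ξᵀ` is block diagonal, with the hat matrices of the blocks of `Λ` as its blocks
(`IsEigendecomposition.proj_eq`). Hence the rows of `Ξ` of nodes of different communities are
orthogonal, and the squared norm of the row `i` is `selfForm Λ c i`.

*The noise.* The law of `A` is a product of Bernoulli laws on a finite cube, where expectations are
finite sums. A discrete integration by parts (`bernMean_sum_centered_le`) bounds the moments of a
sum of centred variables, with vector or with matrix coefficients, by those of the sum of the squared
coefficients. At order `log n` this gives the bounds of Bernstein's inequality for the operator norm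
of `A - Θ`, for its columns, and, conditionally on the other edges, for a projection that does not
depend on the edges at `i`, applied to the column `i` of `A - Θ`. The graphs that satisfy these
bounds are the regular ones (`IsRegularGraph`); the others have probability at most `3 / n ^ 4`.

*Leave-one-out.* Let `A'` be `A` without the edges at `i`, and let `Q`, `Q'` be the projections on
leading eigenvectors of `A` and `A'`. By the Davis-Kahan argument, `Q - Q'` is small as soon as the
columns of `Q` are, and `Q'` is independent of the column `i` of `A - Θ`. The bound on that column
thus involves the largest column of `Q`, which the perturbation expansion bounds back; the resulting
self-bounding inequality (`norm_sub_apply_le_of_leaveOneOut`) shows that every column of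
`Ξhat * Ξhatᵀ - Ξ * Ξᵀ` is of the order `ρ * K * √(log n) / σ`, where `σ` is the smallest nonzero
singular value of `Θ`.

*Clustering.* This order is a small multiple of `φ₁ * φ₂`, by the lower bound on `φ₁ * φ₂`, while
the columns of `Ξ * Ξᵀ` of the strong nodes have norm at least `φ₂`. So the cosines of strong nodes
move by at most `φ₁ / 4`, and thresholding at `φ₁ / 2` is right for every pair of strong nodes that
lie in different communities or have similarity at least `φ₁`. The thresholded similarities are then
close, in total squared distance, to the indicators of the communities, which are at squared
distance of the order `n / K` from one another, and an approximate K-means solution can only misplace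
few nodes (`loss_le_of_kmeans`).
-/

/-! ### Independent Bernoulli variables on the cube -/

namespace PABM

section Bernoulli

variable {ι : Type*} [Fintype ι]

/-- The probability of the configuration `x` when the coordinates are independent and the
coordinate `k` is `true` with probability `p k`. -/
noncomputable def bernWeight (p : ι → ℝ) (x : ι → Bool) : ℝ :=
  ∏ k, if x k then p k else 1 - p k

/-- The Boolean `b` as the number `0` or `1`. -/
def bit (b : Bool) : ℝ := if b then 1 else 0

@[simp] lemma bit_true : bit true = 1 := rfl
@[simp] lemma bit_false : bit false = 0 := rfl

lemma bit_nonneg (b : Bool) : 0 ≤ bit b := by cases b <;> simp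

lemma bernWeight_nonneg {p : ι → ℝ} (hp : ∀ k, 0 ≤ p k ∧ p k ≤ 1) (x : ι → Bool) :
    0 ≤ bernWeight p x := by
  refine Finset.prod_nonneg fun k _ => ?_
  split_ifs
  · exact (hp k).1
  · linarith [(hp k).2]

variable [DecidableEq ι]

/-- The expectation of `f` under independent Bernoulli variables with parameters `p`. -/
noncomputable def bernMean (p : ι → ℝ) (f : (ι → Bool) → ℝ) : ℝ :=
  ∑ x, bernWeight p x * f x

lemma bernMean_mono {p : ι → ℝ} (hp : ∀ k, 0 ≤ p k ∧ p k ≤ 1) {f g : (ι → Bool) → ℝ}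
    (h : ∀ x, f x ≤ g x) : bernMean p f ≤ bernMean p g :=
  Finset.sum_le_sum fun x _ => mul_le_mul_of_nonneg_left (h x) (bernWeight_nonneg hp x)

lemma bernMean_add (p : ι → ℝ) (f g : (ι → Bool) → ℝ) :
    bernMean p (fun x => f x + g x) = bernMean p f + bernMean p g := by
  simp [bernMean, mul_add, Finset.sum_add_distrib]

lemma bernMean_const_mul (p : ι → ℝ) (a : ℝ) (f : (ι → Bool) → ℝ) :
    bernMean p (fun x => a * f x) = a * bernMean p f := by
  simp only [bernMean, Finset.mul_sum]
  exact Finset.sum_congr rfl fun x _ => by ring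

lemma bernMean_sum (p : ι → ℝ) {κ : Type*} (s : Finset κ) (f : κ → (ι → Bool) → ℝ) :
    bernMean p (fun x => ∑ k ∈ s, f k x) = ∑ k ∈ s, bernMean p (f k) := by
  simp only [bernMean, Finset.mul_sum]
  exact Finset.sum_comm

lemma bernMean_one (p : ι → ℝ) : bernMean p (fun _ => 1) = 1 := by
  have h := Finset.prod_univ_sum (fun _ : ι => (Finset.univ : Finset Bool))
    (fun k (b : Bool) => if b then p k else 1 - p k)
  simp only [Fintype.piFinset_univ] at h
  simp only [bernMean, bernWeight, mul_one]
  rw [← h]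
  simp

/-- Averaging over the coordinate `k` does not change the expectation. -/
lemma bernMean_resample (p : ι → ℝ) (k : ι) (f : (ι → Bool) → ℝ) :
    bernMean p f = bernMean p (fun x =>
      p k * f (Function.update x k true) + (1 - p k) * f (Function.update x k false)) := by
  -- pair every configuration with the one that differs from it at `k` only
  let flip : (ι → Bool) → (ι → Bool) := fun x => Function.update x k (!(x k))
  have hflip : Function.Involutive flip := by
    intro x
    simp [flip]
  have key : ∀ F : (ι → Bool) → ℝ, ∑ x, F x = (1 / 2) * ∑ x, (F x + F (flip x)) := by
    intro F
    have : ∑ x, F (flip x) = ∑ x, F x := hflip.toPerm.sum_comp Finset.univ F (by simp)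
    rw [Finset.sum_add_distrib, this]
    ring
  have hw : ∀ x b, bernWeight p (Function.update x k b) =
      (if b then p k else 1 - p k) * ∏ l ∈ Finset.univ.erase k, if x l then p l else 1 - p l := by
    intro x b
    rw [bernWeight, ← Finset.mul_prod_erase _ _ (Finset.mem_univ k)]
    congr 1
    · simp
    · refine Finset.prod_congr rfl fun l hl => ?_
      rw [Function.update_of_ne (Finset.ne_of_mem_erase hl)]
  unfold bernMean
  rw [key, key (fun x => bernWeight p x *
      (p k * f (Function.update x k true) + (1 - p k) * f (Function.update x k false)))]
  congr 1
  refine Finset.sum_congr rfl fun x _ => ?_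
  have hx : Function.update x k (x k) = x := Function.update_eq_self k x
  have h1 := hw x true
  have h0 := hw x false
  cases hb : x k
  · rw [hb] at hx
    simp only [flip, hb, Bool.not_false, Function.update_idem, h1]
    rw [← hx, Function.update_idem, Function.update_idem, h0]
    simp only [hx]
    simp
    ring
  · rw [hb] at hx
    simp only [flip, hb, Bool.not_true, Function.update_idem, h0]
    rw [← hx, Function.update_idem, Function.update_idem, h1]
    simp only [hx]
    simp
    ring

/-- The discrete integration by parts behind all the moment bounds: a sum of centred variables,
each multiplied by a function `g k` of the configuration, is controlled by the increments of `g k`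
in the coordinate `k`. -/
lemma bernMean_sum_centered_le {p : ι → ℝ} (hp : ∀ k, 0 ≤ p k ∧ p k ≤ 1) (J : Finset ι)
    (g G : ι → (ι → Bool) → ℝ) {c : ℝ} (hc : 0 ≤ c) (hG : ∀ k x, 0 ≤ G k x)
    (h : ∀ k ∈ J, ∀ x, g k (Function.update x k true) - g k (Function.update x k false) ≤
      c * (G k (Function.update x k true) + G k (Function.update x k false))) :
    bernMean p (fun x => ∑ k ∈ J, (bit (x k) - p k) * g k x) ≤
      c * bernMean p (fun x => ∑ k ∈ J, (bit (x k) + p k) * G k x) := by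
  rw [bernMean_sum, bernMean_sum, Finset.mul_sum]
  refine Finset.sum_le_sum fun k hk => ?_
  have h2 : bernMean p (fun x => ((1 - p k) * bit (x k) + p k * (1 - bit (x k))) * G k x) ≤
      bernMean p (fun x => (bit (x k) + p k) * G k x) := by
    refine bernMean_mono hp fun x => mul_le_mul_of_nonneg_right ?_ (hG k x)
    have := (hp k).1
    cases x k
    · simp
    · simp
      linarith
  refine le_trans ?_ (mul_le_mul_of_nonneg_left h2 hc)
  rw [bernMean_resample p k, bernMean_resample p k (fun x =>
    ((1 - p k) * bit (x k) + p k * (1 - bit (x k))) * G k x), ← bernMean_const_mul]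
  refine bernMean_mono hp fun x => ?_
  -- given the other coordinates, the centred variable averages to `p * (1 - p)` times the increment
  simp only [Function.update_self, bit_true, bit_false]
  have h3 := mul_le_mul_of_nonneg_left (h k hk x)
    (mul_nonneg (hp k).1 (sub_nonneg.2 (hp k).2))
  nlinarith [h3]

/-- The probability of the event `S` under independent Bernoulli variables with parameters `p`. -/
noncomputable def bernProb (p : ι → ℝ) (S : Set (ι → Bool)) : ℝ :=
  bernMean p (S.indicator fun _ => 1)

lemma bernProb_mono {p : ι → ℝ} (hp : ∀ k, 0 ≤ p k ∧ p k ≤ 1) {S T : Set (ι → Bool)}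
    (h : S ⊆ T) : bernProb p S ≤ bernProb p T :=
  bernMean_mono hp fun x => Set.indicator_le_indicator_of_subset h (fun _ => zero_le_one) x

lemma bernProb_union_le {p : ι → ℝ} (hp : ∀ k, 0 ≤ p k ∧ p k ≤ 1) (S T : Set (ι → Bool)) :
    bernProb p (S ∪ T) ≤ bernProb p S + bernProb p T := by
  rw [bernProb, bernProb, bernProb, ← bernMean_add]
  refine bernMean_mono hp fun x => ?_
  by_cases hS : x ∈ S <;> by_cases hT : x ∈ T <;> simp [hS, hT]

lemma bernProb_iUnion_le {p : ι → ℝ} (hp : ∀ k, 0 ≤ p k ∧ p k ≤ 1) {κ : Type*} [Fintype κ]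
    (S : κ → Set (ι → Bool)) : bernProb p (⋃ i, S i) ≤ ∑ i, bernProb p (S i) := by
  simp only [bernProb]
  rw [← bernMean_sum]
  refine bernMean_mono hp fun x => ?_
  have h0 : ∀ i, 0 ≤ (S i).indicator (fun _ => (1 : ℝ)) x := fun i =>
    Set.indicator_nonneg (fun _ _ => zero_le_one) x
  by_cases h : x ∈ ⋃ i, S i
  · obtain ⟨i, hi⟩ := Set.mem_iUnion.1 h
    rw [Set.indicator_of_mem h]
    calc (1 : ℝ) = (S i).indicator (fun _ => (1 : ℝ)) x := by rw [Set.indicator_of_mem hi]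
      _ ≤ _ := Finset.single_le_sum (f := fun i => (S i).indicator (fun _ => (1 : ℝ)) x)
          (fun j _ => h0 j) (Finset.mem_univ i)
  · rw [Set.indicator_of_notMem h]
    exact Finset.sum_nonneg fun i _ => h0 i

/-- Markov's inequality for a moment of order `q`. For `q` at least `log n` the factor `e ^ (-6 q)`
is at most `n ^ (-6)`, which leaves room for a union bound over `n ^ 2` events. -/
lemma bernProb_le_of_moment {p : ι → ℝ} (hp : ∀ k, 0 ≤ p k ∧ p k ≤ 1) {f : (ι → Bool) → ℝ}
    (hf : ∀ x, 0 ≤ f x) {q : ℕ} {N W : ℝ} (hW : 0 < W)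
    (h : bernMean p (fun x => f x ^ q) ≤ N * (Real.exp 3 * W) ^ q) :
    bernProb p {x | Real.exp 9 * W ≤ f x} ≤ N * Real.exp (-(6 * q)) := by
  have ht : 0 < (Real.exp 9 * W) ^ q := by positivity
  have h1 : (Real.exp 9 * W) ^ q * bernProb p {x | Real.exp 9 * W ≤ f x} ≤
      bernMean p (fun x => f x ^ q) := by
    rw [bernProb, ← bernMean_const_mul]
    refine bernMean_mono hp fun x => ?_
    by_cases hx : x ∈ {x | Real.exp 9 * W ≤ f x}
    · rw [Set.indicator_of_mem hx, mul_one]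
      exact pow_le_pow_left₀ (by positivity) hx q
    · rw [Set.indicator_of_notMem hx, mul_zero]
      exact pow_nonneg (hf x) q
  have h2 : N * (Real.exp 3 * W) ^ q = (Real.exp 9 * W) ^ q * (N * Real.exp (-(6 * q))) := by
    have : Real.exp 3 = Real.exp 9 * Real.exp (-6) := by rw [← Real.exp_add]; norm_num
    rw [this, mul_right_comm, mul_pow, ← Real.exp_nat_mul]
    ring_nf
  rw [h2] at h
  exact le_of_mul_le_mul_left (h1.trans h) ht

/-- Exponential moments of a weighted sum of Bernoulli variables, where the weight may depend on the
coordinates outside of `J₀`. -/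
lemma bernMean_exp_le_one {p : ι → ℝ} (hp : ∀ k, 0 ≤ p k ∧ p k ≤ 1) (J₀ : Finset ι)
    (t : ι → (ι → Bool) → ℝ) (ht0 : ∀ k ∈ J₀, ∀ x, 0 ≤ t k x) (ht1 : ∀ k ∈ J₀, ∀ x, t k x ≤ 1)
    (hinv : ∀ k ∈ J₀, ∀ l ∈ J₀, ∀ x b, t k (Function.update x l b) = t k x)
    (J : Finset ι) (hJ : J ⊆ J₀) :
    bernMean p (fun x => Real.exp (∑ k ∈ J, (t k x * bit (x k) - 2 * (p k * t k x)))) ≤ 1 := by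
  induction J using Finset.induction_on with
  | empty => simp [bernMean_one]
  | insert l J hl ih =>
    refine le_trans ?_ (ih fun k hk => hJ (Finset.mem_insert_of_mem hk))
    -- average over the new coordinate first: the other factors do not depend on it
    rw [bernMean_resample p l]
    refine bernMean_mono hp fun x => ?_
    have hl0 : l ∈ J₀ := hJ (Finset.mem_insert_self l J)
    have hsum : ∀ b, ∑ k ∈ insert l J, (t k (Function.update x l b) *
        bit (Function.update x l b k) - 2 * (p k * t k (Function.update x l b))) =
        (t l x * bit b - 2 * (p l * t l x)) + ∑ k ∈ J, (t k x * bit (x k) - 2 * (p k * t k x)) := by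
      intro b
      rw [Finset.sum_insert hl]
      congr 1
      · simp [hinv l hl0 l hl0 x b]
      · refine Finset.sum_congr rfl fun k hk => ?_
        rw [hinv k (hJ (Finset.mem_insert_of_mem hk)) l hl0 x b,
          Function.update_of_ne (by rintro rfl; exact hl hk)]
    rw [hsum, hsum, Real.exp_add, Real.exp_add]
    have h0 := ht0 l hl0 x
    have h1 := ht1 l hl0 x
    set s := t l x
    -- `e ^ s ≤ 1 + 2 s` on the unit interval
    have hs : Real.exp s ≤ 1 + 2 * s := by
      have := Real.abs_exp_sub_one_sub_id_le (x := s) (by rw [abs_of_nonneg h0]; exact h1)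
      have := (abs_le.1 this).2
      nlinarith
    have h2 : p l * Real.exp (s * bit true - 2 * (p l * s)) +
        (1 - p l) * Real.exp (s * bit false - 2 * (p l * s)) ≤ 1 := by
      have e1 : Real.exp (s * bit true - 2 * (p l * s)) =
          Real.exp s * Real.exp (-(2 * (p l * s))) := by rw [← Real.exp_add]; simp; ring
      have e0 : Real.exp (s * bit false - 2 * (p l * s)) = Real.exp (-(2 * (p l * s))) := by simp
      rw [e1, e0]
      have h4 : p l * Real.exp s + (1 - p l) ≤ Real.exp (2 * (p l * s)) := by
        have := Real.add_one_le_exp (2 * (p l * s))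
        nlinarith [(hp l).1]
      calc _ = (p l * Real.exp s + (1 - p l)) * Real.exp (-(2 * (p l * s))) := by ring
        _ ≤ Real.exp (2 * (p l * s)) * Real.exp (-(2 * (p l * s))) :=
            mul_le_mul_of_nonneg_right h4 (Real.exp_nonneg _)
        _ = 1 := by rw [← Real.exp_add]; simp
    have h5 := mul_le_mul_of_nonneg_right h2
      (Real.exp_nonneg (∑ k ∈ J, (t k x * bit (x k) - 2 * (p k * t k x))))
    calc _ = (p l * Real.exp (s * bit true - 2 * (p l * s)) +
        (1 - p l) * Real.exp (s * bit false - 2 * (p l * s))) *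
        Real.exp (∑ k ∈ J, (t k x * bit (x k) - 2 * (p k * t k x))) := by ring
      _ ≤ _ := by simpa using h5

/-- Moments of a nonnegative weighted sum of Bernoulli variables, from its exponential moments: up
to the order `q` with `q * u ≤ V`, they are those of a constant of the order `V`. -/
lemma bernMean_weighted_pow_le {p : ι → ℝ} (hp : ∀ k, 0 ≤ p k ∧ p k ≤ 1) (J : Finset ι)
    (u : ι → (ι → Bool) → ℝ) (hu : ∀ k ∈ J, ∀ x, 0 ≤ u k x)
    (hinv : ∀ k ∈ J, ∀ l ∈ J, ∀ x b, u k (Function.update x l b) = u k x)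
    {q : ℕ} {V : ℝ} (hV : 0 < V) (hq : ∀ k ∈ J, ∀ x, q * u k x ≤ V)
    (hsum : ∀ x, ∑ k ∈ J, p k * u k x ≤ V) :
    bernMean p (fun x => (∑ k ∈ J, (bit (x k) + p k) * u k x) ^ q) ≤
      (Real.exp 3 * V) ^ q := by
  have h1 := bernMean_exp_le_one hp J (fun k x => q * u k x / V)
    (fun k hk x => div_nonneg (mul_nonneg (Nat.cast_nonneg q) (hu k hk x)) hV.le)
    (fun k hk x => (div_le_one hV).2 (hq k hk x))
    (fun k hk l hl x b => by simp only [hinv k hk l hl x b]) J subset_rfl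
  have h2 : ∀ x, (∑ k ∈ J, (bit (x k) + p k) * u k x) ^ q ≤ (Real.exp 3 * V) ^ q *
      Real.exp (∑ k ∈ J, (q * u k x / V * bit (x k) - 2 * (p k * (q * u k x / V)))) := by
    intro x
    set δ := ∑ k ∈ J, (bit (x k) + p k) * u k x with hδ
    have hδ0 : 0 ≤ δ := Finset.sum_nonneg fun k hk =>
      mul_nonneg (add_nonneg (bit_nonneg _) (hp k).1) (hu k hk x)
    have hid : ∑ k ∈ J, (q * u k x / V * bit (x k) - 2 * (p k * (q * u k x / V))) =
        q * (δ / V) - 3 * (q * ((∑ k ∈ J, p k * u k x) / V)) := by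
      rw [hδ, Finset.sum_div, Finset.sum_div, Finset.mul_sum, Finset.mul_sum, Finset.mul_sum,
        ← Finset.sum_sub_distrib]
      refine Finset.sum_congr rfl fun k _ => ?_
      field_simp
      ring
    have hle : q * (δ / V) - 3 * q ≤
        ∑ k ∈ J, (q * u k x / V * bit (x k) - 2 * (p k * (q * u k x / V))) := by
      rw [hid]
      have : (∑ k ∈ J, p k * u k x) / V ≤ 1 := (div_le_one hV).2 (hsum x)
      have := mul_le_mul_of_nonneg_left this (Nat.cast_nonneg (α := ℝ) q)
      linarith
    have hy : δ / V ≤ Real.exp (δ / V) := by linarith [Real.add_one_le_exp (δ / V)]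
    calc δ ^ q = V ^ q * (δ / V) ^ q := by rw [← mul_pow, mul_div_cancel₀ _ hV.ne']
      _ ≤ V ^ q * (Real.exp (δ / V)) ^ q := by
          gcongr
      _ = (Real.exp 3 * V) ^ q * Real.exp (q * (δ / V) - 3 * q) := by
          rw [mul_pow, ← Real.exp_nat_mul, ← Real.exp_nat_mul, mul_right_comm, ← Real.exp_add,
            mul_comm (V ^ q)]
          congr 2
          ring
      _ ≤ _ := by gcongr
  calc _ ≤ bernMean p (fun x => (Real.exp 3 * V) ^ q * Real.exp (∑ k ∈ J, (q * u k x / V *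
        bit (x k) - 2 * (p k * (q * u k x / V))))) := bernMean_mono hp h2
    _ ≤ (Real.exp 3 * V) ^ q * 1 := by
        rw [bernMean_const_mul]
        exact mul_le_mul_of_nonneg_left h1 (by positivity)
    _ = _ := mul_one _

end Bernoulli

end PABM

/-! ### Moment inequalities -/

namespace PABM

lemma eigendecomposition_exists {n : ℕ} {M : Matrix (Fin n) (Fin n) ℝ} (hM : Mᵀ = M) :
    ∃ (U : Matrix (Fin n) (Fin n) ℝ) (w : Fin n → ℝ), IsEigendecomposition M U w := by
  have hH : M.IsHermitian := by
    rw [Matrix.IsHermitian, Matrix.conjTranspose_eq_transpose_of_trivial, hM]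
  refine ⟨hH.eigenvectorUnitary, hH.eigenvalues, ?_, ?_⟩
  · have := Unitary.coe_star_mul_self hH.eigenvectorUnitary
    rwa [Matrix.star_eq_conjTranspose, Matrix.conjTranspose_eq_transpose_of_trivial] at this
  · have := hH.spectral_theorem
    rw [Unitary.conjStarAlgAut_apply] at this
    rwa [Matrix.star_eq_conjTranspose, Matrix.conjTranspose_eq_transpose_of_trivial] at this

lemma IsEigendecomposition.pow {n : ℕ} {M U : Matrix (Fin n) (Fin n) ℝ} {w : Fin n → ℝ}
    (h : IsEigendecomposition M U w) (a : ℕ) :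
    M ^ a = U * Matrix.diagonal (fun i => w i ^ a) * Uᵀ := by
  obtain ⟨h1, h2⟩ := h
  induction a with
  | zero =>
    have : U * Uᵀ = 1 := mul_eq_one_comm.1 h1
    simp [this]
  | succ a ih =>
    rw [pow_succ, ih]
    nth_rewrite 1 [h2]
    calc _ = U * diagonal (fun i => w i ^ a) * (Uᵀ * U) * diagonal w * Uᵀ := by
          simp only [Matrix.mul_assoc]
      _ = _ := by
          rw [h1, Matrix.mul_one, Matrix.mul_assoc U, Matrix.diagonal_mul_diagonal]
          simp only [pow_succ]

/-- Traces of products of powers of two symmetric matrices are sums over pairs of eigenvalues, with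
nonnegative weights. -/
lemma exists_trace_pow_mul_pow {n : ℕ} {W Y : Matrix (Fin n) (Fin n) ℝ} (hW : Wᵀ = W)
    (hY : Yᵀ = Y) : ∃ (w y : Fin n → ℝ) (c : Fin n → Fin n → ℝ), (∀ i j, 0 ≤ c i j) ∧
      ∀ a b : ℕ, (W ^ a * Y ^ b).trace = ∑ i, ∑ j, c i j * (w i ^ a * y j ^ b) := by
  obtain ⟨U, w, hU⟩ := eigendecomposition_exists hW
  obtain ⟨V, y, hV⟩ := eigendecomposition_exists hY
  refine ⟨w, y, fun i j => (Uᵀ * V) i j ^ 2, fun i j => sq_nonneg _, fun a b => ?_⟩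
  rw [hU.pow, hV.pow]
  have : (U * diagonal (fun i => w i ^ a) * Uᵀ * (V * diagonal (fun i => y i ^ b) * Vᵀ)).trace =
      ((diagonal (fun i => w i ^ a) * (Uᵀ * V)) *
        (diagonal (fun i => y i ^ b) * (Uᵀ * V)ᵀ)).trace := by
    rw [Matrix.transpose_mul, Matrix.transpose_transpose]
    calc _ = (U * (diagonal (fun i => w i ^ a) * Uᵀ *
          (V * diagonal (fun i => y i ^ b) * Vᵀ))).trace := by
          simp only [Matrix.mul_assoc]
      _ = _ := by rw [Matrix.trace_mul_comm]; simp only [Matrix.mul_assoc]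
  rw [this, Matrix.trace]
  refine Finset.sum_congr rfl fun i _ => ?_
  rw [Matrix.diag_apply, Matrix.mul_apply]
  refine Finset.sum_congr rfl fun j _ => ?_
  rw [Matrix.diagonal_mul, Matrix.diagonal_mul, Matrix.transpose_apply]
  ring

/-- The mean of the convex function `t ^ (2 q)` on an interval is at most the mean of its values at
the ends. -/
lemma sub_mul_pow_sub_pow_le (a b : ℝ) (q : ℕ) :
    (a - b) * (a ^ (2 * q + 1) - b ^ (2 * q + 1)) ≤
      (2 * q + 1) / 2 * ((a - b) ^ 2 * (a ^ (2 * q) + b ^ (2 * q))) := by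
  have h1 := geom_sum₂_mul a b (2 * q + 1)
  simp only [Nat.add_sub_cancel] at h1
  rw [← h1]
  set s := ∑ i ∈ Finset.range (2 * q + 1), a ^ i * b ^ (2 * q - i) with hs
  have h2 : 2 * s ≤ (2 * q + 1) * (a ^ (2 * q) + b ^ (2 * q)) := by
    have hr : ∑ i ∈ Finset.range (2 * q + 1), a ^ (2 * q - i) * b ^ i = s := by
      rw [hs, ← Finset.sum_range_reflect]
      refine Finset.sum_congr rfl fun i hi => ?_
      have : i ≤ 2 * q := Nat.lt_succ_iff.1 (Finset.mem_range.1 hi)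
      simp only [Nat.add_sub_cancel]
      rw [Nat.sub_sub_self this]
    have h3 : ∀ i ∈ Finset.range (2 * q + 1), a ^ i * b ^ (2 * q - i) + a ^ (2 * q - i) * b ^ i ≤
        a ^ (2 * q) + b ^ (2 * q) := by
      intro i hi
      have hi' : i ≤ 2 * q := Nat.lt_succ_iff.1 (Finset.mem_range.1 hi)
      have hA : |a| ^ (2 * q) = a ^ (2 * q) := by rw [pow_mul, sq_abs, ← pow_mul]
      have hB : |b| ^ (2 * q) = b ^ (2 * q) := by rw [pow_mul, sq_abs, ← pow_mul]
      have hA' : |a| ^ i * |a| ^ (2 * q - i) = |a| ^ (2 * q) := by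
        rw [← pow_add, Nat.add_sub_cancel' hi']
      have hB' : |b| ^ i * |b| ^ (2 * q - i) = |b| ^ (2 * q) := by
        rw [← pow_add, Nat.add_sub_cancel' hi']
      have h4 : a ^ i * b ^ (2 * q - i) ≤ |a| ^ i * |b| ^ (2 * q - i) := by
        rw [← abs_pow, ← abs_pow, ← abs_mul]; exact le_abs_self _
      have h5 : a ^ (2 * q - i) * b ^ i ≤ |a| ^ (2 * q - i) * |b| ^ i := by
        rw [← abs_pow, ← abs_pow, ← abs_mul]; exact le_abs_self _
      have h6 : 0 ≤ (|a| ^ i - |b| ^ i) * (|a| ^ (2 * q - i) - |b| ^ (2 * q - i)) := by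
        rcases le_total |a| |b| with h | h
        · exact mul_nonneg_of_nonpos_of_nonpos (sub_nonpos.2 (pow_le_pow_left₀ (abs_nonneg _) h _))
            (sub_nonpos.2 (pow_le_pow_left₀ (abs_nonneg _) h _))
        · exact mul_nonneg (sub_nonneg.2 (pow_le_pow_left₀ (abs_nonneg _) h _))
            (sub_nonneg.2 (pow_le_pow_left₀ (abs_nonneg _) h _))
      nlinarith
    have h7 := Finset.sum_le_sum h3
    rw [Finset.sum_add_distrib, hr, Finset.sum_const, Finset.card_range, nsmul_eq_mul] at h7
    push_cast at h7
    linarith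
  nlinarith [mul_le_mul_of_nonneg_left h2 (sq_nonneg (a - b))]

/-- `sub_mul_pow_sub_pow_le` for matrices: both sides are sums over pairs of eigenvalues of `W` and
`Y`, with the same nonnegative weights. -/
lemma trace_sub_mul_pow_sub_pow_le {n : ℕ} {W Y : Matrix (Fin n) (Fin n) ℝ} (hW : Wᵀ = W)
    (hY : Yᵀ = Y) (q : ℕ) :
    ((W - Y) * (W ^ (2 * q + 1) - Y ^ (2 * q + 1))).trace ≤
      (2 * q + 1) / 2 *
        (((W - Y) ^ 2 * W ^ (2 * q)).trace + ((W - Y) ^ 2 * Y ^ (2 * q)).trace) := by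
  obtain ⟨w, y, c, hc, h⟩ := exists_trace_pow_mul_pow hW hY
  have e1 : ((W - Y) * (W ^ (2 * q + 1) - Y ^ (2 * q + 1))).trace = ∑ i, ∑ j, c i j *
      ((w i - y j) * (w i ^ (2 * q + 1) - y j ^ (2 * q + 1))) := by
    have : ((W - Y) * (W ^ (2 * q + 1) - Y ^ (2 * q + 1))).trace =
        (W ^ (2 * q + 2) * Y ^ 0).trace - (W ^ 1 * Y ^ (2 * q + 1)).trace
          - (W ^ (2 * q + 1) * Y ^ 1).trace + (W ^ 0 * Y ^ (2 * q + 2)).trace := by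
      rw [Matrix.sub_mul, Matrix.mul_sub, Matrix.mul_sub, Matrix.trace_sub, Matrix.trace_sub,
        Matrix.trace_sub, Matrix.trace_mul_comm Y (W ^ (2 * q + 1)), pow_succ' W (2 * q + 1),
        pow_succ' Y (2 * q + 1)]
      simp only [pow_zero, Matrix.mul_one, Matrix.one_mul, pow_one]
      ring
    rw [this, h, h, h, h]
    simp only [← Finset.sum_sub_distrib, ← Finset.sum_add_distrib]
    refine Finset.sum_congr rfl fun i _ => Finset.sum_congr rfl fun j _ => ?_
    ring
  have e2 : ((W - Y) ^ 2 * W ^ (2 * q)).trace = ∑ i, ∑ j, c i j *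
      ((w i - y j) ^ 2 * w i ^ (2 * q)) := by
    have : ((W - Y) ^ 2 * W ^ (2 * q)).trace =
        (W ^ (2 * q + 2) * Y ^ 0).trace - (W ^ (2 * q + 1) * Y ^ 1).trace
          - (W ^ (2 * q + 1) * Y ^ 1).trace + (W ^ (2 * q) * Y ^ 2).trace := by
      have s1 : (W - Y) ^ 2 * W ^ (2 * q) = W ^ (2 * q + 2) - W * (Y * W ^ (2 * q)) -
          Y * W ^ (2 * q + 1) + Y ^ 2 * W ^ (2 * q) := by
        rw [pow_succ' W (2 * q + 1), pow_succ' W (2 * q)]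
        noncomm_ring
      rw [s1, Matrix.trace_add, Matrix.trace_sub, Matrix.trace_sub,
        Matrix.trace_mul_comm W (Y * W ^ (2 * q)), Matrix.mul_assoc Y, ← pow_succ,
        Matrix.trace_mul_comm Y, Matrix.trace_mul_comm (Y ^ 2)]
      simp only [pow_zero, Matrix.mul_one, pow_one]
    rw [this, h, h, h]
    simp only [← Finset.sum_sub_distrib, ← Finset.sum_add_distrib]
    refine Finset.sum_congr rfl fun i _ => Finset.sum_congr rfl fun j _ => ?_
    ring
  have e3 : ((W - Y) ^ 2 * Y ^ (2 * q)).trace = ∑ i, ∑ j, c i j *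
      ((w i - y j) ^ 2 * y j ^ (2 * q)) := by
    have : ((W - Y) ^ 2 * Y ^ (2 * q)).trace =
        (W ^ 2 * Y ^ (2 * q)).trace - (W ^ 1 * Y ^ (2 * q + 1)).trace
          - (W ^ 1 * Y ^ (2 * q + 1)).trace + (W ^ 0 * Y ^ (2 * q + 2)).trace := by
      have s1 : (W - Y) ^ 2 * Y ^ (2 * q) = W ^ 2 * Y ^ (2 * q) - W * Y ^ (2 * q + 1) -
          Y * (W * Y ^ (2 * q)) + Y ^ (2 * q + 2) := by
        rw [pow_succ' Y (2 * q + 1), pow_succ' Y (2 * q)]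
        noncomm_ring
      rw [s1, Matrix.trace_add, Matrix.trace_sub, Matrix.trace_sub,
        Matrix.trace_mul_comm Y (W * Y ^ (2 * q)), Matrix.mul_assoc W, ← pow_succ]
      simp only [pow_zero, Matrix.one_mul, pow_one]
    rw [this, h, h, h]
    simp only [← Finset.sum_sub_distrib, ← Finset.sum_add_distrib]
    refine Finset.sum_congr rfl fun i _ => Finset.sum_congr rfl fun j _ => ?_
    ring
  rw [e1, e2, e3, ← Finset.sum_add_distrib, Finset.mul_sum]
  refine Finset.sum_le_sum fun i _ => ?_
  rw [← Finset.sum_add_distrib, Finset.mul_sum]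
  refine Finset.sum_le_sum fun j _ => ?_
  have := mul_le_mul_of_nonneg_left (sub_mul_pow_sub_pow_le (w i) (y j) q) (hc i j)
  linarith

/-- Young's inequality for the exponents `q + 1` and `(q + 1) / q`. -/
lemma mul_pow_le_pow_add {a b : ℝ} (ha : 0 ≤ a) (hb : 0 ≤ b) (q : ℕ) :
    (q + 1) * (a * b ^ q) ≤ a ^ (q + 1) + q * b ^ (q + 1) := by
  rcases hb.eq_or_lt with rfl | hb
  · rcases Nat.eq_zero_or_pos q with rfl | hq
    · simp
    · simp [hq.ne', pow_nonneg ha]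
  · have h := one_add_mul_le_pow (a := a / b - 1) (by have := div_nonneg ha hb.le; linarith) (q + 1)
    have h2 := mul_le_mul_of_nonneg_right h (pow_nonneg hb.le (q + 1))
    rw [← mul_pow] at h2
    have e : (1 + (a / b - 1)) * b = a := by field_simp; ring
    rw [e] at h2
    have e2 : (1 + ((q + 1 : ℕ) : ℝ) * (a / b - 1)) * b ^ (q + 1) =
        (q + 1) * (a * b ^ q) - q * b ^ (q + 1) := by
      push_cast
      field_simp
      ring
    linarith

/-- `sub_mul_pow_sub_pow_le` for the vector field `s ↦ ‖s‖ ^ (2 q) • s`. -/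
lemma inner_sub_pow_le {H : Type*} [NormedAddCommGroup H] [InnerProductSpace ℝ H] (s t : H)
    (q : ℕ) :
    inner ℝ (s - t) s * ‖s‖ ^ (2 * q) - inner ℝ (s - t) t * ‖t‖ ^ (2 * q) ≤
      (2 * q + 1) / 2 * (‖s - t‖ ^ 2 * ‖s‖ ^ (2 * q) + ‖s - t‖ ^ 2 * ‖t‖ ^ (2 * q)) := by
  have h1 := sub_mul_pow_sub_pow_le ‖s‖ ‖t‖ q
  have h2 : inner ℝ s t ≤ ‖s‖ * ‖t‖ := real_inner_le_norm s t
  rw [inner_sub_left, inner_sub_left, real_inner_self_eq_norm_sq, real_inner_self_eq_norm_sq,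
    real_inner_comm s t, norm_sub_sq_real]
  have h3 : 0 ≤ (‖s‖ * ‖t‖ - inner ℝ s t) * (2 * q * (‖s‖ ^ (2 * q) + ‖t‖ ^ (2 * q))) :=
    mul_nonneg (sub_nonneg.2 h2) (by positivity)
  rw [pow_succ, pow_succ] at h1
  nlinarith

end PABM

/-! ### Moments of centred sums -/

namespace PABM

open scoped Matrix.Norms.L2Operator

section Moments

variable {ι : Type*} [DecidableEq ι]

/-- A sum over `J` of centred Bernoulli variables, with coefficients in a vector space that may
depend on the configuration. -/
def centredSum {H : Type*} [AddCommGroup H] [Module ℝ H] (p : ι → ℝ) (J : Finset ι)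
    (v : ι → (ι → Bool) → H) (x : ι → Bool) : H :=
  ∑ k ∈ J, (bit (x k) - p k) • v k x

lemma centredSum_update_sub {H : Type*} [AddCommGroup H] [Module ℝ H] (p : ι → ℝ) (J : Finset ι)
    (v : ι → (ι → Bool) → H)
    (hinv : ∀ k ∈ J, ∀ l ∈ J, ∀ x b, v k (Function.update x l b) = v k x) {l : ι} (hl : l ∈ J)
    (x : ι → Bool) :
    centredSum p J v (Function.update x l true) - centredSum p J v (Function.update x l false) =
      v l x := by
  unfold centredSum
  rw [← Finset.sum_sub_distrib, Finset.sum_eq_single_of_mem l hl]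
  · rw [hinv l hl l hl, hinv l hl l hl, ← sub_smul]
    simp
  · intro k hk hkl
    rw [hinv k hk l hl, hinv k hk l hl, Function.update_of_ne hkl, Function.update_of_ne hkl,
      sub_self]

variable [Fintype ι]

lemma bernMean_le_of_self_bound {p : ι → ℝ} {T U : (ι → Bool) → ℝ} {q : ℕ}
    (h : (q + 1) * bernMean p T ≤ bernMean p (fun x => U x + q * T x)) :
    bernMean p T ≤ bernMean p U := by
  rw [bernMean_add, bernMean_const_mul] at h
  linarith

/-- Moments of the norm of a centred sum in a Hilbert space: Burkholder's inequality with the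
constant of order `q`. The coefficients may depend on the coordinates outside of `J`. -/
lemma bernMean_norm_centredSum_pow_le {H : Type*} [NormedAddCommGroup H] [InnerProductSpace ℝ H]
    {p : ι → ℝ} (hp : ∀ k, 0 ≤ p k ∧ p k ≤ 1) (J : Finset ι) (v : ι → (ι → Bool) → H)
    (hinv : ∀ k ∈ J, ∀ l ∈ J, ∀ x b, v k (Function.update x l b) = v k x) (q : ℕ) :
    bernMean p (fun x => ‖centredSum p J v x‖ ^ (2 * (q + 1))) ≤
      bernMean p (fun x => ((q + 1 : ℝ) * ∑ k ∈ J, (bit (x k) + p k) * ‖v k x‖ ^ 2) ^ (q + 1)) := by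
  refine bernMean_le_of_self_bound (q := q) ?_
  have h1 := bernMean_sum_centered_le hp J
    (fun k x => inner ℝ (v k x) (centredSum p J v x) * ‖centredSum p J v x‖ ^ (2 * q))
    (fun k x => ‖v k x‖ ^ 2 * ‖centredSum p J v x‖ ^ (2 * q)) (c := (2 * q + 1) / 2)
    (by positivity) (fun k x => by positivity) (fun k hk x => by
      have := inner_sub_pow_le (centredSum p J v (Function.update x k true))
        (centredSum p J v (Function.update x k false)) q
      rw [centredSum_update_sub p J v hinv hk] at this
      simp only [hinv k hk k hk]
      exact this)
  have h2 : (fun x => ‖centredSum p J v x‖ ^ (2 * (q + 1))) = fun x => ∑ k ∈ J,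
      (bit (x k) - p k) * (inner ℝ (v k x) (centredSum p J v x) *
        ‖centredSum p J v x‖ ^ (2 * q)) := by
    funext x
    simp only [← mul_assoc]
    rw [← Finset.sum_mul]
    have : ∑ k ∈ J, (bit (x k) - p k) * inner ℝ (v k x) (centredSum p J v x) =
        ‖centredSum p J v x‖ ^ 2 := by
      rw [← real_inner_self_eq_norm_sq]
      nth_rewrite 2 [centredSum]
      rw [sum_inner]
      exact Finset.sum_congr rfl fun k _ => (real_inner_smul_left _ _ _).symm
    rw [this, ← pow_add]
    congr 1
    ring
  -- Young's inequality leaves `q` of the `q + 1` copies of the moment on the right-hand side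
  calc _ ≤ (q + 1 : ℝ) * ((2 * q + 1) / 2 * bernMean p (fun x => ∑ k ∈ J, (bit (x k) + p k) *
        (‖v k x‖ ^ 2 * ‖centredSum p J v x‖ ^ (2 * q)))) := by
        rw [h2]
        exact mul_le_mul_of_nonneg_left h1 (by positivity)
    _ ≤ _ := by
        rw [← bernMean_const_mul, ← bernMean_const_mul]
        refine bernMean_mono hp fun x => ?_
        set δ := ∑ k ∈ J, (bit (x k) + p k) * ‖v k x‖ ^ 2 with hδ
        have hδ0 : 0 ≤ δ := Finset.sum_nonneg fun k _ =>
          mul_nonneg (add_nonneg (bit_nonneg _) (hp k).1) (sq_nonneg _)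
        have e : ∑ k ∈ J, (bit (x k) + p k) * (‖v k x‖ ^ 2 * ‖centredSum p J v x‖ ^ (2 * q)) =
            δ * (‖centredSum p J v x‖ ^ 2) ^ q := by
          rw [hδ, Finset.sum_mul, ← pow_mul]
          exact Finset.sum_congr rfl fun k _ => by ring
        rw [e, pow_mul]
        refine le_trans ?_ (mul_pow_le_pow_add (by positivity) (by positivity) q)
        have : 0 ≤ δ * (‖centredSum p J v x‖ ^ 2) ^ q := by positivity
        nlinarith [mul_nonneg (Nat.cast_nonneg (α := ℝ) q) this]

lemma diag_pow_even_nonneg {n : ℕ} {X : Matrix (Fin n) (Fin n) ℝ} (hX : Xᵀ = X) (q : ℕ)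
    (i : Fin n) : 0 ≤ (X ^ (2 * q)) i i := by
  rw [two_mul, pow_add, Matrix.mul_apply]
  refine Finset.sum_nonneg fun j _ => ?_
  have : (X ^ q) j i = (X ^ q) i j := by
    nth_rewrite 1 [← hX]
    rw [← Matrix.transpose_pow, Matrix.transpose_apply]
  rw [this]
  exact mul_self_nonneg _

lemma trace_pow_eq_sum {n : ℕ} {X U : Matrix (Fin n) (Fin n) ℝ} {w : Fin n → ℝ}
    (h : IsEigendecomposition X U w) (a : ℕ) : (X ^ a).trace = ∑ i, w i ^ a := by
  rw [h.pow, Matrix.trace_mul_comm, ← Matrix.mul_assoc, h.1, Matrix.one_mul,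
    Matrix.trace_diagonal]

lemma trace_pow_even_nonneg {n : ℕ} {X : Matrix (Fin n) (Fin n) ℝ} (hX : Xᵀ = X) (q : ℕ) :
    0 ≤ (X ^ (2 * q)).trace :=
  Finset.sum_nonneg fun i _ => diag_pow_even_nonneg hX q i

lemma mul_trace_pow_le {n : ℕ} {X : Matrix (Fin n) (Fin n) ℝ} (hX : Xᵀ = X) {a : ℝ} (ha : 0 ≤ a)
    (q : ℕ) : (q + 1) * (a * (X ^ (2 * q)).trace) ≤
      n * a ^ (q + 1) + q * (X ^ (2 * (q + 1))).trace := by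
  obtain ⟨U, w, h⟩ := eigendecomposition_exists hX
  rw [trace_pow_eq_sum h, trace_pow_eq_sum h, Finset.mul_sum, Finset.mul_sum, Finset.mul_sum]
  have : (n : ℝ) * a ^ (q + 1) = ∑ _i : Fin n, a ^ (q + 1) := by simp
  rw [this, ← Finset.sum_add_distrib]
  refine Finset.sum_le_sum fun i _ => ?_
  rw [pow_mul, pow_mul]
  exact mul_pow_le_pow_add ha (sq_nonneg _) q

/-- The trace moments of a symmetric matrix dominate its operator norm. -/
lemma norm_pow_le_trace {n : ℕ} {X : Matrix (Fin n) (Fin n) ℝ} (hX : Xᵀ = X) (q : ℕ) :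
    ‖X‖ ^ (2 * (q + 1)) ≤ (X ^ (2 * (q + 1))).trace := by
  obtain ⟨U, w, h⟩ := eigendecomposition_exists hX
  have hU : U ∈ unitary (Matrix (Fin n) (Fin n) ℝ) := by
    rw [Unitary.mem_iff, Matrix.star_eq_conjTranspose, Matrix.conjTranspose_eq_transpose_of_trivial]
    exact ⟨h.1, mul_eq_one_comm.1 h.1⟩
  have h1 : ‖X‖ = ‖w‖ := by
    have e : X = U * diagonal w * star U := by
      rw [Matrix.star_eq_conjTranspose, Matrix.conjTranspose_eq_transpose_of_trivial]; exact h.2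
    rw [e, CStarRing.norm_mul_mem_unitary _ (Unitary.star_mem hU),
      CStarRing.norm_mem_unitary_mul _ hU, Matrix.l2_opNorm_diagonal]
  rw [h1, trace_pow_eq_sum h]
  have h0 : 0 ≤ ∑ i, w i ^ (2 * (q + 1)) :=
    Finset.sum_nonneg fun i _ => by rw [pow_mul]; positivity
  rcases isEmpty_or_nonempty (Fin n) with he | he
  · have : w = 0 := Subsingleton.elim _ _
    simp [this]
  · obtain ⟨i, hi⟩ : ∃ i, ‖w‖ = ‖w i‖ := by
      obtain ⟨i, _, hi⟩ := Finset.exists_mem_eq_sup' (Finset.univ_nonempty (α := Fin n))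
        (fun i => ‖w i‖)
      refine ⟨i, le_antisymm ?_ (norm_le_pi_norm w i)⟩
      rw [← hi, pi_norm_le_iff_of_nonempty]
      exact fun j => Finset.le_sup' (fun i => ‖w i‖) (Finset.mem_univ j)
    rw [hi, Real.norm_eq_abs, pow_mul, sq_abs, ← pow_mul]
    exact Finset.single_le_sum (f := fun i => w i ^ (2 * (q + 1)))
      (fun i _ => by rw [pow_mul]; positivity) (Finset.mem_univ i)

/-- Trace moments of a sum of independent centred symmetric matrices whose squares are diagonal: a
moment form of the matrix Bernstein inequality. -/
lemma bernMean_trace_centredSum_pow_le {n : ℕ} {p : ι → ℝ} (hp : ∀ k, 0 ≤ p k ∧ p k ≤ 1)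
    (H : ι → Matrix (Fin n) (Fin n) ℝ) (hH : ∀ k, (H k)ᵀ = H k) (c : ι → Fin n → ℝ)
    (hc : ∀ k i, 0 ≤ c k i) (hsq : ∀ k, H k ^ 2 = diagonal (c k)) (q : ℕ) :
    bernMean p (fun x => ((centredSum p Finset.univ (fun k _ => H k) x) ^ (2 * (q + 1))).trace) ≤
      n * ∑ i, bernMean p (fun x =>
        ((q + 1 : ℝ) * ∑ k, (bit (x k) + p k) * c k i) ^ (q + 1)) := by
  rw [← bernMean_sum, ← bernMean_const_mul]
  refine bernMean_le_of_self_bound (q := q) ?_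
  set X := centredSum p Finset.univ (fun k (_ : ι → Bool) => H k) with hXdef
  have hX : ∀ x, (X x)ᵀ = X x := by
    intro x
    simp only [hXdef, centredSum, Matrix.transpose_sum, Matrix.transpose_smul, hH]
  have hG : ∀ k x, (H k ^ 2 * X x ^ (2 * q)).trace = ∑ i, c k i * (X x ^ (2 * q)) i i := by
    intro k x
    rw [hsq, Matrix.trace]
    exact Finset.sum_congr rfl fun i _ => by rw [Matrix.diag_apply, Matrix.diagonal_mul]
  have h1 := bernMean_sum_centered_le hp Finset.univ
    (fun k x => (H k * X x ^ (2 * q + 1)).trace) (fun k x => (H k ^ 2 * X x ^ (2 * q)).trace)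
    (c := (2 * q + 1) / 2) (by positivity)
    (fun k x => by
      rw [hG]
      exact Finset.sum_nonneg fun i _ => mul_nonneg (hc k i) (diag_pow_even_nonneg (hX x) q i))
    (fun k hk x => by
      have := trace_sub_mul_pow_sub_pow_le (hX (Function.update x k true))
        (hX (Function.update x k false)) q
      rw [hXdef, centredSum_update_sub p Finset.univ (fun k _ => H k) (fun _ _ _ _ _ _ => rfl) hk,
        ← hXdef, Matrix.mul_sub, Matrix.trace_sub] at this
      exact this)
  have h2 : (fun x => (X x ^ (2 * (q + 1))).trace) = fun x => ∑ k,
      (bit (x k) - p k) * (H k * X x ^ (2 * q + 1)).trace := by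
    funext x
    have : X x ^ (2 * (q + 1)) = (∑ k, (bit (x k) - p k) • H k) * X x ^ (2 * q + 1) := by
      rw [show 2 * (q + 1) = (2 * q + 1) + 1 by ring, pow_succ' (X x) (2 * q + 1)]
      rfl
    rw [this, Finset.sum_mul, Matrix.trace_sum]
    refine Finset.sum_congr rfl fun k _ => ?_
    rw [Matrix.smul_mul, Matrix.trace_smul, smul_eq_mul]
  calc _ ≤ (q + 1 : ℝ) * ((2 * q + 1) / 2 * bernMean p (fun x => ∑ k, (bit (x k) + p k) *
        (H k ^ 2 * X x ^ (2 * q)).trace)) := by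
        rw [h2]
        exact mul_le_mul_of_nonneg_left h1 (by positivity)
    _ ≤ _ := by
        rw [← bernMean_const_mul, ← bernMean_const_mul]
        refine bernMean_mono hp fun x => ?_
        set d : Fin n → ℝ := fun i => ∑ k, (bit (x k) + p k) * c k i with hd
        have hd0 : ∀ i, 0 ≤ d i := fun i => Finset.sum_nonneg fun k _ =>
          mul_nonneg (add_nonneg (bit_nonneg _) (hp k).1) (hc k i)
        have e : ∑ k, (bit (x k) + p k) * (H k ^ 2 * X x ^ (2 * q)).trace =
            ∑ i, d i * (X x ^ (2 * q)) i i := by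
          simp only [hG, hd, Finset.mul_sum, Finset.sum_mul]
          rw [Finset.sum_comm]
          exact Finset.sum_congr rfl fun i _ => Finset.sum_congr rfl fun k _ => by ring
        rw [e]
        -- the largest of the `d i`
        obtain ⟨a, ha0, had, haS⟩ : ∃ a, 0 ≤ a ∧ (∀ i, d i ≤ a) ∧
            ((q + 1) * a) ^ (q + 1) ≤ ∑ i, ((q + 1) * d i) ^ (q + 1) := by
          rcases isEmpty_or_nonempty (Fin n) with he | he
          · exact ⟨0, le_rfl, fun i => he.elim i, by simp⟩
          · obtain ⟨i, _, hi⟩ := Finset.exists_mem_eq_sup' (Finset.univ_nonempty (α := Fin n)) d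
            refine ⟨d i, hd0 i, fun j => ?_, ?_⟩
            · rw [← hi]; exact Finset.le_sup' d (Finset.mem_univ j)
            · exact Finset.single_le_sum (f := fun i => ((q + 1) * d i) ^ (q + 1))
                (fun j _ => pow_nonneg (mul_nonneg (by positivity) (hd0 j)) _) (Finset.mem_univ i)
        have h3 : ∑ i, d i * (X x ^ (2 * q)) i i ≤ a * (X x ^ (2 * q)).trace := by
          rw [Matrix.trace, Finset.mul_sum]
          exact Finset.sum_le_sum fun i _ => mul_le_mul_of_nonneg_right (had i)
            (diag_pow_even_nonneg (hX x) q i)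
        have h4 := mul_trace_pow_le (hX x) (a := (q + 1) * a) (by positivity) q
        have h5 : (n : ℝ) * ((q + 1) * a) ^ (q + 1) ≤ n * ∑ i, ((q + 1) * d i) ^ (q + 1) :=
          mul_le_mul_of_nonneg_left haS (Nat.cast_nonneg n)
        have h6 : 0 ≤ a * (X x ^ (2 * q)).trace := mul_nonneg ha0 (trace_pow_even_nonneg (hX x) q)
        have h7 : (q + 1 : ℝ) * ((2 * q + 1) / 2 * ∑ i, d i * (X x ^ (2 * q)) i i) ≤
            (q + 1) * ((q + 1) * a * (X x ^ (2 * q)).trace) := by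
          refine mul_le_mul_of_nonneg_left ?_ (by positivity)
          have := mul_le_mul_of_nonneg_left h3 (show (0 : ℝ) ≤ (2 * q + 1) / 2 by positivity)
          nlinarith
        linarith

end Moments

end PABM

/-! ### Perturbation of spectral projections -/

namespace PABM

section Perturbation

variable {H : Type*} [NormedAddCommGroup H] [InnerProductSpace ℝ H] [CompleteSpace H]

/-- `P` is an orthogonal projection that commutes with `A`; on its range `A` is invertible with
inverse `B` of norm at most `β`, and on its kernel the norm of `A` is at most `α`. -/
structure SpectralSplit (A P B : H →L[ℝ] H) (α β : ℝ) : Prop where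
  proj : IsStarProjection P
  inv_mul : B * A = P
  mul_inv : A * B = P
  inv_proj : B * P = B
  norm_inv : ‖B‖ ≤ β
  norm_compl : ‖A * (1 - P)‖ ≤ α

lemma SpectralSplit.comm {A P B : H →L[ℝ] H} {α β : ℝ} (h : SpectralSplit A P B α β) :
    A * P = P * A := by
  rw [← h.inv_mul, ← mul_assoc, h.mul_inv, h.inv_mul]

/-- A Davis-Kahan bound: the Sylvester equation for `(1 - P) * P'` shows that it is of the size of
the perturbation restricted to the range of `P'`. -/
lemma SpectralSplit.norm_compl_mul_proj_le {A P B A' P' B' : H →L[ℝ] H} {α β α' β' : ℝ}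
    (h : SpectralSplit A P B α β) (h' : SpectralSplit A' P' B' α' β') (hab : α * β' ≤ 1 / 2) :
    ‖(1 - P) * P'‖ ≤ 2 * β' * ‖(A - A') * P'‖ := by
  set Y := (1 - P) * P' with hY
  have hPP : P * P = P := h.proj.isIdempotentElem
  have hPP' : P' * P' = P' := h'.proj.isIdempotentElem
  have e1 : Y * A' * B' = Y := by
    rw [mul_assoc, h'.mul_inv, hY, mul_assoc, hPP']
  have e2 : Y * A' = A * (1 - P) * Y - (1 - P) * ((A - A') * P') := by
    have c1 : (1 - P) * (1 - P) = 1 - P := by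
      rw [mul_sub, sub_mul, sub_mul, hPP]; simp
    have c2 : A * (1 - P) * Y = (1 - P) * A * P' := by
      rw [hY, ← mul_assoc, mul_assoc A, c1, mul_sub, h.comm, sub_mul 1 P A, mul_one, one_mul]
    rw [c2, hY, mul_assoc, ← h'.comm]
    noncomm_ring
  have e3 : Y = A * (1 - P) * Y * B' - (1 - P) * ((A - A') * P') * B' := by
    rw [← sub_mul, ← e2, e1]
  have hβ' : 0 ≤ β' := (norm_nonneg _).trans h'.norm_inv
  have b1 : ‖A * (1 - P) * Y * B'‖ ≤ α * ‖Y‖ * β' :=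
    (norm_mul_le _ _).trans (mul_le_mul ((norm_mul_le _ _).trans
      (mul_le_mul_of_nonneg_right h.norm_compl (norm_nonneg _))) h'.norm_inv (norm_nonneg _)
      (mul_nonneg ((norm_nonneg _).trans h.norm_compl) (norm_nonneg _)))
  have b2 : ‖(1 - P) * ((A - A') * P') * B'‖ ≤ ‖(A - A') * P'‖ * β' := by
    refine (norm_mul_le _ _).trans (mul_le_mul ((norm_mul_le _ _).trans ?_) h'.norm_inv
      (norm_nonneg _) (norm_nonneg _))
    exact mul_le_of_le_one_left (norm_nonneg _) h.proj.one_sub.norm_le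
  have b3 : ‖Y‖ ≤ α * ‖Y‖ * β' + ‖(A - A') * P'‖ * β' := by
    nth_rewrite 1 [e3]
    exact (norm_sub_le _ _).trans (add_le_add b1 b2)
  nlinarith [mul_le_mul_of_nonneg_right hab (norm_nonneg Y)]

/-- First order bound for the spectral projection applied to a vector. -/
lemma SpectralSplit.norm_sub_apply_le {Θ P S A Q B : H →L[ℝ] H} {α σ : ℝ} (hσ : 0 < σ)
    (hΘ : SpectralSplit Θ P S 0 (1 / σ)) (hA : SpectralSplit A Q B α (2 / σ))
    (hα : α ≤ σ / 8) (e : H) :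
    ‖(Q - P) e‖ ≤ (4 * ‖A - Θ‖ * ‖P e‖ + 2 * ‖Q ((A - Θ) e)‖) / σ := by
  have hPP : P * P = P := hΘ.proj.isIdempotentElem
  have k0 : Θ * (1 - P) = 0 := norm_le_zero_iff.1 hΘ.norm_compl
  have h1 : ‖((1 - Q) * P) e‖ ≤ 2 * (1 / σ) * ‖A - Θ‖ * ‖P e‖ := by
    have e1 : ((1 - Q) * P) e = ((1 - Q) * P) (P e) := by
      rw [← mul_apply_eq_comp, mul_assoc, hPP]
    rw [e1]
    refine (ContinuousLinearMap.le_opNorm _ _).trans ?_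
    refine mul_le_mul_of_nonneg_right ?_ (norm_nonneg _)
    refine (hA.norm_compl_mul_proj_le hΘ ?_).trans ?_
    · rw [mul_one_div, div_le_iff₀ hσ]; linarith
    · refine mul_le_mul_of_nonneg_left ?_ (by positivity)
      exact (norm_mul_le _ _).trans (mul_le_of_le_one_right (norm_nonneg _)
        hΘ.proj.norm_le)
  have h2 : ‖(Q * (1 - P)) e‖ ≤ 2 / σ * (‖Q ((A - Θ) e)‖ + ‖A - Θ‖ * ‖P e‖) := by
    have e1 : Q * (1 - P) = B * (Q * (A - Θ) - (A - Θ) * P) := by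
      have : B * (Q * (A - Θ) - (A - Θ) * P) = B * ((A - Θ) * (1 - P)) := by
        rw [mul_sub, ← mul_assoc, hA.inv_proj, ← mul_sub, mul_sub (A - Θ), mul_one]
      rw [this, sub_mul, k0, sub_zero, ← mul_assoc, hA.inv_mul]
    rw [e1]
    refine (ContinuousLinearMap.le_opNorm B _).trans ?_
    refine mul_le_mul hA.norm_inv ?_ (norm_nonneg _) (by positivity)
    refine (norm_sub_le _ _).trans (add_le_add le_rfl ?_)
    exact ContinuousLinearMap.le_opNorm (A - Θ) (P e)
  have e : Q - P = Q * (1 - P) - (1 - Q) * P := by noncomm_ring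
  rw [e]
  refine (norm_sub_le _ _).trans ((add_le_add h2 h1).trans (le_of_eq ?_))
  field_simp
  ring

/-- Deleting the row and the column of a unit vector `e` moves the spectral projection by a quantity
that only involves the projections of `A e` and of `e`. -/
lemma SpectralSplit.norm_sub_deleted_le {A P B A' P' B' : H →L[ℝ] H} {α σ : ℝ} (hσ : 0 < σ)
    (h : SpectralSplit A P B α (2 / σ)) (h' : SpectralSplit A' P' B' α (2 / σ)) (hα : α ≤ σ / 8)
    {e : H} (he : ‖e‖ = 1) (hdel : A' e = 0)
    (hdiff : ∀ x, (A - A') x = inner ℝ (A e) x • e + inner ℝ e x • A e) :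
    ‖P - P'‖ ≤ 4 / σ * (‖P' (A e)‖ + ‖P (A e)‖ + ‖P e‖ * ‖A e‖) := by
  have hab : α * (2 / σ) ≤ 1 / 2 := by
    rw [← mul_div_assoc, div_le_iff₀ hσ]; linarith
  have hsa : ∀ x y, inner ℝ x (P y) = inner ℝ (P x) y := fun x y =>
    (h.proj.isSelfAdjoint.isSymmetric x y).symm
  have hsa' : ∀ x y, inner ℝ x (P' y) = inner ℝ (P' x) y := fun x y =>
    (h'.proj.isSelfAdjoint.isSymmetric x y).symm
  have hPe : P' e = 0 := by
    rw [← h'.inv_mul, mul_apply_eq_comp, hdel, map_zero]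
  have h1 : ‖(A - A') * P'‖ ≤ ‖P' (A e)‖ := by
    refine ContinuousLinearMap.opNorm_le_bound _ (norm_nonneg _) fun x => ?_
    rw [mul_apply_eq_comp, hdiff, hsa', hsa', hPe, inner_zero_left, zero_smul, add_zero,
      norm_smul, he, mul_one]
    exact norm_inner_le_norm _ _
  have h2 : ‖(A' - A) * P‖ ≤ ‖P (A e)‖ + ‖P e‖ * ‖A e‖ := by
    rw [← neg_sub A A', neg_mul, norm_neg]
    refine ContinuousLinearMap.opNorm_le_bound _ (by positivity) fun x => ?_
    rw [mul_apply_eq_comp, hdiff, hsa, hsa]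
    refine (norm_add_le _ _).trans ?_
    rw [norm_smul, norm_smul, he, mul_one]
    have i1 : ‖inner ℝ (P (A e)) x‖ ≤ _ := norm_inner_le_norm (𝕜 := ℝ) (P (A e)) x
    have i2 : ‖inner ℝ (P e) x‖ ≤ _ := norm_inner_le_norm (𝕜 := ℝ) (P e) x
    nlinarith [mul_le_mul_of_nonneg_right i2 (norm_nonneg (A e))]
  have k1 := h.norm_compl_mul_proj_le h' hab
  have k2 := h'.norm_compl_mul_proj_le h hab
  have k3 : ‖P * (1 - P')‖ = ‖(1 - P') * P‖ := by
    rw [← norm_star, star_mul, h.proj.isSelfAdjoint.star_eq, h'.proj.one_sub.isSelfAdjoint.star_eq]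
  have hsplit : P - P' = P * (1 - P') - (1 - P) * P' := by noncomm_ring
  rw [hsplit]
  refine (norm_sub_le _ _).trans ?_
  rw [k3]
  have hs : 0 ≤ 2 * (2 / σ) := by positivity
  calc _ ≤ 2 * (2 / σ) * (‖P (A e)‖ + ‖P e‖ * ‖A e‖) + 2 * (2 / σ) * ‖P' (A e)‖ :=
        add_le_add (k2.trans (mul_le_mul_of_nonneg_left h2 hs))
          (k1.trans (mul_le_mul_of_nonneg_left h1 hs))
    _ = _ := by ring

/-- The self-bounding argument: if the `P' i` are decoupled from the noise vectors `(A - Θ) e i`, so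
that `P' i ((A - Θ) e i)` is small as soon as the `P' i (e j)` are, then all vectors
`(Q - P) e i` are of the order of the first order term of the perturbation expansion.

The relative size of the noise is `γ`, that of the noise vectors `w`; `p` bounds the vectors
`P (e i)`, and `a + b * W` the decoupled noise when all `P' i (e j)` are at most `W`. -/
lemma norm_sub_apply_le_of_leaveOneOut {ι : Type*} [Finite ι] [Nonempty ι] {Θ P S A Q B : H →L[ℝ] H}
    {A' P' B' : ι → H →L[ℝ] H} {e : ι → H} {σ τ γ p w a b : ℝ} (hσ : 0 < σ)
    (hΘ : SpectralSplit Θ P S 0 (1 / σ)) (hA : SpectralSplit A Q B (σ / 8) (2 / σ))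
    (hA' : ∀ i, SpectralSplit (A' i) (P' i) (B' i) (σ / 8) (2 / σ))
    (he : ∀ i, ‖e i‖ = 1) (hdel : ∀ i, A' i (e i) = 0)
    (hdiff : ∀ i x, (A - A' i) x = inner ℝ (A (e i)) x • e i + inner ℝ (e i) x • A (e i))
    (hp : ∀ i, ‖P (e i)‖ ≤ p) (hτ : ‖Θ‖ ≤ τ) (hγ : ‖A - Θ‖ ≤ γ * σ) (hγ1 : 4 * γ ≤ 1)
    (hw : ∀ i, ‖(A - Θ) (e i)‖ ≤ w) (hw' : ∀ i, ‖A (e i)‖ ≤ w) (hwσ : 32 * w ≤ σ)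
    (ha0 : 0 ≤ a) (hb0 : 0 ≤ b) (hbσ : 32 * b ≤ σ)
    (hdec : ∀ i W, (∀ j, ‖P' i (e j)‖ ≤ W) → ‖P' i ((A - Θ) (e i))‖ ≤ a + b * W) (i : ι) :
    ‖(Q - P) (e i)‖ ≤ 4 * γ * p +
      (6 * a + 12 * (8 * (b + w) * τ * p / σ) + (24 * b + 8 * w) * p) / σ := by
  have hp0 : 0 ≤ p := (norm_nonneg _).trans (hp i)
  have hw0 : 0 ≤ w := (norm_nonneg _).trans (hw i)
  have hτ0 : 0 ≤ τ := (norm_nonneg _).trans hτ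
  have hγ0 : 0 ≤ γ := nonneg_of_mul_nonneg_left ((norm_nonneg _).trans hγ) hσ
  set T := 8 * (b + w) * τ * p / σ with hT
  have hT0 : 0 ≤ T := by positivity
  -- the largest row norm of `Q`
  obtain ⟨M, hM, i₀, hi₀⟩ : ∃ M, (∀ j, ‖Q (e j)‖ ≤ M) ∧ ∃ i₀, ‖Q (e i₀)‖ = M := by
    obtain ⟨i₀, hi₀⟩ := Finite.exists_max fun j => ‖Q (e j)‖
    exact ⟨_, hi₀, i₀, rfl⟩
  have hM0 : 0 ≤ M := (norm_nonneg _).trans (hM i)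
  have hΘe : ∀ i, ‖Θ (e i)‖ ≤ τ * p := by
    intro i
    have k0 : Θ * (1 - P) = 0 := norm_le_zero_iff.1 hΘ.norm_compl
    have : Θ (e i) = Θ (P (e i)) := by
      have := congrArg (fun F : H →L[ℝ] H => F (e i)) k0
      simp only [mul_apply_eq_comp, _root_.sub_apply,
        one_apply_eq_self, _root_.zero_apply, map_sub] at this
      exact sub_eq_zero.1 this
    rw [this]
    exact (ContinuousLinearMap.le_opNorm _ _).trans
      (mul_le_mul hτ (hp i) (norm_nonneg _) hτ0)
  have hproj : ∀ (R : H →L[ℝ] H), IsStarProjection R → ∀ i,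
      ‖R (A (e i))‖ ≤ τ * p + ‖R ((A - Θ) (e i))‖ := by
    intro R hR i
    have : A (e i) = Θ (e i) + (A - Θ) (e i) := by simp
    rw [this, map_add]
    refine (norm_add_le _ _).trans (add_le_add ?_ le_rfl)
    exact ((ContinuousLinearMap.le_opNorm _ _).trans
      (mul_le_of_le_one_left (norm_nonneg _) hR.norm_le)).trans (hΘe i)
  -- replacing `Q` by `P' i` costs `g`, which is bounded by the terms that it enters
  have hx : ∀ i, ‖Q ((A - Θ) (e i))‖ ≤ 2 * a + 4 * T + (3 * b + w) * M := by
    intro i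
    set x := ‖Q ((A - Θ) (e i))‖ with hxdef
    set y := ‖P' i ((A - Θ) (e i))‖ with hydef
    have hx0 : 0 ≤ x := norm_nonneg _
    have hy0 : 0 ≤ y := norm_nonneg _
    set g := 4 / σ * (y + x + 2 * (τ * p) + w * M) with hg
    have hg0 : 0 ≤ g := by positivity
    have hQg : ‖Q - P' i‖ ≤ g := by
      refine (hA.norm_sub_deleted_le hσ (hA' i) le_rfl (he i) (hdel i) (hdiff i)).trans ?_
      refine mul_le_mul_of_nonneg_left ?_ (by positivity)
      have h1 := hproj Q hA.proj i
      have h2 := hproj (P' i) (hA' i).proj i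
      have h3 : ‖Q (e i)‖ * ‖A (e i)‖ ≤ M * w :=
        mul_le_mul (hM i) (hw' i) (norm_nonneg _) hM0
      linarith
    have hy : y ≤ a + b * (M + g) := by
      refine hdec i _ fun j => ?_
      have : P' i (e j) = Q (e j) - (Q - P' i) (e j) := by simp
      rw [this]
      refine (norm_sub_le _ _).trans (add_le_add (hM j) ?_)
      refine (ContinuousLinearMap.le_opNorm _ _).trans ?_
      rw [he j, mul_one]
      exact hQg
    have hxy : x ≤ y + g * w := by
      have : Q ((A - Θ) (e i)) = P' i ((A - Θ) (e i)) + (Q - P' i) ((A - Θ) (e i)) := by simp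
      rw [hxdef, this]
      refine (norm_add_le _ _).trans (add_le_add le_rfl ?_)
      exact (ContinuousLinearMap.le_opNorm _ _).trans
        (mul_le_mul hQg (hw i) (norm_nonneg _) hg0)
    have hbσ' : b * (4 / σ) ≤ 1 / 8 := by
      rw [mul_div_assoc', div_le_iff₀ hσ]; linarith
    have hwσ' : w * (4 / σ) ≤ 1 / 8 := by
      rw [mul_div_assoc', div_le_iff₀ hσ]; linarith
    have hTeq : T = b * (4 / σ) * (2 * (τ * p)) + w * (4 / σ) * (2 * (τ * p)) := by
      rw [hT]; field_simp; ring
    have hTb : 0 ≤ b * (4 / σ) * (2 * (τ * p)) := by positivity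
    have hTw : 0 ≤ w * (4 / σ) * (2 * (τ * p)) := by positivity
    have hbg : b * g ≤ (y + x) / 8 + T + b * M / 8 := by
      have : b * g = b * (4 / σ) * (y + x) + b * (4 / σ) * (2 * (τ * p)) +
          (w * (4 / σ)) * (b * M) := by
        rw [hg]; ring
      have h1 := mul_le_mul_of_nonneg_right hbσ' (add_nonneg hy0 hx0)
      have h2 := mul_le_mul_of_nonneg_right hwσ' (mul_nonneg hb0 hM0)
      linarith
    have hwg : g * w ≤ (y + x) / 8 + T + w * M / 8 := by
      have : g * w = w * (4 / σ) * (y + x) + w * (4 / σ) * (2 * (τ * p)) +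
          (w * (4 / σ)) * (w * M) := by
        rw [hg]; ring
      have h1 := mul_le_mul_of_nonneg_right hwσ' (add_nonneg hy0 hx0)
      have h2 := mul_le_mul_of_nonneg_right hwσ' (mul_nonneg hw0 hM0)
      linarith
    have hbM : 0 ≤ b * M := mul_nonneg hb0 hM0
    have hwM : 0 ≤ w * M := mul_nonneg hw0 hM0
    have ha0 : 0 ≤ a + 9 / 8 * (b * M) + T + x / 8 := by linarith
    linarith
  have hd : ∀ i, ‖(Q - P) (e i)‖ ≤ 4 * γ * p +
      (4 * a + 8 * T + (6 * b + 2 * w) * M) / σ := by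
    intro i
    refine (hΘ.norm_sub_apply_le hσ hA le_rfl (e i)).trans ?_
    have h1 : 4 * ‖A - Θ‖ * ‖P (e i)‖ ≤ 4 * (γ * σ) * p := by
      have := mul_le_mul hγ (hp i) (norm_nonneg _) (mul_nonneg hγ0 hσ.le)
      linarith
    have h2 := hx i
    have h3 : 4 * γ * p + (4 * a + 8 * T + (6 * b + 2 * w) * M) / σ =
        (4 * (γ * σ) * p + (4 * a + 8 * T + (6 * b + 2 * w) * M)) / σ := by
      field_simp
    rw [h3]
    gcongr
    linarith
  -- `M` also bounds the error, so that it is controlled by its first order terms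
  have hMb : M ≤ 2 * (p + 4 * γ * p + (4 * a + 8 * T) / σ) := by
    have h1 : M ≤ p + ‖(Q - P) (e i₀)‖ := by
      rw [← hi₀]
      have : Q (e i₀) = P (e i₀) + (Q - P) (e i₀) := by simp
      rw [this]
      exact (norm_add_le _ _).trans (add_le_add (hp i₀) le_rfl)
    have h2 := hd i₀
    have h3 : (6 * b + 2 * w) * M / σ ≤ M / 4 := by
      rw [div_le_iff₀ hσ]
      nlinarith
    rw [add_div] at h2
    linarith
  refine (hd i).trans ?_
  have h1 : (6 * b + 2 * w) * M / σ ≤ (6 * b + 2 * w) * (4 * p) / σ + (2 * a + 4 * T) / σ := by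
    have h4 : 2 * (p + 4 * γ * p + (4 * a + 8 * T) / σ) ≤ 4 * p + 2 * ((4 * a + 8 * T) / σ) := by
      nlinarith
    have h5 : (6 * b + 2 * w) * M / σ ≤
        (6 * b + 2 * w) * (4 * p + 2 * ((4 * a + 8 * T) / σ)) / σ := by
      gcongr
      exact hMb.trans h4
    have h6 : (6 * b + 2 * w) / σ ≤ 1 / 4 := by
      rw [div_le_iff₀ hσ]; linarith
    have h7 : 0 ≤ (4 * a + 8 * T) / σ := by positivity
    have h8 := mul_le_mul_of_nonneg_right h6 h7
    have h9 : (6 * b + 2 * w) * (4 * p + 2 * ((4 * a + 8 * T) / σ)) / σ =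
        (6 * b + 2 * w) * (4 * p) / σ + 2 * ((6 * b + 2 * w) / σ * ((4 * a + 8 * T) / σ)) := by
      ring
    have h10 : (4 * a + 8 * T) / σ = 2 * ((2 * a + 4 * T) / σ) := by ring
    rw [h9] at h5
    linarith
  have h2 : (6 * a + 12 * T + (24 * b + 8 * w) * p) / σ = (4 * a + 8 * T) / σ +
      ((6 * b + 2 * w) * (4 * p) / σ + (2 * a + 4 * T) / σ) := by ring
  rw [h2, add_div (4 * a + 8 * T)]
  linarith

end Perturbation

end PABM

/-! ### Leading eigenvectors -/

namespace PABM

open scoped Matrix.Norms.L2Operator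

section Leading

/-- The Euclidean norm of a vector. -/
noncomputable def eNorm {m : ℕ} (v : Fin m → ℝ) : ℝ :=
  ‖(WithLp.toLp 2 v : EuclideanSpace ℝ (Fin m))‖

lemma eNorm_nonneg {m : ℕ} (v : Fin m → ℝ) : 0 ≤ eNorm v := norm_nonneg _

lemma eNorm_sq {m : ℕ} (v : Fin m → ℝ) : eNorm v ^ 2 = ∑ i, v i ^ 2 := by
  rw [eNorm, EuclideanSpace.norm_sq_eq]
  simp

lemma eNorm_sq_eq_dotProduct {m : ℕ} (v : Fin m → ℝ) : eNorm v ^ 2 = v ⬝ᵥ v := by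
  rw [eNorm_sq, dotProduct]
  exact Finset.sum_congr rfl fun i _ => sq _

lemma eNorm_pos {m : ℕ} {v : Fin m → ℝ} (hv : v ≠ 0) : 0 < eNorm v := by
  rw [eNorm, norm_pos_iff]
  intro h
  exact hv ((WithLp.toLp_eq_zero 2).1 h)

lemma eNorm_mulVec_le {n m : ℕ} (M : Matrix (Fin n) (Fin m) ℝ) (v : Fin m → ℝ) :
    eNorm (M *ᵥ v) ≤ ‖M‖ * eNorm v :=
  Matrix.l2_opNorm_mulVec M (WithLp.toLp 2 v)

lemma eNorm_mulVec_of_orthonormal {n m : ℕ} {M : Matrix (Fin n) (Fin m) ℝ} (hM : Mᵀ * M = 1)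
    (v : Fin m → ℝ) : eNorm (M *ᵥ v) = eNorm v := by
  rw [← sq_eq_sq₀ (eNorm_nonneg _) (eNorm_nonneg _), eNorm_sq_eq_dotProduct, eNorm_sq_eq_dotProduct,
    Matrix.dotProduct_mulVec, Matrix.vecMul_mulVec, hM, Matrix.vecMul_one]

lemma eNorm_le_add_sub {m : ℕ} (v w : Fin m → ℝ) : eNorm v ≤ eNorm w + eNorm (v - w) := by
  have : (WithLp.toLp 2 v : EuclideanSpace ℝ (Fin m)) =
      WithLp.toLp 2 w + WithLp.toLp 2 (v - w) := by
    rw [← WithLp.toLp_add]; simp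
  unfold eNorm
  rw [this]
  exact norm_add_le _ _

lemma exists_mulVec_eq_zero_of_card_lt {κ ν : Type*} [Fintype κ] [Fintype ν] [DecidableEq ν]
    (M : Matrix κ ν ℝ) (h : Fintype.card κ < Fintype.card ν) : ∃ v ≠ 0, M *ᵥ v = 0 := by
  have h1 : LinearMap.ker (Matrix.toLin' M) ≠ ⊥ := by
    apply LinearMap.ker_ne_bot_of_finrank_lt
    simpa using h
  obtain ⟨v, hv, hv0⟩ := Submodule.exists_mem_ne_zero_of_ne_bot h1
  exact ⟨v, hv0, by simpa using hv⟩

lemma norm_le_one_of_orthonormal {n m : ℕ} {M : Matrix (Fin n) (Fin m) ℝ} (hM : Mᵀ * M = 1) :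
    ‖M‖ ≤ 1 := by
  have h := Matrix.l2_opNorm_conjTranspose_mul_self M
  rw [Matrix.conjTranspose_eq_transpose_of_trivial, hM] at h
  have h1 : ‖(1 : Matrix (Fin m) (Fin m) ℝ)‖ ≤ 1 := by
    rw [← Matrix.diagonal_one, Matrix.l2_opNorm_diagonal]
    exact (pi_norm_le_iff_of_nonneg zero_le_one).2 fun i => by simp
  nlinarith [norm_nonneg M]

lemma norm_mul_diagonal_mul_transpose_le {n m : ℕ} {M : Matrix (Fin n) (Fin m) ℝ}
    (hM : Mᵀ * M = 1) {d : Fin m → ℝ} {b : ℝ} (hb : 0 ≤ b) (hd : ∀ r, |d r| ≤ b) :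
    ‖M * diagonal d * Mᵀ‖ ≤ b := by
  have h1 := norm_le_one_of_orthonormal hM
  have h2 : ‖Mᵀ‖ ≤ 1 := by
    rw [← Matrix.conjTranspose_eq_transpose_of_trivial, Matrix.l2_opNorm_conjTranspose]
    exact h1
  have h3 : ‖(diagonal d : Matrix (Fin m) (Fin m) ℝ)‖ ≤ b := by
    rw [Matrix.l2_opNorm_diagonal]
    exact (pi_norm_le_iff_of_nonneg hb).2 hd
  calc _ ≤ ‖M * diagonal d‖ * ‖Mᵀ‖ := Matrix.l2_opNorm_mul _ _
    _ ≤ ‖M * diagonal d‖ * 1 := by gcongr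
    _ ≤ ‖M‖ * ‖(diagonal d : Matrix (Fin m) (Fin m) ℝ)‖ * 1 := by
        gcongr; exact Matrix.l2_opNorm_mul _ _
    _ ≤ 1 * b * 1 := by gcongr
    _ = b := by ring

/-- A square matrix as an operator of the Euclidean space. -/
noncomputable abbrev op {n : ℕ} (M : Matrix (Fin n) (Fin n) ℝ) :
    EuclideanSpace ℝ (Fin n) →L[ℝ] EuclideanSpace ℝ (Fin n) :=
  Matrix.toEuclideanCLM (n := Fin n) (𝕜 := ℝ) M

lemma norm_op {n : ℕ} (M : Matrix (Fin n) (Fin n) ℝ) : ‖op M‖ = ‖M‖ := rfl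

/-- An invariant subspace of a symmetric matrix, given by orthonormal eigenvectors, provides a
spectral splitting. -/
lemma spectralSplit_of_eigenvectors {n m : ℕ} {A : Matrix (Fin n) (Fin n) ℝ}
    {X : Matrix (Fin n) (Fin m) ℝ} {d : Fin m → ℝ} (hA : Aᵀ = A) (hX : Xᵀ * X = 1)
    (hAX : A * X = X * diagonal d) {α β : ℝ} (hβ : 0 ≤ β) (hd0 : ∀ r, d r ≠ 0)
    (hd : ∀ r, |d r|⁻¹ ≤ β) (hα : ‖A * (1 - X * Xᵀ)‖ ≤ α) :
    ∃ B, SpectralSplit (op A) (op (X * Xᵀ)) B α β := by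
  have hXA : Xᵀ * A = diagonal d * Xᵀ := by
    have := congrArg Matrix.transpose hAX
    rwa [Matrix.transpose_mul, Matrix.transpose_mul, hA, Matrix.diagonal_transpose] at this
  have hdd : diagonal (fun r => (d r)⁻¹) * diagonal d = (1 : Matrix (Fin m) (Fin m) ℝ) := by
    rw [Matrix.diagonal_mul_diagonal, ← Matrix.diagonal_one]
    congr 1
    funext r
    exact inv_mul_cancel₀ (hd0 r)
  have hdd' : diagonal d * diagonal (fun r => (d r)⁻¹) = (1 : Matrix (Fin m) (Fin m) ℝ) :=
    mul_eq_one_comm.1 hdd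
  refine ⟨op (X * diagonal (fun r => (d r)⁻¹) * Xᵀ), ⟨⟨?_, ?_⟩, ?_, ?_, ?_, ?_, ?_⟩⟩
  · rw [IsIdempotentElem, ← map_mul]
    congr 1
    calc _ = X * (Xᵀ * X) * Xᵀ := by simp only [Matrix.mul_assoc]
      _ = _ := by rw [hX, Matrix.mul_one]
  · rw [IsSelfAdjoint, ← map_star]
    congr 1
    rw [Matrix.star_eq_conjTranspose, Matrix.conjTranspose_eq_transpose_of_trivial,
      Matrix.transpose_mul, Matrix.transpose_transpose]
  · rw [← map_mul]
    congr 1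
    rw [Matrix.mul_assoc, hXA, Matrix.mul_assoc, ← Matrix.mul_assoc (diagonal _), hdd,
      Matrix.one_mul]
  · rw [← map_mul]
    congr 1
    rw [Matrix.mul_assoc X, ← Matrix.mul_assoc, hAX, Matrix.mul_assoc,
      ← Matrix.mul_assoc (diagonal _), hdd', Matrix.one_mul]
  · rw [← map_mul]
    congr 1
    calc _ = X * diagonal (fun r => (d r)⁻¹) * (Xᵀ * X) * Xᵀ := by simp only [Matrix.mul_assoc]
      _ = _ := by rw [hX, Matrix.mul_one]
  · rw [norm_op]
    exact norm_mul_diagonal_mul_transpose_le hX hβ fun r => by rw [abs_inv]; exact hd r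
  · rw [← map_one (Matrix.toEuclideanCLM (n := Fin n) (𝕜 := ℝ)), ← map_sub, ← map_mul, norm_op]
    exact hα

lemma IsEigendecomposition.transpose_eq {n m : ℕ} {M : Matrix (Fin n) (Fin n) ℝ}
    {X : Matrix (Fin n) (Fin m) ℝ} {d : Fin m → ℝ} (h : IsEigendecomposition M X d) : Mᵀ = M := by
  rw [h.2, Matrix.transpose_mul, Matrix.transpose_mul, Matrix.transpose_transpose,
    Matrix.diagonal_transpose, Matrix.mul_assoc]

lemma IsEigendecomposition.mul_eq {n m : ℕ} {M : Matrix (Fin n) (Fin n) ℝ}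
    {X : Matrix (Fin n) (Fin m) ℝ} {d : Fin m → ℝ} (h : IsEigendecomposition M X d) :
    M * X = X * diagonal d := by
  nth_rewrite 1 [h.2]
  rw [Matrix.mul_assoc, h.1, Matrix.mul_one]

lemma IsEigendecomposition.spectralSplit {n m : ℕ} {M : Matrix (Fin n) (Fin n) ℝ}
    {X : Matrix (Fin n) (Fin m) ℝ} {d : Fin m → ℝ} (h : IsEigendecomposition M X d) {σ : ℝ}
    (hσ : 0 < σ) (hd : ∀ r, σ ≤ |d r|) :
    ∃ S, SpectralSplit (op M) (op (X * Xᵀ)) S 0 (1 / σ) := by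
  refine spectralSplit_of_eigenvectors h.transpose_eq h.1 h.mul_eq (by positivity)
    (fun r => abs_pos.1 (hσ.trans_le (hd r))) (fun r => ?_) ?_
  · rw [one_div]
    exact inv_anti₀ hσ (hd r)
  · have : M * (1 - X * Xᵀ) = 0 := by
      rw [Matrix.mul_sub, Matrix.mul_one, ← Matrix.mul_assoc, h.mul_eq, ← h.2, sub_self]
    rw [this, norm_zero]

section Counting

variable {n m : ℕ} {Θ A V : Matrix (Fin n) (Fin n) ℝ} {Ξ : Matrix (Fin n) (Fin m) ℝ}
  {δ : Fin m → ℝ} {D : Fin n → ℝ} {σ ε : ℝ}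

/-- At least `m` eigenvalues of a perturbation of `Θ` remain far from zero. -/
lemma card_large_eigenvalues_ge (hΘ : IsEigendecomposition Θ Ξ δ)
    (hA : IsEigendecomposition A V D) (hσ : 0 < σ) (hδ : ∀ r, σ ≤ |δ r|) (hε : ‖A - Θ‖ ≤ ε)
    (hεσ : ε < σ) : m ≤ (Finset.univ.filter fun j => σ - ε ≤ |D j|).card := by
  by_contra! hlt
  set T := Finset.univ.filter fun j => σ - ε ≤ |D j| with hT
  -- otherwise the range of `Ξ` contains a vector orthogonal to the other eigenvectors
  obtain ⟨y, hy0, hy⟩ := exists_mulVec_eq_zero_of_card_lt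
    ((Vᵀ * Ξ).submatrix (fun j : {j // j ∈ T} => j.1) id) (by simpa using hlt)
  set x := Ξ *ᵥ y with hx
  have hVV : V * Vᵀ = 1 := mul_eq_one_comm.1 hA.1
  have hz : ∀ j ∈ T, (Vᵀ *ᵥ x) j = 0 := by
    intro j hj
    have := congrFun hy ⟨j, hj⟩
    rw [hx, Matrix.mulVec_mulVec]
    simpa [Matrix.mulVec, dotProduct] using this
  have hxy : eNorm x = eNorm y := eNorm_mulVec_of_orthonormal hΘ.1 y
  have hy1 : 0 < eNorm y := eNorm_pos hy0
  have hzx : eNorm (Vᵀ *ᵥ x) = eNorm y := by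
    rw [← hxy]
    exact eNorm_mulVec_of_orthonormal (by rw [Matrix.transpose_transpose, hVV]) x
  -- `A x` is shorter than `(σ - ε) * x`
  have h1 : eNorm (A *ᵥ x) < (σ - ε) * eNorm y := by
    have e1 : eNorm (A *ᵥ x) = eNorm (fun j => D j * (Vᵀ *ᵥ x) j) := by
      rw [hA.2, Matrix.mul_assoc, ← Matrix.mulVec_mulVec, eNorm_mulVec_of_orthonormal hA.1,
        ← Matrix.mulVec_mulVec]
      congr 1
      funext j
      rw [Matrix.mulVec_diagonal]
    rw [e1, ← pow_lt_pow_iff_left₀ (eNorm_nonneg _)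
      (mul_nonneg (by linarith) (eNorm_nonneg _)) two_ne_zero, mul_pow, ← hzx, eNorm_sq, eNorm_sq,
      Finset.mul_sum]
    have hne : ∃ j, (Vᵀ *ᵥ x) j ≠ 0 := by
      by_contra! hcon
      have : Vᵀ *ᵥ x = 0 := funext hcon
      rw [this] at hzx
      have h0 : eNorm (0 : Fin n → ℝ) = 0 := by simp [eNorm]
      rw [h0] at hzx
      exact hy1.ne hzx
    have hsmall : ∀ j, (Vᵀ *ᵥ x) j ≠ 0 → D j ^ 2 < (σ - ε) ^ 2 := by
      intro j hj
      have : j ∉ T := fun h => hj (hz j h)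
      simp only [hT, Finset.mem_filter, Finset.mem_univ, true_and, not_le] at this
      rw [← sq_abs (D j)]
      exact pow_lt_pow_left₀ this (abs_nonneg _) two_ne_zero
    obtain ⟨j, hj⟩ := hne
    refine Finset.sum_lt_sum (fun k _ => ?_) ⟨j, Finset.mem_univ j, ?_⟩
    · rw [mul_pow]
      by_cases hk : (Vᵀ *ᵥ x) k = 0
      · simp [hk]
      · exact mul_le_mul_of_nonneg_right (hsmall k hk).le (sq_nonneg _)
    · rw [mul_pow]
      exact mul_lt_mul_of_pos_right (hsmall j hj) (by positivity)
  have h2 : σ * eNorm y ≤ eNorm (Θ *ᵥ x) := by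
    have e1 : Θ *ᵥ x = Ξ *ᵥ (fun r => δ r * y r) := by
      rw [hx, Matrix.mulVec_mulVec, hΘ.mul_eq, ← Matrix.mulVec_mulVec]
      congr 1
      funext r
      rw [Matrix.mulVec_diagonal]
    rw [e1, eNorm_mulVec_of_orthonormal hΘ.1, ← pow_le_pow_iff_left₀
      (mul_nonneg hσ.le (eNorm_nonneg _)) (eNorm_nonneg _) two_ne_zero, mul_pow, eNorm_sq, eNorm_sq,
      Finset.mul_sum]
    refine Finset.sum_le_sum fun r _ => ?_
    rw [mul_pow]
    refine mul_le_mul_of_nonneg_right ?_ (sq_nonneg _)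
    rw [← sq_abs (δ r)]
    exact pow_le_pow_left₀ hσ.le (hδ r) 2
  have h3 := eNorm_le_add_sub (Θ *ᵥ x) (A *ᵥ x)
  have h4 : eNorm (Θ *ᵥ x - A *ᵥ x) ≤ ε * eNorm y := by
    rw [← Matrix.sub_mulVec, ← hxy]
    refine (eNorm_mulVec_le _ _).trans ?_
    rw [norm_sub_rev]
    exact mul_le_mul_of_nonneg_right hε (eNorm_nonneg _)
  linarith

/-- At most `m` eigenvalues of a perturbation of `Θ` exceed the size of the perturbation. -/
lemma card_eigenvalues_gt_le (hΘ : IsEigendecomposition Θ Ξ δ)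
    (hA : IsEigendecomposition A V D) (hε : ‖A - Θ‖ ≤ ε) :
    (Finset.univ.filter fun j => ε < |D j|).card ≤ m := by
  by_contra! hlt
  set T := Finset.univ.filter fun j => ε < |D j| with hT
  have hε0 : 0 ≤ ε := (norm_nonneg _).trans hε
  -- otherwise their span contains a vector in the kernel of `Θ`
  obtain ⟨y, hy0, hy⟩ := exists_mulVec_eq_zero_of_card_lt
    ((Ξᵀ * V).submatrix id (fun j : {j // j ∈ T} => j.1)) (by simpa using hlt)
  -- the vector with coordinates `y` in the eigenbasis
  set z : Fin n → ℝ := fun j => if h : j ∈ T then y ⟨j, h⟩ else 0 with hzdef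
  have hsupp : ∀ j, z j ≠ 0 → j ∈ T := by
    intro j hj
    by_contra h
    exact hj (by simp [hzdef, h])
  have hz0 : z ≠ 0 := by
    intro h
    apply hy0
    funext j
    have := congrFun h j.1
    simpa [hzdef] using this
  have hΞz : (Ξᵀ * V) *ᵥ z = 0 := by
    funext r
    have h1 := congrFun hy r
    simp only [Matrix.mulVec, dotProduct, Matrix.submatrix_apply, id, Pi.zero_apply] at h1 ⊢
    rw [← h1, ← Finset.sum_subset (Finset.subset_univ T), ← Finset.sum_coe_sort]
    · refine Finset.sum_congr rfl fun j _ => ?_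
      simp [hzdef]
    · intro j _ hj
      simp [hzdef, hj]
  set x := V *ᵥ z with hx
  have hΘx : Θ *ᵥ x = 0 := by
    rw [hΘ.2, ← Matrix.mulVec_mulVec, hx, Matrix.mulVec_mulVec z Ξᵀ, hΞz, Matrix.mulVec_zero]
  have hxz : eNorm x = eNorm z := eNorm_mulVec_of_orthonormal hA.1 z
  have h1 : ε * eNorm z < eNorm (A *ᵥ x) := by
    have e1 : A *ᵥ x = V *ᵥ (fun j => D j * z j) := by
      rw [hx, Matrix.mulVec_mulVec, hA.mul_eq, ← Matrix.mulVec_mulVec]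
      congr 1
      funext r
      rw [Matrix.mulVec_diagonal]
    rw [e1, eNorm_mulVec_of_orthonormal hA.1, ← pow_lt_pow_iff_left₀
      (mul_nonneg hε0 (eNorm_nonneg _)) (eNorm_nonneg _) two_ne_zero, mul_pow, eNorm_sq, eNorm_sq,
      Finset.mul_sum]
    have hbig : ∀ j, z j ≠ 0 → ε ^ 2 < D j ^ 2 := by
      intro j hj
      have := hsupp j hj
      simp only [hT, Finset.mem_filter, Finset.mem_univ, true_and] at this
      rw [← sq_abs (D j)]
      exact pow_lt_pow_left₀ this hε0 two_ne_zero
    obtain ⟨j, hj⟩ := Function.ne_iff.1 hz0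
    refine Finset.sum_lt_sum (fun k _ => ?_) ⟨j, Finset.mem_univ j, ?_⟩
    · rw [mul_pow]
      by_cases hk : z k = 0
      · simp [hk]
      · exact mul_le_mul_of_nonneg_right (hbig k hk).le (sq_nonneg _)
    · rw [mul_pow]
      exact mul_lt_mul_of_pos_right (hbig j hj) (sq_pos_of_ne_zero hj)
  have h2 : eNorm (A *ᵥ x) ≤ ε * eNorm z := by
    have : A *ᵥ x = (A - Θ) *ᵥ x := by rw [Matrix.sub_mulVec, hΘx, sub_zero]
    rw [this, ← hxz]
    exact (eNorm_mulVec_le _ _).trans (mul_le_mul_of_nonneg_right hε (eNorm_nonneg _))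
  linarith

end Counting

/-- The leading eigenvectors of a small perturbation `A` of a matrix `Θ` of rank `m` provide a
spectral splitting of `A`. -/
lemma IsLeadingEigenvectors.spectralSplit {n m : ℕ} {Θ A : Matrix (Fin n) (Fin n) ℝ}
    {Ξ Ξhat : Matrix (Fin n) (Fin m) ℝ} {δ : Fin m → ℝ} {σ : ℝ} (h : IsLeadingEigenvectors A Ξhat)
    (hΘ : IsEigendecomposition Θ Ξ δ) (hσ : 0 < σ) (hδ : ∀ r, σ ≤ |δ r|) (hε : ‖A - Θ‖ ≤ σ / 8) :
    ∃ B, SpectralSplit (op A) (op (Ξhat * Ξhatᵀ)) B (σ / 8) (2 / σ) := by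
  obtain ⟨V, D, s, hA, hs, hV⟩ := h
  have hm1 := card_large_eigenvalues_ge hΘ hA hσ hδ hε (by linarith)
  have hm2 := card_eigenvalues_gt_le hΘ hA hε
  have hrange : (Finset.univ.map s).card = m := by simp
  have hmem : ∀ j, j ∈ Finset.univ.map s ↔ j ∈ Set.range s := by
    intro j; simp
  -- the selected eigenvalues are large
  have hlarge : ∀ r, σ - σ / 8 ≤ |D (s r)| := by
    intro r
    by_contra! hr
    have hsub : (Finset.univ.filter fun j => σ - σ / 8 ≤ |D j|) ⊆
        (Finset.univ.map s).erase (s r) := by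
      intro j hj
      have hj' : σ - σ / 8 ≤ |D j| := (Finset.mem_filter.1 hj).2
      refine Finset.mem_erase.2 ⟨?_, ?_⟩
      · rintro rfl; linarith
      · rw [hmem]
        by_contra hcon
        linarith [hs r j hcon]
    have := Finset.card_le_card hsub
    rw [Finset.card_erase_of_mem ((hmem _).2 ⟨r, rfl⟩), hrange] at this
    have : 0 < m := r.pos
    omega
  -- the other ones are small
  have hsmall : ∀ j, j ∉ Set.range s → |D j| ≤ σ / 8 := by
    intro j hj
    by_contra! hlt
    have hsub : insert j (Finset.univ.map s) ⊆ Finset.univ.filter fun j => σ / 8 < |D j| := by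
      intro k hk
      refine Finset.mem_filter.2 ⟨Finset.mem_univ k, ?_⟩
      rcases Finset.mem_insert.1 hk with rfl | hk
      · exact hlt
      · obtain ⟨r, rfl⟩ := (hmem k).1 hk
        exact hlt.trans_le (hs r j hj)
    have := Finset.card_le_card hsub
    rw [Finset.card_insert_of_notMem (fun h => hj ((hmem j).1 h)), hrange] at this
    omega
  have hXeq : Ξhat = V.submatrix id s := by ext i r; exact hV i r
  have hVV : V * Vᵀ = 1 := mul_eq_one_comm.1 hA.1
  have hX : Ξhatᵀ * Ξhat = 1 := by
    rw [hXeq]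
    ext r t
    have := congrFun (congrFun hA.1 (s r)) (s t)
    rw [Matrix.mul_apply] at this
    simp only [Matrix.mul_apply, Matrix.transpose_apply, Matrix.submatrix_apply, id] at this ⊢
    rw [this]
    simp [Matrix.one_apply]
  have hAX : A * Ξhat = Ξhat * diagonal (fun r => D (s r)) := by
    ext i r
    have := congrFun (congrFun hA.mul_eq i) (s r)
    rw [Matrix.mul_diagonal, Matrix.mul_apply] at this
    rw [Matrix.mul_diagonal, Matrix.mul_apply, hXeq]
    simpa using this
  have hcompl : A * (1 - Ξhat * Ξhatᵀ) =
      V * diagonal (fun j => if j ∈ Finset.univ.map s then 0 else D j) * Vᵀ := by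
    have e1 : Ξhat * Ξhatᵀ =
        V * diagonal (fun j => if j ∈ Finset.univ.map s then 1 else 0) * Vᵀ := by
      ext i k
      rw [Matrix.mul_apply, Matrix.mul_apply, hXeq]
      simp only [Matrix.mul_diagonal, Matrix.transpose_apply, Matrix.submatrix_apply, id]
      have : ∀ j, V i j * (if j ∈ Finset.univ.map s then 1 else 0) * V k j =
          if j ∈ Finset.univ.map s then V i j * V k j else 0 := by
        intro j; split_ifs <;> ring
      simp only [this]
      rw [Finset.sum_ite_mem, Finset.univ_inter, Finset.sum_map]
    have e2 : (1 : Matrix (Fin n) (Fin n) ℝ) - Ξhat * Ξhatᵀ =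
        V * (1 - diagonal (fun j => if j ∈ Finset.univ.map s then 1 else 0)) * Vᵀ := by
      rw [Matrix.mul_sub, Matrix.mul_one, Matrix.sub_mul, hVV, e1]
    rw [e2, ← Matrix.mul_assoc, ← Matrix.mul_assoc, hA.mul_eq, Matrix.mul_assoc V,
      ← Matrix.diagonal_one, Matrix.diagonal_sub, Matrix.diagonal_mul_diagonal]
    congr 3
    funext j
    split_ifs <;> simp
  refine spectralSplit_of_eigenvectors hA.transpose_eq hX hAX (by positivity)
    (fun r => abs_pos.1 (lt_of_lt_of_le (by linarith) (hlarge r))) (fun r => ?_) ?_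
  · have h1 : σ / 2 ≤ |D (s r)| := by linarith [hlarge r]
    have h2 := inv_anti₀ (by positivity) h1
    rwa [inv_div] at h2
  · rw [hcompl]
    refine norm_mul_diagonal_mul_transpose_le hA.1 (by positivity) fun j => ?_
    split_ifs with hj
    · simp; positivity
    · exact hsmall j fun h => hj ((hmem j).2 h)

lemma exists_isLeadingEigenvectors {n m : ℕ} (hm : m ≤ n) {M : Matrix (Fin n) (Fin n) ℝ}
    (hM : Mᵀ = M) : ∃ X : Matrix (Fin n) (Fin m) ℝ, IsLeadingEigenvectors M X := by
  obtain ⟨V, D, h⟩ := eigendecomposition_exists hM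
  -- sort the eigenvalues by decreasing absolute value
  set π := Tuple.sort fun j => -|D j| with hπ
  have hmono : Monotone ((fun j => -|D j|) ∘ π) := Tuple.monotone_sort _
  set s : Fin m ↪ Fin n := (Fin.castLEEmb hm).trans π.toEmbedding with hs
  refine ⟨V.submatrix id s, V, D, s, h, fun r j hj => ?_, fun i r => rfl⟩
  obtain ⟨k, rfl⟩ := π.surjective j
  have hk : Fin.castLE hm r ≤ k := by
    by_contra! hlt
    refine hj ⟨⟨k, lt_trans (Fin.lt_def.1 hlt) r.2⟩, ?_⟩
    simp [hs]
  have := hmono hk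
  simp only [Function.comp_apply, neg_le_neg_iff] at this
  simpa [hs] using this

end Leading

end PABM

/-! ### The edge probability matrix -/

namespace PABM

open scoped Matrix.Norms.L2Operator

section Model

variable {n K : ℕ} {Λ : Matrix (Fin n) (Fin K) ℝ} {c : Fin n → Fin K}
  {Ξ : Matrix (Fin n) (Fin (K ^ 2)) ℝ} {D : Fin (K ^ 2) → ℝ}

lemma rank_eq_card_support_singVal (M : Matrix (Fin n) (Fin n) ℝ) :
    M.rank = (singVal M).support.card := by
  rw [singVal, LinearMap.card_support_singularValues, Matrix.toEuclideanLin_eq_toLin_orthonormal]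
  exact Matrix.rank_eq_finrank_range_toLin M _ _

/-- If a matrix has rank `m`, then the `m` coefficients of a reduced eigenvalue decomposition do not
vanish, and their absolute values are among the first `m` singular values. -/
lemma IsEigendecomposition.abs_mem_singVal {m : ℕ} {M : Matrix (Fin n) (Fin n) ℝ}
    {X : Matrix (Fin n) (Fin m) ℝ} {d : Fin m → ℝ} (h : IsEigendecomposition M X d)
    (hm : (singVal M).support.card = m) (r : Fin m) : ∃ k < m, singVal M k = |d r| ∧ d r ≠ 0 := by
  have hd : d r ≠ 0 := by
    intro h0
    have h1 : M.rank ≤ (diagonal d).rank := by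
      nth_rewrite 1 [h.2]
      exact (Matrix.rank_mul_le_left _ _).trans (Matrix.rank_mul_le_right _ _)
    rw [rank_eq_card_support_singVal, hm, Matrix.rank_diagonal] at h1
    have h2 : Fintype.card {i // d i ≠ 0} < Fintype.card (Fin m) :=
      Fintype.card_subtype_lt (x := r) (by simpa using h0)
    rw [Fintype.card_fin] at h2
    omega
  set T := Matrix.toEuclideanLin M with hT
  have hadj : LinearMap.adjoint T = T := by
    rw [hT, ← Matrix.toEuclideanLin_conjTranspose_eq_adjoint,
      Matrix.conjTranspose_eq_transpose_of_trivial, h.transpose_eq]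
  set v : EuclideanSpace ℝ (Fin n) := WithLp.toLp 2 (fun i => X i r) with hv
  have hTv : T v = d r • v := by
    rw [hT, hv, Matrix.toLpLin_toLp]
    rw [← WithLp.toLp_smul]
    congr 1
    funext i
    have := congrFun (congrFun h.mul_eq i) r
    rw [Matrix.mul_diagonal, Matrix.mul_apply] at this
    simp only [Matrix.toLin'_apply, Matrix.mulVec, dotProduct, Pi.smul_apply, smul_eq_mul]
    rw [this, mul_comm]
  have hv0 : v ≠ 0 := by
    intro h0
    have h1 := congrFun (congrFun h.1 r) r
    rw [Matrix.mul_apply] at h1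
    have h2 : ∀ i, X i r = 0 := fun i => congrArg (fun u : EuclideanSpace ℝ (Fin n) => u i) h0
    simp [h2] at h1
  have heig : Module.End.HasEigenvalue (LinearMap.adjoint T ∘ₗ T) (d r ^ 2) := by
    refine Module.End.hasEigenvalue_of_hasEigenvector (x := v) ⟨?_, hv0⟩
    rw [Module.End.mem_eigenspace_iff, LinearMap.comp_apply, hadj, hTv, map_smul, hTv, smul_smul,
      sq]
  have hfin : Module.finrank ℝ (EuclideanSpace ℝ (Fin n)) = n := by simp
  obtain ⟨k, hk⟩ := T.isSymmetric_adjoint_comp_self.exists_eigenvalues_eq hfin heig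
  have hk2 : singVal M k ^ 2 = d r ^ 2 := by
    have := T.sq_singularValues_fin hfin k
    rw [singVal, ← hT, this]
    exact hk
  have hk3 : singVal M k = |d r| := by
    have h0 : 0 ≤ singVal M k := LinearMap.singularValues_nonneg _ _
    rw [← sq_eq_sq₀ h0 (abs_nonneg _), sq_abs]
    exact hk2
  refine ⟨k, ?_, hk3, hd⟩
  have hsupp : (k : ℕ) ∈ (singVal M).support := by
    rw [Finsupp.mem_support_iff, hk3]
    exact abs_ne_zero.2 hd
  have hr : (singVal M).support = Finset.range m := by
    rw [← hm, singVal, LinearMap.card_support_singularValues, LinearMap.support_singularValues]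
  rw [hr] at hsupp
  exact Finset.mem_range.1 hsupp

lemma IsEigendecomposition.singVal_bounds {m : ℕ} {M : Matrix (Fin n) (Fin n) ℝ}
    {X : Matrix (Fin n) (Fin m) ℝ} {d : Fin m → ℝ} (h : IsEigendecomposition M X d)
    (hm : (singVal M).support.card = m) (r : Fin m) :
    singVal M (m - 1) ≤ |d r| ∧ |d r| ≤ singVal M 0 := by
  obtain ⟨k, hk, hk1, -⟩ := h.abs_mem_singVal hm r
  rw [← hk1]
  exact ⟨LinearMap.singularValues_antitone _ (by omega),
    LinearMap.singularValues_antitone _ (Nat.zero_le k)⟩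

lemma singVal_pred_pos {m : ℕ} (hm0 : 0 < m) {M : Matrix (Fin n) (Fin n) ℝ}
    (hm : (singVal M).support.card = m) : 0 < singVal M (m - 1) := by
  rw [singVal, LinearMap.singularValues_pos_iff_lt_finrank_range,
    ← LinearMap.card_support_singularValues]
  change m - 1 < (singVal M).support.card
  omega

lemma IsEigendecomposition.norm_le_singVal {m : ℕ} {M : Matrix (Fin n) (Fin n) ℝ}
    {X : Matrix (Fin n) (Fin m) ℝ} {d : Fin m → ℝ} (h : IsEigendecomposition M X d)
    (hm : (singVal M).support.card = m) : ‖M‖ ≤ singVal M 0 := by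
  nth_rewrite 1 [h.2]
  exact norm_mul_diagonal_mul_transpose_le h.1 (LinearMap.singularValues_nonneg _ 0)
    fun r => (h.singVal_bounds hm r).2

/-- The rows of the popularity matrix, arranged in blocks of columns: the column `(l, k)` has the
entries `Λ i l` of the nodes `i` of the community `k`, and zeros elsewhere. -/
def popBlocks (Λ : Matrix (Fin n) (Fin K) ℝ) (c : Fin n → Fin K) :
    Matrix (Fin n) (Fin K × Fin K) ℝ :=
  Matrix.of fun i a => if c i = a.2 then Λ i a.1 else 0

/-- The column `(l, k)` of `popBlocks` is paired with the column `(k, l)`, since `Λ i (c j)` belongs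
to the community `c i` and `Λ j (c i)` to the community `c j`. -/
lemma edgeProb_eq_popBlocks : edgeProb Λ c =
    (popBlocks Λ c).submatrix id Prod.swap * (popBlocks Λ c)ᵀ := by
  ext i j
  rw [Matrix.mul_apply, Fintype.sum_prod_type]
  simp [edgeProb, popBlocks]

lemma edgeProb_transpose : (edgeProb Λ c)ᵀ = edgeProb Λ c := by
  ext i j
  simp only [edgeProb, Matrix.transpose_apply, Matrix.of_apply]
  ring

lemma popBlocks_gram : (popBlocks Λ c)ᵀ * popBlocks Λ c =
    Matrix.blockDiagonal fun k => (block Λ c k)ᵀ * block Λ c k := by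
  ext ⟨l, k⟩ ⟨l', k'⟩
  rw [Matrix.mul_apply, Matrix.blockDiagonal_apply]
  simp only [popBlocks, Matrix.transpose_apply, Matrix.of_apply]
  split_ifs with hk
  · subst hk
    rw [Matrix.mul_apply]
    simp only [Matrix.transpose_apply, block, Matrix.submatrix_apply, id]
    rw [← Finset.sum_subtype (Finset.univ.filter fun i => c i = k) (by simp)
      (fun i => Λ i l * Λ i l'), Finset.sum_filter]
    exact Finset.sum_congr rfl fun i _ => by split_ifs <;> simp
  · refine Finset.sum_eq_zero fun i _ => ?_
    by_cases h : c i = k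
    · rw [if_neg (show ¬ c i = k' by rw [h]; exact hk), mul_zero]
    · rw [if_neg h, zero_mul]

/-- The projection on the range of the edge probability matrix is block diagonal, and its blocks are
the hat matrices of the blocks of the popularity matrix. -/
lemma IsEigendecomposition.proj_eq (h : IsEigendecomposition (edgeProb Λ c) Ξ D)
    (hm : (singVal (edgeProb Λ c)).support.card = K ^ 2) : Ξ * Ξᵀ = popBlocks Λ c *
      Matrix.blockDiagonal (fun k => ((block Λ c k)ᵀ * block Λ c k)⁻¹) * (popBlocks Λ c)ᵀ := by
  set U := popBlocks Λ c with hU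
  set N := Uᵀ * U with hN
  set G := Matrix.blockDiagonal (fun k => ((block Λ c k)ᵀ * block Λ c k)⁻¹) with hG
  -- the columns of `U` are independent, as `Θ` has rank `K ^ 2`
  have hNu : IsUnit N.det := by
    have h1 : K ^ 2 ≤ U.rank := by
      rw [← hm, ← rank_eq_card_support_singVal, edgeProb_eq_popBlocks, ← Matrix.rank_transpose U]
      exact Matrix.rank_mul_le_right _ _
    have h2 : N.rank = Fintype.card (Fin K × Fin K) := by
      refine le_antisymm (Matrix.rank_le_card_width N) ?_
      rw [hN, Matrix.rank_transpose_mul_self]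
      simpa [sq] using h1
    refine (Matrix.isUnit_iff_isUnit_det _).1 (Matrix.mulVec_surjective_iff_isUnit.1 ?_)
    have h3 : LinearMap.range N.mulVecLin = ⊤ :=
      Submodule.eq_top_of_finrank_eq (by rw [← Matrix.rank, h2]; simp)
    exact LinearMap.range_eq_top.1 h3
  have hNG : N * G = 1 := by
    have hdet : N.det = ∏ k, ((block Λ c k)ᵀ * block Λ c k).det := by
      rw [hN, hU, popBlocks_gram, Matrix.det_blockDiagonal]
    rw [hdet, isUnit_iff_ne_zero, Finset.prod_ne_zero_iff] at hNu
    rw [hN, hU, popBlocks_gram, hG, ← Matrix.blockDiagonal_mul, ← Matrix.blockDiagonal_one]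
    congr 1
    funext k
    exact Matrix.mul_nonsing_inv _ (isUnit_iff_ne_zero.2 (hNu k (Finset.mem_univ k)))
  have hGN : G * N = 1 := mul_eq_one_comm.1 hNG
  set Q := U * G * Uᵀ with hQ
  have hGT : Gᵀ = G := by
    have h1 : Nᵀ = N := by rw [hN, Matrix.transpose_mul, Matrix.transpose_transpose]
    have h2 : Gᵀ * N = 1 := by
      rw [← h1, ← Matrix.transpose_mul, hNG, Matrix.transpose_one]
    calc Gᵀ = Gᵀ * (N * G) := by rw [hNG, Matrix.mul_one]
      _ = G := by rw [← Matrix.mul_assoc, h2, Matrix.one_mul]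
  have hQT : Qᵀ = Q := by
    rw [hQ, Matrix.transpose_mul, Matrix.transpose_mul, Matrix.transpose_transpose, hGT,
      Matrix.mul_assoc]
  have hPΘ : Ξ * Ξᵀ * edgeProb Λ c = edgeProb Λ c := by
    rw [h.2]
    calc _ = Ξ * (Ξᵀ * Ξ) * diagonal D * Ξᵀ := by simp only [Matrix.mul_assoc]
      _ = _ := by rw [h.1, Matrix.mul_one]
  have hPU : Ξ * Ξᵀ * U = U := by
    have h1 : edgeProb Λ c * (U * G) = U.submatrix id Prod.swap := by
      rw [edgeProb_eq_popBlocks, Matrix.mul_assoc, ← Matrix.mul_assoc Uᵀ, ← hN, hNG, Matrix.mul_one]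
    have h2 : Ξ * Ξᵀ * U.submatrix id Prod.swap = U.submatrix id Prod.swap := by
      rw [← h1, ← Matrix.mul_assoc, hPΘ]
    ext i a
    have := congrFun (congrFun h2 i) a.swap
    simpa [Matrix.mul_apply] using this
  have hQΘ : Q * edgeProb Λ c = edgeProb Λ c := by
    rw [← edgeProb_transpose, edgeProb_eq_popBlocks, Matrix.transpose_mul,
      Matrix.transpose_transpose, ← hU, ← Matrix.mul_assoc, hQ]
    congr 1
    rw [Matrix.mul_assoc, ← hN, Matrix.mul_assoc, hGN, Matrix.mul_one]
  have hQΞ : Q * Ξ = Ξ := by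
    have hdd : diagonal D * diagonal (fun r => (D r)⁻¹) = (1 : Matrix _ _ ℝ) := by
      rw [Matrix.diagonal_mul_diagonal, ← Matrix.diagonal_one]
      congr 1
      funext r
      obtain ⟨k, -, -, h0⟩ := h.abs_mem_singVal hm r
      exact mul_inv_cancel₀ h0
    have h1 : edgeProb Λ c * Ξ * diagonal (fun r => (D r)⁻¹) = Ξ := by
      rw [h.mul_eq, Matrix.mul_assoc, hdd, Matrix.mul_one]
    rw [← h1, ← Matrix.mul_assoc, ← Matrix.mul_assoc, hQΘ]
  calc Ξ * Ξᵀ = (Q * (Ξ * Ξᵀ))ᵀ := by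
        rw [← Matrix.mul_assoc, hQΞ, Matrix.transpose_mul, Matrix.transpose_transpose]
    _ = Ξ * Ξᵀ * Q := by
        rw [Matrix.transpose_mul, Matrix.transpose_mul, Matrix.transpose_transpose, hQT]
    _ = Q := by rw [hQ, ← Matrix.mul_assoc, ← Matrix.mul_assoc, hPU]

lemma popBlocks_mul_blockDiagonal_apply (G : Fin K → Matrix (Fin K) (Fin K) ℝ) (i j : Fin n) :
    (popBlocks Λ c * Matrix.blockDiagonal G * (popBlocks Λ c)ᵀ) i j =
      if c i = c j then Λ i ⬝ᵥ (G (c i) *ᵥ Λ j) else 0 := by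
  have h1 : ∀ a : Fin K × Fin K, (popBlocks Λ c * Matrix.blockDiagonal G) i a =
      if c i = a.2 then (Λ i ᵥ* G (c i)) a.1 else 0 := by
    rintro ⟨l, k⟩
    rw [Matrix.mul_apply, Fintype.sum_prod_type]
    simp only [popBlocks, Matrix.of_apply, Matrix.blockDiagonal_apply, ite_mul, zero_mul,
      Finset.sum_ite_eq, Finset.mem_univ, if_true]
    split_ifs with h
    · subst h
      rfl
    · simp
  rw [Matrix.mul_apply, Fintype.sum_prod_type]
  simp only [h1]
  simp only [popBlocks, Matrix.transpose_apply, Matrix.of_apply, ite_mul, zero_mul,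
    Finset.sum_ite_eq, Finset.mem_univ, if_true]
  rw [Matrix.dotProduct_mulVec]
  by_cases h : c i = c j
  · simp [h, dotProduct]
  · simp [h, Ne.symm h]

lemma IsEigendecomposition.proj_apply_self (h : IsEigendecomposition (edgeProb Λ c) Ξ D)
    (hm : (singVal (edgeProb Λ c)).support.card = K ^ 2) (i : Fin n) :
    (Ξ * Ξᵀ) i i = selfForm Λ c i := by
  rw [h.proj_eq hm, popBlocks_mul_blockDiagonal_apply, if_pos rfl]
  rfl

lemma IsEigendecomposition.proj_apply_of_ne (h : IsEigendecomposition (edgeProb Λ c) Ξ D)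
    (hm : (singVal (edgeProb Λ c)).support.card = K ^ 2) {i j : Fin n} (hij : c i ≠ c j) :
    (Ξ * Ξᵀ) i j = 0 := by
  rw [h.proj_eq hm, popBlocks_mul_blockDiagonal_apply, if_neg hij]

end Model

end PABM

/-! ### Concentration of the adjacency matrix -/

namespace PABM

open scoped Matrix.Norms.L2Operator

section Graph

variable {n : ℕ}

/-- The pairs of distinct nodes. -/
abbrev Edge (n : ℕ) : Type := {e : Fin n × Fin n // e.1 < e.2}

/-- The adjacency matrix of the graph with edge indicators `x`. -/
def graphMatrix (x : Edge n → Bool) : Matrix (Fin n) (Fin n) ℝ :=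
  Matrix.of fun i j => if h : i < j then bit (x ⟨(i, j), h⟩) else
    if h : j < i then bit (x ⟨(j, i), h⟩) else 0

/-- The parameters of the edge indicators. -/
def edgeParam (Θ : Matrix (Fin n) (Fin n) ℝ) (e : Edge n) : ℝ := Θ e.1.1 e.1.2

/-- The law of a random graph is the product of the Bernoulli laws of its edges. The set `S` need
not be measurable, as only finitely many matrices are adjacency matrices. -/
lemma IsRandomGraph.measureReal_le {Ω : Type*} [MeasurableSpace Ω] {P : Measure Ω}
    [IsProbabilityMeasure P] {Θ : Matrix (Fin n) (Fin n) ℝ} {A : Ω → Matrix (Fin n) (Fin n) ℝ}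
    (h : IsRandomGraph P Θ A) (hΘ : ∀ e : Edge n, 0 ≤ edgeParam Θ e ∧ edgeParam Θ e ≤ 1)
    (S : Set (Matrix (Fin n) (Fin n) ℝ)) :
    P.real {ω | A ω ∈ S} ≤ bernProb (edgeParam Θ) {x | graphMatrix x ∈ S} := by
  classical
  have hsub : {ω | A ω ∈ S} ⊆ ⋃ x ∈ Finset.univ.filter fun x : Edge n → Bool => graphMatrix x ∈ S,
      ⋂ e ∈ (Finset.univ : Finset (Edge n)), (fun ω => A ω e.1.1 e.1.2) ⁻¹' {bit (x e)} := by
    intro ω hω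
    set x : Edge n → Bool := fun e => decide (A ω e.1.1 e.1.2 = 1) with hx
    have hbit : ∀ e : Edge n, A ω e.1.1 e.1.2 = bit (x e) := by
      intro e
      rcases h.zero_or_one ω e.1.1 e.1.2 with h0 | h1
      · simp [hx, h0, bit]
      · simp [hx, h1, bit]
    have hG : graphMatrix x = A ω := by
      ext i j
      simp only [graphMatrix, Matrix.of_apply, ← hbit]
      split_ifs with h1 h2
      · rfl
      · exact h.symm ω j i
      · have : i = j := le_antisymm (not_lt.1 h2) (not_lt.1 h1)
        rw [this, h.diag_eq_zero]
    refine Set.mem_biUnion (x := x) ?_ ?_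
    · simpa [hG] using hω
    · simp [hbit]
  refine (measureReal_mono hsub (measure_ne_top _ _)).trans
    ((measureReal_biUnion_finset_le _ _).trans ?_)
  have hprob : ∀ x : Edge n → Bool, P.real (⋂ e ∈ (Finset.univ : Finset (Edge n)),
      (fun ω => A ω e.1.1 e.1.2) ⁻¹' {bit (x e)}) = bernWeight (edgeParam Θ) x := by
    intro x
    rw [Measure.real, h.indep.measure_inter_preimage_eq_mul Finset.univ
      (fun e _ => measurableSet_singleton (bit (x e))), ENNReal.toReal_prod, bernWeight]
    refine Finset.prod_congr rfl fun e _ => ?_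
    have h1 : P.real {ω | A ω e.1.1 e.1.2 = 1} = edgeParam Θ e := by
      rw [Measure.real, h.prob_edge _ _ e.2]
      exact ENNReal.toReal_ofReal (hΘ e).1
    cases hxe : x e
    · have hc : (fun ω => A ω e.1.1 e.1.2) ⁻¹' {bit false} = {ω | A ω e.1.1 e.1.2 = 1}ᶜ := by
        ext ω
        rcases h.zero_or_one ω e.1.1 e.1.2 with h0 | h1
        · simp [h0]
        · simp [h1]
      have hm : MeasurableSet {ω | A ω e.1.1 e.1.2 = 1} :=
        h.measurable_entry _ _ (measurableSet_singleton 1)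
      rw [hc, ← Measure.real, measureReal_compl hm, h1]
      simp
    · have hc : (fun ω => A ω e.1.1 e.1.2) ⁻¹' {bit true} = {ω | A ω e.1.1 e.1.2 = 1} := rfl
      rw [hc, ← Measure.real, h1]
      simp
  rw [bernProb, bernMean, Finset.sum_filter]
  refine Finset.sum_le_sum fun x _ => ?_
  by_cases hx : graphMatrix x ∈ S
  · rw [if_pos hx, hprob, Set.indicator_of_mem (by exact hx), mul_one]
  · rw [if_neg hx, Set.indicator_of_notMem (by exact hx), mul_zero]

/-- The edges at the node `i`. -/
def incident (i : Fin n) : Finset (Edge n) :=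
  Finset.univ.filter fun e => e.1.1 = i ∨ e.1.2 = i

/-- The other end of an edge at the node `i`. -/
def otherEnd (i : Fin n) (e : Edge n) : Fin n := if e.1.1 = i then e.1.2 else e.1.1

/-- The edges at `i` correspond to the other nodes. -/
lemma sum_incident {M : Type*} [AddCommMonoid M] (i : Fin n) (f : Fin n → M) :
    ∑ e ∈ incident i, f (otherEnd i e) = ∑ j ∈ Finset.univ.erase i, f j := by
  refine Finset.sum_nbij (otherEnd i) ?_ ?_ ?_ fun _ _ => rfl
  · rintro ⟨⟨a, b⟩, hab⟩ he
    simp only [incident, Finset.mem_filter, Finset.mem_univ, true_and] at he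
    simp only [otherEnd, Finset.mem_erase, Finset.mem_univ, and_true]
    simp only at hab
    split_ifs with h
    · rw [← h]; exact hab.ne'
    · exact h
  · rintro ⟨⟨a, b⟩, hab⟩ he ⟨⟨a', b'⟩, hab'⟩ he' heq
    simp only [incident, Finset.coe_filter, Finset.mem_univ, true_and, Set.mem_ofPred_eq] at he he'
    simp only [otherEnd] at heq
    simp only [Subtype.mk.injEq, Prod.mk.injEq]
    simp only at hab hab'
    grind
  · intro j hj
    have hji : j ≠ i := by simpa using hj
    rcases lt_or_gt_of_ne hji with h | h
    · exact ⟨⟨(j, i), h⟩, by simp [incident], by simp [otherEnd, hji]⟩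
    · exact ⟨⟨(i, j), h⟩, by simp [incident], by simp [otherEnd]⟩

lemma graphMatrix_apply_otherEnd (x : Edge n → Bool) {i : Fin n} {e : Edge n}
    (he : e ∈ incident i) : graphMatrix x i (otherEnd i e) = bit (x e) := by
  obtain ⟨⟨a, b⟩, hab⟩ := e
  simp only [incident, Finset.mem_filter, Finset.mem_univ, true_and] at he
  simp only at hab
  by_cases h : a = i
  · subst h
    simp [graphMatrix, otherEnd, hab]
  · have hb : b = i := by tauto
    subst hb
    simp [graphMatrix, otherEnd, h, hab, not_lt.2 hab.le]

lemma edgeParam_eq_otherEnd {Θ : Matrix (Fin n) (Fin n) ℝ} (hΘ : Θᵀ = Θ) {i : Fin n} {e : Edge n}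
    (he : e ∈ incident i) : edgeParam Θ e = Θ i (otherEnd i e) := by
  simp only [incident, Finset.mem_filter, Finset.mem_univ, true_and] at he
  unfold edgeParam otherEnd
  split_ifs with h
  · rw [h]
  · rw [he.resolve_left h, ← Matrix.transpose_apply Θ, hΘ]

/-- The matrix `M` with its row and its column of index `i` replaced by zeros. -/
def deleteNode (i : Fin n) (M : Matrix (Fin n) (Fin n) ℝ) : Matrix (Fin n) (Fin n) ℝ :=
  Matrix.of fun a b => if a = i ∨ b = i then 0 else M a b

lemma deleteNode_graphMatrix_update (x : Edge n → Bool) {i : Fin n} {e : Edge n}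
    (he : e ∈ incident i) (b : Bool) :
    deleteNode i (graphMatrix (Function.update x e b)) = deleteNode i (graphMatrix x) := by
  simp only [incident, Finset.mem_filter, Finset.mem_univ, true_and] at he
  ext a a'
  simp only [deleteNode, Matrix.of_apply]
  split_ifs with h
  · rfl
  · have hne : ∀ h', (⟨(a, a'), h'⟩ : Edge n) ≠ e := by rintro h' rfl; exact h he
    have hne' : ∀ h', (⟨(a', a), h'⟩ : Edge n) ≠ e := by rintro h' rfl; exact h he.symm
    simp [graphMatrix, hne, hne']

/-- The column `j` of `M` as a vector of the Euclidean space. -/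
noncomputable def colVec (M : Matrix (Fin n) (Fin n) ℝ) (j : Fin n) : EuclideanSpace ℝ (Fin n) :=
  WithLp.toLp 2 fun l => M l j

/-- The largest norm of a column of `M`. -/
noncomputable def colMax (M : Matrix (Fin n) (Fin n) ℝ) : ℝ := ⨆ j, ‖colVec M j‖

lemma norm_colVec_le_colMax (M : Matrix (Fin n) (Fin n) ℝ) (j : Fin n) :
    ‖colVec M j‖ ≤ colMax M :=
  le_ciSup (f := fun j => ‖colVec M j‖) (Set.finite_range _).bddAbove j

section Tails

variable {Θ : Matrix (Fin n) (Fin n) ℝ} (hp : ∀ e : Edge n, 0 ≤ edgeParam Θ e ∧ edgeParam Θ e ≤ 1)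
  (hΘ : Θᵀ = Θ)

include hp hΘ

/-- Upper tail of the degrees. -/
lemma bernProb_degree_le (i : Fin n) (hΘ0 : ∀ j, 0 ≤ Θ i j) {q : ℕ} {V : ℝ} (hV : 0 < V)
    (hq : q ≤ V) (hsum : ∑ j, Θ i j ≤ V) :
    bernProb (edgeParam Θ) {x | Real.exp 9 * V ≤
      ∑ j ∈ Finset.univ.erase i, (graphMatrix x i j + Θ i j)} ≤ Real.exp (-(6 * q)) := by
  have hsum' : ∀ x : Edge n → Bool, ∑ j ∈ Finset.univ.erase i, (graphMatrix x i j + Θ i j) =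
      ∑ e ∈ incident i, (bit (x e) + edgeParam Θ e) * 1 := by
    intro x
    rw [← sum_incident]
    refine Finset.sum_congr rfl fun e he => ?_
    rw [graphMatrix_apply_otherEnd x he, edgeParam_eq_otherEnd hΘ he, mul_one]
  simp only [hsum']
  have h := bernProb_le_of_moment hp (N := 1) (q := q)
    (f := fun x => ∑ e ∈ incident i, (bit (x e) + edgeParam Θ e) * 1)
    (fun x => Finset.sum_nonneg fun e _ =>
      mul_nonneg (add_nonneg (bit_nonneg _) (hp e).1) zero_le_one) hV (by
      rw [one_mul]
      refine bernMean_weighted_pow_le hp (incident i) (fun _ _ => 1) (fun _ _ _ => zero_le_one)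
        (fun _ _ _ _ _ _ => rfl) hV (fun _ _ _ => by simpa using hq) fun x => ?_
      have h1 : ∑ e ∈ incident i, edgeParam Θ e * 1 = ∑ j ∈ Finset.univ.erase i, Θ i j := by
        rw [← sum_incident]
        exact Finset.sum_congr rfl fun e he => by rw [edgeParam_eq_otherEnd hΘ he, mul_one]
      rw [h1]
      refine le_trans ?_ hsum
      exact Finset.sum_le_sum_of_subset_of_nonneg (Finset.erase_subset _ _) fun j _ _ => hΘ0 j)
  simpa using h

/-- A matrix that does not depend on the edges at `i` does not increase the noise vector at `i` by
more than its columns allow: Bernstein's inequality, conditionally on the other edges. -/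
lemma bernProb_decoupled_le (i : Fin n)
    (R : Matrix (Fin n) (Fin n) ℝ → Matrix (Fin n) (Fin n) ℝ) {m r : ℝ} (hr : 0 < r) (hm : 0 < m)
    (hΘ0 : ∀ j, 0 ≤ Θ i j) (hΘr : ∀ j, Θ i j ≤ r) (hR : ∀ M, ∑ j, ‖colVec (R M) j‖ ^ 2 ≤ m)
    (q : ℕ) :
    bernProb (edgeParam Θ) {x | Real.exp 9 * ((q + 1 : ℕ) *
        (r * m + (q + 1 : ℕ) * colMax (R (deleteNode i (graphMatrix x))) ^ 2)) ≤
      ‖∑ j ∈ Finset.univ.erase i, (graphMatrix x i j - Θ i j) •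
        colVec (R (deleteNode i (graphMatrix x))) j‖ ^ 2} ≤ Real.exp (-(6 * (q + 1 : ℕ))) := by
  set Q : ℝ := ((q + 1 : ℕ) : ℝ) with hQ
  have hQ0 : 0 < Q := by positivity
  set RR : (Edge n → Bool) → Matrix (Fin n) (Fin n) ℝ := fun x => R (deleteNode i (graphMatrix x))
    with hRR
  set V : (Edge n → Bool) → ℝ := fun x => r * m + Q * colMax (RR x) ^ 2 with hV
  have hV0 : ∀ x, 0 < V x := fun x => by
    have : 0 < r * m := mul_pos hr hm
    have : 0 ≤ Q * colMax (RR x) ^ 2 := by positivity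
    simp only [hV]
    linarith
  have hRRinv : ∀ l ∈ incident i, ∀ x b, RR (Function.update x l b) = RR x := by
    intro l hl x b
    simp only [hRR, deleteNode_graphMatrix_update x hl]
  -- the coefficients are normalised by a function of the edges that are not at `i`
  set v : Edge n → (Edge n → Bool) → EuclideanSpace ℝ (Fin n) := fun e x =>
    (Real.sqrt (V x))⁻¹ • colVec (RR x) (otherEnd i e) with hv
  have hinv : ∀ k ∈ incident i, ∀ l ∈ incident i, ∀ x b, v k (Function.update x l b) = v k x := by
    intro k _ l hl x b
    simp only [hv, hV, hRRinv l hl]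
  have hvn : ∀ e x, ‖v e x‖ ^ 2 = ‖colVec (RR x) (otherEnd i e)‖ ^ 2 / V x := by
    intro e x
    simp only [hv]
    rw [norm_smul, mul_pow, norm_inv, inv_pow, Real.norm_eq_abs, sq_abs, Real.sq_sqrt (hV0 x).le,
      mul_comm, div_eq_mul_inv]
  have hS : ∀ x, centredSum (edgeParam Θ) (incident i) v x = (Real.sqrt (V x))⁻¹ •
      ∑ j ∈ Finset.univ.erase i, (graphMatrix x i j - Θ i j) • colVec (RR x) j := by
    intro x
    rw [← sum_incident, Finset.smul_sum, centredSum]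
    refine Finset.sum_congr rfl fun e he => ?_
    rw [graphMatrix_apply_otherEnd x he, edgeParam_eq_otherEnd hΘ he, smul_comm]
  have hmom := bernMean_norm_centredSum_pow_le hp (incident i) v hinv q
  have hmom2 := bernMean_weighted_pow_le hp (incident i) (fun e x => ‖v e x‖ ^ 2)
    (fun _ _ _ => sq_nonneg _) (fun k hk l hl x b => by simp only [hinv k hk l hl]) (q := q + 1)
    (V := 1) one_pos
    (fun e _ x => by
      rw [hvn, ← mul_div_assoc, div_le_one (hV0 x)]
      have h1 : ‖colVec (RR x) (otherEnd i e)‖ ^ 2 ≤ colMax (RR x) ^ 2 :=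
        pow_le_pow_left₀ (norm_nonneg _) (norm_colVec_le_colMax _ _) 2
      have h2 := mul_le_mul_of_nonneg_left h1 hQ0.le
      have h3 : 0 < r * m := mul_pos hr hm
      simp only [hV]
      linarith)
    (fun x => by
      simp only [hvn, ← mul_div_assoc]
      rw [← Finset.sum_div, div_le_one (hV0 x)]
      have h1 : ∑ e ∈ incident i, edgeParam Θ e * ‖colVec (RR x) (otherEnd i e)‖ ^ 2 =
          ∑ j ∈ Finset.univ.erase i, Θ i j * ‖colVec (RR x) j‖ ^ 2 := by
        rw [← sum_incident]
        exact Finset.sum_congr rfl fun e he => by rw [edgeParam_eq_otherEnd hΘ he]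
      rw [h1]
      have h2 : ∑ j ∈ Finset.univ.erase i, Θ i j * ‖colVec (RR x) j‖ ^ 2 ≤
          ∑ j, r * ‖colVec (RR x) j‖ ^ 2 :=
        (Finset.sum_le_sum_of_subset_of_nonneg (Finset.erase_subset _ _) fun j _ _ =>
          mul_nonneg (hΘ0 j) (sq_nonneg _)).trans
          (Finset.sum_le_sum fun j _ => mul_le_mul_of_nonneg_right (hΘr j) (sq_nonneg _))
      rw [← Finset.mul_sum] at h2
      have h3 := mul_le_mul_of_nonneg_left (hR (deleteNode i (graphMatrix x))) hr.le
      have h4 : 0 ≤ Q * colMax (RR x) ^ 2 := by positivity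
      simp only [hV]
      linarith)
  have htail := bernProb_le_of_moment hp (N := 1) (q := q + 1) (W := Q)
    (f := fun x => ‖centredSum (edgeParam Θ) (incident i) v x‖ ^ 2) (fun x => sq_nonneg _) hQ0 (by
      simp only [← pow_mul]
      refine hmom.trans ?_
      simp only [mul_pow] at hmom2 ⊢
      rw [bernMean_const_mul, one_mul]
      have := mul_le_mul_of_nonneg_left hmom2 (show 0 ≤ (Q ^ (q + 1) : ℝ) by positivity)
      simp only [hQ, Nat.cast_add, Nat.cast_one, one_pow] at this ⊢
      linarith)
  rw [one_mul] at htail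
  refine le_trans (bernProb_mono hp ?_) htail
  intro x hx
  simp only [Set.mem_ofPred_eq] at hx ⊢
  rw [hS, norm_smul, mul_pow, norm_inv, inv_pow, Real.norm_eq_abs, sq_abs, Real.sq_sqrt (hV0 x).le,
    inv_mul_eq_div, le_div_iff₀ (hV0 x)]
  calc Real.exp 9 * Q * V x = Real.exp 9 * (Q * V x) := by ring
    _ ≤ _ := hx

/-- Operator norm of the centred adjacency matrix, which differs from `A - Θ` by the diagonal of
`Θ`, as there are no self-loops. -/
lemma bernProb_norm_le (hΘ0 : ∀ i j, 0 ≤ Θ i j) (q : ℕ) {V : ℝ} (hV : 0 < V)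
    (hq : (q + 1 : ℕ) ≤ V) (hsum : ∀ i, ∑ j, Θ i j ≤ V) :
    bernProb (edgeParam Θ) {x | Real.exp 9 * ((q + 1 : ℕ) * V) ≤
      ‖graphMatrix x - Θ + diagonal (fun i => Θ i i)‖ ^ 2} ≤
      (n : ℝ) ^ 2 * Real.exp (-(6 * (q + 1 : ℕ))) := by
  set H : Edge n → Matrix (Fin n) (Fin n) ℝ := fun e =>
    Matrix.single e.1.1 e.1.2 1 + Matrix.single e.1.2 e.1.1 1 with hH
  have hHT : ∀ e, (H e)ᵀ = H e := by
    intro e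
    simp only [hH, Matrix.transpose_add, Matrix.transpose_single]
    rw [add_comm]
  set cc : Edge n → Fin n → ℝ := fun e i => if e.1.1 = i ∨ e.1.2 = i then 1 else 0 with hcc
  have hc0 : ∀ e i, 0 ≤ cc e i := fun e i => by
    simp only [hcc]; split_ifs <;> simp
  have hsq : ∀ e, H e ^ 2 = diagonal (cc e) := by
    rintro ⟨⟨a, b⟩, hab⟩
    simp only at hab
    have hne := hab.ne
    simp only [hH, sq, Matrix.add_mul, Matrix.mul_add]
    rw [Matrix.single_mul_single_of_ne _ _ _ _ hne.symm, Matrix.single_mul_single_same,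
      Matrix.single_mul_single_same, Matrix.single_mul_single_of_ne _ _ _ _ hne]
    ext i j
    simp only [hcc, Matrix.add_apply, Matrix.single_apply, Matrix.diagonal_apply, Matrix.zero_apply]
    grind
  have hX : ∀ x : Edge n → Bool, centredSum (edgeParam Θ) Finset.univ (fun e _ => H e) x =
      graphMatrix x - Θ + diagonal (fun i => Θ i i) := by
    intro x
    ext i j
    simp only [centredSum, Matrix.sum_apply, Matrix.smul_apply, smul_eq_mul, Matrix.add_apply,
      Matrix.sub_apply, Matrix.diagonal_apply, hH, Matrix.single_apply]
    rcases lt_trichotomy i j with h | h | h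
    · rw [Finset.sum_eq_single (⟨(i, j), h⟩ : Edge n)]
      · simp [graphMatrix, h, h.ne, h.ne', edgeParam]
      · rintro ⟨⟨a, b⟩, hab⟩ _ hne
        simp only [ne_eq, Subtype.mk.injEq, Prod.mk.injEq] at hne hab
        rw [if_neg (by tauto), if_neg (by rintro ⟨rfl, rfl⟩; exact absurd hab (not_lt.2 h.le))]
        simp
      · simp
    · subst h
      rw [Finset.sum_eq_zero]
      · simp [graphMatrix]
      · rintro ⟨⟨a, b⟩, hab⟩ _
        have h1 : ¬(a = i ∧ b = i) := fun h => absurd hab (by simp [h.1, h.2])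
        have h2 : ¬(b = i ∧ a = i) := fun h => h1 h.symm
        simp [h1, h2]
    · rw [Finset.sum_eq_single (⟨(j, i), h⟩ : Edge n)]
      · have : Θ j i = Θ i j := by rw [← Matrix.transpose_apply Θ, hΘ]
        simp [graphMatrix, h, h.ne, h.ne', not_lt.2 h.le, edgeParam, this]
      · rintro ⟨⟨a, b⟩, hab⟩ _ hne
        simp only [ne_eq, Subtype.mk.injEq, Prod.mk.injEq] at hne hab
        rw [if_neg (by rintro ⟨rfl, rfl⟩; exact absurd hab (not_lt.2 h.le)), if_neg (by tauto)]
        simp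
      · simp
  have hXT : ∀ x : Edge n → Bool, (graphMatrix x - Θ + diagonal (fun i => Θ i i))ᵀ =
      graphMatrix x - Θ + diagonal (fun i => Θ i i) := by
    intro x
    rw [← hX]
    simp only [centredSum, Matrix.transpose_sum, Matrix.transpose_smul, hHT]
  have hmom := bernMean_trace_centredSum_pow_le hp H hHT cc hc0 hsq q
  have hdeg : ∀ i, bernMean (edgeParam Θ) (fun x =>
      ((q + 1 : ℝ) * ∑ e, (bit (x e) + edgeParam Θ e) * cc e i) ^ (q + 1)) ≤
      (Real.exp 3 * ((q + 1 : ℕ) * V)) ^ (q + 1) := by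
    intro i
    simp only [mul_pow]
    rw [bernMean_const_mul]
    have h1 := bernMean_weighted_pow_le hp Finset.univ (fun e _ => cc e i)
      (fun e _ _ => hc0 e i) (fun _ _ _ _ _ _ => rfl) (q := q + 1) hV
      (fun e _ _ => by
        refine le_trans (mul_le_of_le_one_right (Nat.cast_nonneg _) ?_) hq
        simp only [hcc]; split_ifs <;> simp)
      (fun x => by
        refine le_trans (le_of_eq ?_) ((Finset.sum_le_sum_of_subset_of_nonneg
          (Finset.erase_subset i _) fun j _ _ => hΘ0 i j).trans (hsum i))
        rw [← sum_incident]
        simp only [hcc, mul_ite, mul_one, mul_zero]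
        rw [← Finset.sum_filter]
        exact Finset.sum_congr rfl fun e he => edgeParam_eq_otherEnd hΘ he)
    have := mul_le_mul_of_nonneg_left h1 (show 0 ≤ ((q : ℝ) + 1) ^ (q + 1) by positivity)
    refine this.trans (le_of_eq ?_)
    push_cast
    ring
  refine bernProb_le_of_moment hp (fun x => sq_nonneg _) (by positivity) ?_
  calc _ ≤ bernMean (edgeParam Θ) (fun x =>
        ((centredSum (edgeParam Θ) Finset.univ (fun e _ => H e) x) ^ (2 * (q + 1))).trace) := by
        refine bernMean_mono hp fun x => ?_
        rw [hX, ← pow_mul]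
        exact norm_pow_le_trace (hXT x) q
    _ ≤ _ := hmom
    _ ≤ n * ∑ _i : Fin n, (Real.exp 3 * ((q + 1 : ℕ) * V)) ^ (q + 1) := by
        gcongr with i
        exact hdeg i
    _ = _ := by
        rw [Finset.sum_const, Finset.card_univ, Fintype.card_fin, nsmul_eq_mul]
        ring

end Tails

end Graph

end PABM

/-! ### Row-wise perturbation of the spectral projection -/

namespace PABM

open scoped Matrix.Norms.L2Operator

section RowWise

variable {n : ℕ}

lemma op_single (M : Matrix (Fin n) (Fin n) ℝ) (i : Fin n) :
    op M (EuclideanSpace.single i 1) = colVec M i := by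
  ext l
  simp [colVec, EuclideanSpace.single]

lemma op_sub (M N : Matrix (Fin n) (Fin n) ℝ) : op (M - N) = op M - op N := map_sub _ M N

lemma op_colVec (M N : Matrix (Fin n) (Fin n) ℝ) (i : Fin n) :
    op M (colVec N i) = ∑ j, N j i • colVec M j := by
  ext l
  simp [colVec, Matrix.toEuclideanCLM_toLp, Matrix.mulVec, dotProduct, mul_comm]

lemma IsLeadingEigenvectors.orthonormal {m : ℕ} {M : Matrix (Fin n) (Fin n) ℝ}
    {X : Matrix (Fin n) (Fin m) ℝ} (h : IsLeadingEigenvectors M X) : Xᵀ * X = 1 := by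
  obtain ⟨V, D, s, hA, -, hV⟩ := h
  ext r t
  have := congrFun (congrFun hA.1 (s r)) (s t)
  rw [Matrix.mul_apply] at this ⊢
  simp only [Matrix.transpose_apply, hV] at this ⊢
  rw [this]
  simp [Matrix.one_apply]

lemma norm_colVec_proj_sq {m : ℕ} {X : Matrix (Fin n) (Fin m) ℝ} (h : Xᵀ * X = 1) (i : Fin n) :
    ‖colVec (X * Xᵀ) i‖ ^ 2 = (X * Xᵀ) i i := by
  have h1 : X * Xᵀ * (X * Xᵀ) = X * Xᵀ := by
    calc _ = X * (Xᵀ * X) * Xᵀ := by simp only [Matrix.mul_assoc]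
      _ = _ := by rw [h, Matrix.mul_one]
  have h2 : (X * Xᵀ)ᵀ = X * Xᵀ := by rw [Matrix.transpose_mul, Matrix.transpose_transpose]
  nth_rewrite 2 [← h1]
  rw [EuclideanSpace.norm_sq_eq, Matrix.mul_apply]
  refine Finset.sum_congr rfl fun l _ => ?_
  nth_rewrite 2 [← h2]
  rw [Matrix.transpose_apply, colVec, Real.norm_eq_abs, sq_abs, sq]

open Classical in
/-- The projection on some `m` leading eigenvectors of `M` (zero if there are none). The choice only
depends on `M`, which makes it independent of the edges that do not enter `M`. -/
noncomputable def leadProj (m : ℕ) (M : Matrix (Fin n) (Fin n) ℝ) : Matrix (Fin n) (Fin n) ℝ :=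
  if h : ∃ X : Matrix (Fin n) (Fin m) ℝ, IsLeadingEigenvectors M X then
    h.choose * h.chooseᵀ else 0

lemma sum_norm_colVec_leadProj_sq_le (m : ℕ) (M : Matrix (Fin n) (Fin n) ℝ) :
    ∑ j, ‖colVec (leadProj m M) j‖ ^ 2 ≤ m := by
  unfold leadProj
  split_ifs with h
  · have h1 := h.choose_spec.orthonormal
    simp only [norm_colVec_proj_sq h1]
    have : ∑ j, (h.choose * h.chooseᵀ) j j = (h.choose * h.chooseᵀ).trace := rfl
    rw [this, Matrix.trace_mul_comm, h1]
    simp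
  · have : ∀ j, colVec (0 : Matrix (Fin n) (Fin n) ℝ) j = 0 := fun j => by ext; simp [colVec]
    simp [this]

/-- A graph whose noise matrix `A - Θ` satisfies, up to the factor `κ`, the bounds that independent
edges of probability at most `ρ ^ 2` satisfy with high probability. In `decoupled`, the leading
eigenvectors are those of the graph without the node `i`. -/
structure IsRegularGraph (K : ℕ) (ρ κ : ℝ) (Θ A : Matrix (Fin n) (Fin n) ℝ) : Prop where
  symm : Aᵀ = A
  diag_eq_zero : ∀ i, A i i = 0
  norm_le : ‖A - Θ‖ ≤ κ * (ρ * Real.sqrt (n * Real.log n))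
  noise_col_le : ∀ i, ‖colVec (A - Θ) i‖ ≤ κ * (ρ * Real.sqrt n)
  col_le : ∀ i, ‖colVec A i‖ ≤ κ * (ρ * Real.sqrt n)
  decoupled : ∀ i, ‖∑ j ∈ Finset.univ.erase i, (A i j - Θ i j) •
      colVec (leadProj (K ^ 2) (deleteNode i A)) j‖ ≤
    κ * (ρ * K * Real.sqrt (Real.log n)) +
      κ * Real.log n * colMax (leadProj (K ^ 2) (deleteNode i A))

/-- Deleting the node `i` is a perturbation of rank two. -/
lemma op_sub_deleteNode {A : Matrix (Fin n) (Fin n) ℝ} (hA : Aᵀ = A) (hd : ∀ i, A i i = 0)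
    (i : Fin n) (x : EuclideanSpace ℝ (Fin n)) :
    (op A - op (deleteNode i A)) x = inner ℝ (op A (EuclideanSpace.single i 1)) x •
      EuclideanSpace.single i (1 : ℝ) + inner ℝ (EuclideanSpace.single i (1 : ℝ)) x •
      op A (EuclideanSpace.single i 1) := by
  rw [op_single, ← map_sub]
  ext l
  have hsym : ∀ a b, A a b = A b a := fun a b => by rw [← Matrix.transpose_apply A, hA]
  simp only [colVec, Matrix.ofLp_toEuclideanCLM, Matrix.mulVec, dotProduct, Matrix.sub_apply,
    deleteNode, Matrix.of_apply, PiLp.add_apply, PiLp.smul_apply, smul_eq_mul,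
    PiLp.inner_apply, PiLp.single_apply,
    RCLike.inner_apply, conj_trivial]
  by_cases hl : l = i
  · subst hl
    simp only [true_or, if_true, sub_zero, hd, mul_zero, add_zero, mul_one]
    exact Finset.sum_congr rfl fun j _ => by rw [hsym, mul_comm]
  · simp only [hl, false_or, if_false, mul_zero, zero_add]
    rw [Finset.sum_eq_single i]
    · simp [mul_comm]
    · intro j _ hj
      simp [hj]
    · simp

/-- All rows of the spectral projection of a regular graph are close to those of the projection of
the edge probability matrix. -/
lemma IsRegularGraph.norm_colVec_sub_le {K : ℕ} {ρ κ σ s C₁ : ℝ}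
    {Θ A : Matrix (Fin n) (Fin n) ℝ}
    {Ξ Ξhat : Matrix (Fin n) (Fin (K ^ 2)) ℝ} {δ : Fin (K ^ 2) → ℝ}
    (h : IsRegularGraph K ρ κ Θ A) (hn : 0 < n) (hρ : 0 < ρ) (hκ : 0 < κ) (hs : 0 ≤ s)
    (hC₁ : 0 ≤ C₁) (hL : 1 ≤ Real.log n) (hLρ : Real.log n ≤ ρ * Real.sqrt n) (hσ0 : 0 < σ)
    (hσ : 32 * (κ * (ρ * Real.sqrt (n * Real.log n))) ≤ σ)
    (hΘ : IsEigendecomposition Θ Ξ δ) (hδ : ∀ r, σ ≤ |δ r|)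
    (hΘn : ‖Θ‖ ≤ C₁ * Real.sqrt (Real.log n) * σ)
    (hP : ∀ i, ‖colVec (Ξ * Ξᵀ) i‖ ≤ s * (K / Real.sqrt n))
    (hlead : IsLeadingEigenvectors A Ξhat) (i : Fin n) :
    ‖colVec (Ξhat * Ξhatᵀ - Ξ * Ξᵀ) i‖ ≤ κ * (36 * s + 6 + 192 * C₁ * s) *
      (ρ * K * Real.sqrt (Real.log n) / σ) := by
  have : NeZero n := ⟨hn.ne'⟩
  set L := Real.log n with hLdef
  set l := Real.sqrt L with hl
  set N := Real.sqrt n with hN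
  have hl1 : 1 ≤ l := Real.one_le_sqrt.2 hL
  have hN0 : 0 < N := Real.sqrt_pos.2 (by exact_mod_cast hn)
  have hsqrt : Real.sqrt (n * L) = N * l := Real.sqrt_mul (Nat.cast_nonneg n) L
  rw [hsqrt] at hσ
  have hnorm : ‖A - Θ‖ ≤ κ * (ρ * (N * l)) := by rw [← hsqrt]; exact h.norm_le
  have hNl : κ * (ρ * N) ≤ κ * (ρ * (N * l)) := by
    have : N ≤ N * l := le_mul_of_one_le_right hN0.le hl1
    gcongr
  -- orthonormal vectors are at most as many as the dimension
  have hm : K ^ 2 ≤ n := by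
    have h1 : (1 : Matrix (Fin (K ^ 2)) (Fin (K ^ 2)) ℝ).rank ≤ n := by
      rw [← hΘ.1]
      exact (Matrix.rank_mul_le_right _ _).trans (Matrix.rank_le_height Ξ)
    simpa using h1
  have hmul : ∀ j, (op (Ξ * Ξᵀ)) (EuclideanSpace.single j 1) = colVec (Ξ * Ξᵀ) j := op_single _
  obtain ⟨S, hS⟩ := hΘ.spectralSplit hσ0 hδ
  have hAn : ‖A - Θ‖ ≤ σ / 8 := by
    have : 0 ≤ κ * (ρ * (N * l)) := by positivity
    linarith
  obtain ⟨B, hB⟩ := hlead.spectralSplit hΘ hσ0 hδ hAn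
  -- deleting a node is a perturbation of the size of a column, so the gap persists
  have hdel : ∀ j, ∃ B', SpectralSplit (op (deleteNode j A))
      (op (leadProj (K ^ 2) (deleteNode j A))) B' (σ / 8) (2 / σ) := by
    intro j
    have hT : (deleteNode j A)ᵀ = deleteNode j A := by
      ext a b
      have hsym : A b a = A a b := by rw [← Matrix.transpose_apply A, h.symm]
      simp only [deleteNode, Matrix.transpose_apply, Matrix.of_apply, hsym, or_comm]
    have hex : ∃ X : Matrix (Fin n) (Fin (K ^ 2)) ℝ, IsLeadingEigenvectors (deleteNode j A) X :=
      exists_isLeadingEigenvectors hm hT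
    have hdiff : ‖A - deleteNode j A‖ ≤ 2 * (κ * (ρ * N)) := by
      rw [← norm_op, op_sub]
      refine ContinuousLinearMap.opNorm_le_bound _ (by positivity) fun x => ?_
      rw [op_sub_deleteNode h.symm h.diag_eq_zero]
      have h1 : ‖op A (EuclideanSpace.single j 1)‖ ≤ κ * (ρ * N) := by
        rw [op_single]; exact h.col_le j
      have h2 := norm_inner_le_norm (𝕜 := ℝ) (op A (EuclideanSpace.single j 1)) x
      have h3 := norm_inner_le_norm (𝕜 := ℝ) (EuclideanSpace.single j (1 : ℝ)) x
      refine (norm_add_le _ _).trans ?_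
      rw [norm_smul, norm_smul]
      have h4 : ‖(EuclideanSpace.single j (1 : ℝ) : EuclideanSpace ℝ (Fin n))‖ = 1 := by simp
      rw [h4] at h3 ⊢
      have h5 := mul_le_mul_of_nonneg_right h1 (norm_nonneg x)
      have h6 := mul_le_mul h3 h1 (norm_nonneg _) (by positivity)
      linarith
    have hn' : ‖deleteNode j A - Θ‖ ≤ σ / 8 := by
      have e : deleteNode j A - Θ = (A - Θ) - (A - deleteNode j A) := by abel
      rw [e]
      refine (norm_sub_le _ _).trans ?_
      have : 0 ≤ κ * (ρ * (N * l)) := by positivity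
      linarith
    rw [leadProj, dif_pos hex]
    exact hex.choose_spec.spectralSplit hΘ hσ0 hδ hn'
  choose B' hB' using hdel
  have hb : κ * L ≤ κ * (ρ * N) := mul_le_mul_of_nonneg_left hLρ hκ.le
  have key := norm_sub_apply_le_of_leaveOneOut (γ := κ * (ρ * (N * l)) / σ) (τ := C₁ * l * σ)
    (p := s * (K / N)) (w := κ * (ρ * N)) (a := κ * (ρ * K * l)) (b := κ * L)
    (e := fun j => (EuclideanSpace.single j (1 : ℝ) : EuclideanSpace ℝ (Fin n)))
    hσ0 hS hB hB' (fun j => by simp)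
    (fun j => by
      rw [op_single]
      ext a
      simp [colVec, deleteNode])
    (fun j x => op_sub_deleteNode h.symm h.diag_eq_zero j x)
    (fun j => by rw [hmul]; exact hP j)
    (by rw [norm_op]; exact hΘn)
    (by
      rw [← map_sub, norm_op, div_mul_cancel₀ _ hσ0.ne']
      exact hnorm)
    (by
      rw [← mul_div_assoc, div_le_one hσ0]
      have : 0 ≤ κ * (ρ * (N * l)) := by positivity
      linarith)
    (fun j => by rw [← map_sub, op_single]; exact h.noise_col_le j)
    (fun j => by rw [op_single]; exact h.col_le j)
    (by linarith) (by positivity) (by positivity) (by linarith)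
    (fun j W hW => by
      rw [← map_sub, op_single, op_colVec]
      simp only [op_single] at hW
      have h0 : colVec (leadProj (K ^ 2) (deleteNode j A)) j = 0 := by
        rw [← op_single, ← (hB' j).inv_mul, mul_apply_eq_comp, op_single]
        have : colVec (deleteNode j A) j = 0 := by
          ext a
          simp [colVec, deleteNode]
        rw [this, map_zero]
      rw [← Finset.add_sum_erase _ _ (Finset.mem_univ j), h0, smul_zero, zero_add]
      have hsym : ∀ t, (A - Θ) t j = A j t - Θ j t := by
        intro t
        rw [Matrix.sub_apply, ← Matrix.transpose_apply A, ← Matrix.transpose_apply Θ, h.symm,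
          hΘ.transpose_eq]
      simp only [hsym]
      refine (h.decoupled j).trans (add_le_add le_rfl ?_)
      exact mul_le_mul_of_nonneg_left (ciSup_le hW) (by positivity)) i
  rw [← map_sub, op_single] at key
  refine key.trans ?_
  -- every term is a multiple of `ρ * K * l / σ`
  have t1 : 4 * (κ * (ρ * (N * l)) / σ) * (s * (K / N)) = κ * (4 * s) * (ρ * K * l / σ) := by
    field_simp
  have t2 : 8 * (κ * L + κ * (ρ * N)) * (C₁ * l * σ) * (s * (K / N)) / σ ≤
      16 * κ * C₁ * s * (ρ * K * l) := by
    have e1 : 8 * (κ * L + κ * (ρ * N)) * (C₁ * l * σ) * (s * (K / N)) / σ =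
        (κ * L + κ * (ρ * N)) * (8 * C₁ * l * s * (K / N)) := by
      field_simp
    have e2 : 16 * κ * C₁ * s * (ρ * K * l) =
        (κ * (ρ * N) + κ * (ρ * N)) * (8 * C₁ * l * s * (K / N)) := by
      field_simp
      ring
    rw [e1, e2]
    gcongr
  have t3 : (24 * (κ * L) + 8 * (κ * (ρ * N))) * (s * (K / N)) ≤ 32 * κ * s * (ρ * K * l) := by
    have e2 : 32 * κ * s * (ρ * K * 1) =
        (24 * (κ * (ρ * N)) + 8 * (κ * (ρ * N))) * (s * (K / N)) := by
      field_simp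
      ring
    calc _ ≤ (24 * (κ * (ρ * N)) + 8 * (κ * (ρ * N))) * (s * (K / N)) := by gcongr
      _ = 32 * κ * s * (ρ * K * 1) := e2.symm
      _ ≤ _ := by gcongr
  calc _ ≤ κ * (4 * s) * (ρ * K * l / σ) + (6 * (κ * (ρ * K * l)) +
        12 * (16 * κ * C₁ * s * (ρ * K * l)) + 32 * κ * s * (ρ * K * l)) / σ := by
        rw [t1]
        gcongr
    _ = _ := by ring

end RowWise

end PABM

/-! ### Random graphs are regular -/

namespace PABM

open scoped Matrix.Norms.L2Operator

section Probability

variable {n : ℕ}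

lemma graphMatrix_transpose (x : Edge n → Bool) : (graphMatrix x)ᵀ = graphMatrix x := by
  ext i j
  simp only [graphMatrix, Matrix.transpose_apply, Matrix.of_apply]
  rcases lt_trichotomy i j with h | h | h
  · simp [h, not_lt.2 h.le]
  · simp [h]
  · simp [h, not_lt.2 h.le]

lemma graphMatrix_zero_or_one (x : Edge n → Bool) (i j : Fin n) :
    graphMatrix x i j = 0 ∨ graphMatrix x i j = 1 := by
  simp only [graphMatrix, Matrix.of_apply]
  split_ifs with h h'
  · cases x ⟨(i, j), h⟩ <;> simp
  · cases x ⟨(j, i), h'⟩ <;> simp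
  · simp

lemma norm_colVec_sq (M : Matrix (Fin n) (Fin n) ℝ) (i : Fin n) :
    ‖colVec M i‖ ^ 2 = ∑ j, M j i ^ 2 := by
  rw [EuclideanSpace.norm_sq_eq]
  simp [colVec]

lemma two_le_exp_one : (2 : ℝ) ≤ Real.exp 1 := by
  linarith [Real.add_one_le_exp (1 : ℝ)]

/-- A graph outside of the exceptional events of `bernProb_norm_le`, `bernProb_degree_le` and
`bernProb_decoupled_le` is regular. -/
lemma isRegularGraph_of_tails {K : ℕ} {ρ : ℝ} {Θ : Matrix (Fin n) (Fin n) ℝ} (hΘT : Θᵀ = Θ)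
    (hΘ0 : ∀ i j, 0 ≤ Θ i j) (hΘρ : ∀ i j, Θ i j ≤ ρ ^ 2) (hρ : 0 < ρ) (hρ1 : ρ ≤ 1)
    (hL : 1 ≤ Real.log n) {Q : ℝ} (hQ0 : 0 < Q) (hQ : Q ≤ 2 * Real.log n) (x : Edge n → Bool)
    (h1 : ‖graphMatrix x - Θ + diagonal (fun i => Θ i i)‖ ^ 2 <
      Real.exp 9 * (Q * (n * ρ ^ 2)))
    (h2 : ∀ i, ∑ j ∈ Finset.univ.erase i, (graphMatrix x i j + Θ i j) < Real.exp 9 * (n * ρ ^ 2))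
    (h3 : ∀ i, ‖∑ j ∈ Finset.univ.erase i, (graphMatrix x i j - Θ i j) •
        colVec (leadProj (K ^ 2) (deleteNode i (graphMatrix x))) j‖ ^ 2 <
      Real.exp 9 * (Q * (ρ ^ 2 * (K ^ 2 : ℕ) +
        Q * colMax (leadProj (K ^ 2) (deleteNode i (graphMatrix x))) ^ 2))) :
    IsRegularGraph K ρ (2 * Real.exp 5) Θ (graphMatrix x) := by
  set L := Real.log n with hLdef
  have hn1 : (1 : ℝ) ≤ n := by
    by_contra! hlt
    have h0 : (n : ℝ) = 0 := by
      have : n < 1 := by exact_mod_cast hlt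
      simp [Nat.lt_one_iff.1 this]
    rw [hLdef, h0, Real.log_zero] at hL
    linarith
  have hn0 : (0 : ℝ) ≤ n := by linarith
  have he9 : Real.exp 9 * 2 ≤ Real.exp 10 := by
    have : Real.exp 10 = Real.exp 9 * Real.exp 1 := by rw [← Real.exp_add]; norm_num
    rw [this]
    exact mul_le_mul_of_nonneg_left two_le_exp_one (Real.exp_pos _).le
  have he5 : Real.exp 5 ^ 2 = Real.exp 10 := by rw [← Real.exp_nat_mul]; norm_num
  have he51 : 1 ≤ Real.exp 5 := Real.one_le_exp (by norm_num)
  have he91 : 1 ≤ Real.exp 9 := Real.one_le_exp (by norm_num)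
  have hdiag : ∀ i, graphMatrix x i i = 0 := fun i => by simp [graphMatrix]
  have hρ2 : ρ ^ 2 ≤ 1 := pow_le_one₀ hρ.le hρ1
  have hsymG : ∀ i j, graphMatrix x j i = graphMatrix x i j := fun i j => by
    rw [← Matrix.transpose_apply (graphMatrix x), graphMatrix_transpose]
  have hsymΘ : ∀ i j, Θ j i = Θ i j := fun i j => by
    rw [← Matrix.transpose_apply Θ, hΘT]
  have hr : 0 ≤ ρ * Real.sqrt n := by positivity
  have hr2 : (ρ * Real.sqrt n) ^ 2 = n * ρ ^ 2 := by
    rw [mul_pow, Real.sq_sqrt hn0, mul_comm]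
  have hcol : ∀ {v : ℝ}, v ^ 2 ≤ Real.exp 10 * (n * ρ ^ 2) →
      v ≤ 2 * Real.exp 5 * (ρ * Real.sqrt n) := by
    intro v hv
    refine abs_le_of_sq_le_sq' ?_ (by positivity) |>.2
    rw [mul_pow, hr2, mul_pow, he5]
    have : 0 ≤ Real.exp 10 * (n * ρ ^ 2) := by positivity
    linarith
  refine ⟨graphMatrix_transpose x, hdiag, ?_, fun i => hcol ?_, fun i => hcol ?_, fun i => ?_⟩
  · -- the diagonal of `Θ` is negligible
    have e : graphMatrix x - Θ = (graphMatrix x - Θ + diagonal (fun i => Θ i i)) -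
        diagonal (fun i => Θ i i) := by abel
    have hd : ‖(diagonal (fun i => Θ i i) : Matrix (Fin n) (Fin n) ℝ)‖ ≤ ρ ^ 2 := by
      rw [Matrix.l2_opNorm_diagonal]
      refine (pi_norm_le_iff_of_nonneg (sq_nonneg _)).2 fun i => ?_
      rw [Real.norm_eq_abs, abs_of_nonneg (hΘ0 i i)]
      exact hΘρ i i
    have hs1 : 1 ≤ Real.sqrt (n * L) := Real.one_le_sqrt.2 (by nlinarith)
    have h4 : ‖graphMatrix x - Θ + diagonal (fun i => Θ i i)‖ ≤
        Real.exp 5 * (ρ * Real.sqrt (n * L)) := by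
      refine abs_le_of_sq_le_sq' (h1.le.trans ?_) (by positivity) |>.2
      rw [mul_pow, mul_pow, Real.sq_sqrt (by positivity), he5]
      have h5 : Q * (n * ρ ^ 2) ≤ 2 * L * (n * ρ ^ 2) :=
        mul_le_mul_of_nonneg_right hQ (by positivity)
      calc _ ≤ Real.exp 9 * (2 * L * (n * ρ ^ 2)) :=
            mul_le_mul_of_nonneg_left h5 (Real.exp_pos _).le
        _ = (Real.exp 9 * 2) * (ρ ^ 2 * (n * L)) := by ring
        _ ≤ _ := mul_le_mul_of_nonneg_right he9 (by positivity)
    have h6 : ρ ^ 2 ≤ Real.exp 5 * (ρ * Real.sqrt (n * L)) := by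
      have h7 : ρ * 1 ≤ ρ * Real.sqrt (n * L) := mul_le_mul_of_nonneg_left hs1 hρ.le
      have h8 : 1 * (ρ * Real.sqrt (n * L)) ≤ Real.exp 5 * (ρ * Real.sqrt (n * L)) :=
        mul_le_mul_of_nonneg_right he51 (by positivity)
      nlinarith
    rw [e]
    refine (norm_sub_le _ _).trans ?_
    linarith
  · rw [norm_colVec_sq, ← Finset.add_sum_erase _ _ (Finset.mem_univ i)]
    have h4 : ∑ j ∈ Finset.univ.erase i, (graphMatrix x - Θ) j i ^ 2 ≤
        ∑ j ∈ Finset.univ.erase i, (graphMatrix x i j + Θ i j) := by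
      refine Finset.sum_le_sum fun j _ => ?_
      rw [Matrix.sub_apply, hsymG, hsymΘ]
      have a0 := hΘ0 i j
      have a1 := (hΘρ i j).trans hρ2
      rcases graphMatrix_zero_or_one x i j with h | h <;> rw [h] <;> nlinarith
    have h5 : (graphMatrix x - Θ) i i ^ 2 ≤ n * ρ ^ 2 := by
      rw [Matrix.sub_apply, hdiag, zero_sub, neg_sq]
      have a0 := hΘ0 i i
      have a1 := hΘρ i i
      have : ρ ^ 2 ≤ n * ρ ^ 2 := le_mul_of_one_le_left (sq_nonneg _) hn1
      nlinarith
    have h6 : 0 ≤ n * ρ ^ 2 := by positivity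
    have h7 := mul_le_mul_of_nonneg_right he9 h6
    have h8 := mul_le_mul_of_nonneg_right he91 h6
    linarith [h2 i]
  · rw [norm_colVec_sq, ← Finset.add_sum_erase _ _ (Finset.mem_univ i), hdiag]
    have h4 : ∑ j ∈ Finset.univ.erase i, graphMatrix x j i ^ 2 ≤
        ∑ j ∈ Finset.univ.erase i, (graphMatrix x i j + Θ i j) := by
      refine Finset.sum_le_sum fun j _ => ?_
      rw [hsymG]
      have a0 := hΘ0 i j
      rcases graphMatrix_zero_or_one x i j with h | h <;> rw [h] <;> linarith
    have h6 : 0 ≤ n * ρ ^ 2 := by positivity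
    have h7 := mul_le_mul_of_nonneg_right he9 h6
    have h8 := mul_le_mul_of_nonneg_right he91 h6
    linarith [h2 i]
  · set W := colMax (leadProj (K ^ 2) (deleteNode i (graphMatrix x))) with hW
    have hW0 : 0 ≤ W := Real.iSup_nonneg fun j => norm_nonneg _
    refine abs_le_of_sq_le_sq' ((h3 i).le.trans ?_) (by positivity) |>.2
    have hK : ((K ^ 2 : ℕ) : ℝ) = (K : ℝ) ^ 2 := by push_cast; rfl
    rw [hK]
    have e : (2 * Real.exp 5 * (ρ * K * Real.sqrt L) + 2 * Real.exp 5 * L * W) ^ 2 =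
        Real.exp 10 * (4 * (ρ ^ 2 * K ^ 2 * L + L ^ 2 * W ^ 2 +
          2 * (ρ * K * Real.sqrt L * (L * W)))) := by
      have hs : Real.sqrt L ^ 2 = L := Real.sq_sqrt (by linarith)
      rw [← he5]
      linear_combination (4 * Real.exp 5 ^ 2 * ρ ^ 2 * K ^ 2) * hs
    rw [e]
    have hL0 : 0 ≤ L := by linarith
    have h5 : Q * (ρ ^ 2 * K ^ 2 + Q * W ^ 2) ≤ 2 * L * (ρ ^ 2 * K ^ 2 + 2 * L * W ^ 2) := by
      gcongr
    calc _ ≤ Real.exp 9 * (2 * L * (ρ ^ 2 * K ^ 2 + 2 * L * W ^ 2)) :=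
          mul_le_mul_of_nonneg_left h5 (Real.exp_pos _).le
      _ = (Real.exp 9 * 2) * (L * (ρ ^ 2 * K ^ 2 + 2 * L * W ^ 2)) := by ring
      _ ≤ Real.exp 10 * (L * (ρ ^ 2 * K ^ 2 + 2 * L * W ^ 2)) :=
          mul_le_mul_of_nonneg_right he9 (by positivity)
      _ ≤ _ := by
          refine mul_le_mul_of_nonneg_left ?_ (Real.exp_pos _).le
          have a1 : 0 ≤ ρ ^ 2 * K ^ 2 * L := by positivity
          have a2 : 0 ≤ L ^ 2 * W ^ 2 := by positivity
          have a3 : 0 ≤ ρ * K * Real.sqrt L * (L * W) := by positivity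
          nlinarith

/-- A random graph is regular with high probability. The constant `2 * e ^ 5` is that of the three
tail bounds at moments of the order `log n`. -/
lemma IsRandomGraph.measureReal_not_isRegularGraph_le {Ω : Type*} [MeasurableSpace Ω]
    {P : Measure Ω} [IsProbabilityMeasure P] {K : ℕ} {ρ : ℝ} {Θ : Matrix (Fin n) (Fin n) ℝ}
    {A : Ω → Matrix (Fin n) (Fin n) ℝ} (h : IsRandomGraph P Θ A) (hΘT : Θᵀ = Θ)
    (hΘ0 : ∀ i j, 0 ≤ Θ i j) (hΘρ : ∀ i j, Θ i j ≤ ρ ^ 2) (hρ : 0 < ρ) (hρ1 : ρ ≤ 1) (hK : 0 < K)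
    (hL : 1 ≤ Real.log n) (hLn : 2 * Real.log n ≤ n * ρ ^ 2) :
    P.real {ω | ¬ IsRegularGraph K ρ (2 * Real.exp 5) Θ (A ω)} ≤ 3 / (n : ℝ) ^ 4 := by
  have hp : ∀ e : Edge n, 0 ≤ edgeParam Θ e ∧ edgeParam Θ e ≤ 1 := fun e =>
    ⟨hΘ0 _ _, (hΘρ _ _).trans (pow_le_one₀ hρ.le hρ1)⟩
  set L := Real.log n with hLdef
  -- the moments are of the order `q + 1`, the logarithm of `n` rounded up
  obtain ⟨q, hq⟩ : ∃ q, ⌈L⌉₊ = q + 1 :=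
    Nat.exists_eq_succ_of_ne_zero (Nat.ceil_pos.2 (by linarith)).ne'
  have hqL : L ≤ (q + 1 : ℕ) := by rw [← hq]; exact Nat.le_ceil L
  have hqL2 : ((q + 1 : ℕ) : ℝ) ≤ 2 * L := by
    rw [← hq]
    have := Nat.ceil_lt_add_one (show 0 ≤ L by linarith)
    linarith
  have hn1 : (1 : ℝ) ≤ n := by
    by_contra! hlt
    have h0 : (n : ℝ) = 0 := by
      have : n < 1 := by exact_mod_cast hlt
      simp [Nat.lt_one_iff.1 this]
    rw [hLdef, h0, Real.log_zero] at hL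
    linarith
  have hV : 0 < n * ρ ^ 2 := by positivity
  have hqV : ((q + 1 : ℕ) : ℝ) ≤ n * ρ ^ 2 := hqL2.trans hLn
  have hsum : ∀ i, ∑ j, Θ i j ≤ n * ρ ^ 2 := by
    intro i
    calc _ ≤ ∑ _j : Fin n, ρ ^ 2 := Finset.sum_le_sum fun j _ => hΘρ i j
      _ = _ := by simp
  set x0 : ℝ := Real.exp (-(6 * (q + 1 : ℕ))) with hx0
  have hx0n : x0 ≤ 1 / (n : ℝ) ^ 6 := by
    have h6 : Real.exp (-(6 * L)) = 1 / (n : ℝ) ^ 6 := by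
      rw [Real.exp_neg, one_div, hLdef]
      congr 1
      have := Real.exp_nat_mul (Real.log n) 6
      rw [Real.exp_log (by linarith)] at this
      exact_mod_cast this
    rw [← h6]
    exact Real.exp_le_exp.2 (by linarith)
  have hx00 : 0 ≤ x0 := (Real.exp_pos _).le
  set E1 : Set (Edge n → Bool) := {x | Real.exp 9 * ((q + 1 : ℕ) * (n * ρ ^ 2)) ≤
      ‖graphMatrix x - Θ + diagonal (fun i => Θ i i)‖ ^ 2} with hE1
  set E2 : Fin n → Set (Edge n → Bool) := fun i => {x | Real.exp 9 * (n * ρ ^ 2) ≤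
      ∑ j ∈ Finset.univ.erase i, (graphMatrix x i j + Θ i j)} with hE2
  set E3 : Fin n → Set (Edge n → Bool) := fun i => {x | Real.exp 9 * ((q + 1 : ℕ) *
        (ρ ^ 2 * (K ^ 2 : ℕ) + (q + 1 : ℕ) *
          colMax (leadProj (K ^ 2) (deleteNode i (graphMatrix x))) ^ 2)) ≤
      ‖∑ j ∈ Finset.univ.erase i, (graphMatrix x i j - Θ i j) •
        colVec (leadProj (K ^ 2) (deleteNode i (graphMatrix x))) j‖ ^ 2} with hE3
  have b1 : bernProb (edgeParam Θ) E1 ≤ (n : ℝ) ^ 2 * x0 :=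
    bernProb_norm_le hp hΘT hΘ0 q hV hqV hsum
  have b2 : ∀ i, bernProb (edgeParam Θ) (E2 i) ≤ x0 := fun i =>
    bernProb_degree_le hp hΘT i (hΘ0 i) hV hqV (hsum i)
  have b3 : ∀ i, bernProb (edgeParam Θ) (E3 i) ≤ x0 := fun i =>
    bernProb_decoupled_le hp hΘT i (leadProj (K ^ 2)) (by positivity) (by positivity)
      (hΘ0 i) (hΘρ i) (sum_norm_colVec_leadProj_sq_le (K ^ 2)) q
  have hsub : {x | graphMatrix x ∈ {M | ¬ IsRegularGraph K ρ (2 * Real.exp 5) Θ M}} ⊆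
      E1 ∪ ((⋃ i, E2 i) ∪ ⋃ i, E3 i) := by
    intro x hx
    by_contra hcon
    simp only [Set.mem_union, Set.mem_iUnion, not_or, not_exists] at hcon
    obtain ⟨c1, c2, c3⟩ := hcon
    refine hx (isRegularGraph_of_tails hΘT hΘ0 hΘρ hρ hρ1 hL (by positivity) hqL2 x
      (not_le.1 c1) (fun i => not_le.1 (c2 i)) fun i => not_le.1 (c3 i))
  calc _ ≤ bernProb (edgeParam Θ) {x | graphMatrix x ∈
        {M | ¬ IsRegularGraph K ρ (2 * Real.exp 5) Θ M}} := h.measureReal_le hp _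
    _ ≤ bernProb (edgeParam Θ) E1 + (∑ i, bernProb (edgeParam Θ) (E2 i) +
        ∑ i, bernProb (edgeParam Θ) (E3 i)) :=
        (bernProb_mono hp hsub).trans ((bernProb_union_le hp _ _).trans (add_le_add le_rfl
          ((bernProb_union_le hp _ _).trans
            (add_le_add (bernProb_iUnion_le hp _) (bernProb_iUnion_le hp _)))))
    _ ≤ (n : ℝ) ^ 2 * x0 + (n * x0 + n * x0) := by
        refine add_le_add b1 (add_le_add ?_ ?_)
        · simpa using Finset.sum_le_sum fun i (_ : i ∈ Finset.univ) => b2 i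
        · simpa using Finset.sum_le_sum fun i (_ : i ∈ Finset.univ) => b3 i
    _ ≤ 3 * ((n : ℝ) ^ 2 * x0) := by nlinarith [mul_le_mul_of_nonneg_right hn1 hx00]
    _ ≤ 3 * ((n : ℝ) ^ 2 * (1 / (n : ℝ) ^ 6)) := by gcongr
    _ = _ := by field_simp

end Probability

end PABM

/-! ### Cosine similarities and K-means -/

namespace PABM

section Cosine

/-- The cosine of two vectors is Lipschitz in the relative errors of the vectors. -/
lemma abs_inner_div_sub_le {H : Type*} [NormedAddCommGroup H] [InnerProductSpace ℝ H]
    {u v u' v' : H} {η : ℝ} (hu : 0 < ‖u‖) (hv : 0 < ‖v‖) (hu' : ‖u' - u‖ ≤ η * ‖u‖)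
    (hv' : ‖v' - v‖ ≤ η * ‖v‖) :
    |inner ℝ u' v' / (‖u'‖ * ‖v'‖) - inner ℝ u v / (‖u‖ * ‖v‖)| ≤ 4 * η := by
  -- the cosine is the inner product of the normalised vectors
  have key : ∀ {a a' : H}, 0 < ‖a‖ → ‖a' - a‖ ≤ η * ‖a‖ →
      ‖‖a'‖⁻¹ • a' - ‖a‖⁻¹ • a‖ ≤ 2 * η := by
    intro a a' ha h
    have e : ‖a'‖⁻¹ • a' - ‖a‖⁻¹ • a = (‖a'‖⁻¹ - ‖a‖⁻¹) • a' + ‖a‖⁻¹ • (a' - a) := by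
      rw [sub_smul, smul_sub]; abel
    have h1 : ‖(‖a'‖⁻¹ - ‖a‖⁻¹) • a'‖ ≤ η := by
      rw [norm_smul, Real.norm_eq_abs]
      rcases (norm_nonneg a').eq_or_lt with h0 | h0
      · rw [← h0, mul_zero]
        exact nonneg_of_mul_nonneg_left ((norm_nonneg _).trans h) ha
      · have : (‖a'‖⁻¹ - ‖a‖⁻¹) = (‖a‖ - ‖a'‖) / (‖a'‖ * ‖a‖) := by field_simp
        rw [this, abs_div, abs_of_pos (mul_pos h0 ha), div_mul_eq_mul_div,
          div_le_iff₀ (mul_pos h0 ha)]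
        have h2 := (abs_norm_sub_norm_le a a').trans ((norm_sub_rev a a').le.trans h)
        nlinarith
    have h2 : ‖‖a‖⁻¹ • (a' - a)‖ ≤ η := by
      rw [norm_smul, norm_inv, norm_norm, inv_mul_le_iff₀ ha, mul_comm]
      exact h
    rw [e]
    linarith [norm_add_le ((‖a'‖⁻¹ - ‖a‖⁻¹) • a') (‖a‖⁻¹ • (a' - a))]
  have hle : ∀ a : H, ‖‖a‖⁻¹ • a‖ ≤ 1 := by
    intro a
    rw [norm_smul, norm_inv, norm_norm]
    exact inv_mul_le_one
  have hin : ∀ a b : H, inner ℝ a b / (‖a‖ * ‖b‖) = inner ℝ (‖a‖⁻¹ • a) (‖b‖⁻¹ • b) := by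
    intro a b
    rw [real_inner_smul_left, real_inner_smul_right, div_eq_inv_mul, mul_inv]
    ring
  rw [hin, hin]
  set a := ‖u‖⁻¹ • u
  set a' := ‖u'‖⁻¹ • u'
  set b := ‖v‖⁻¹ • v
  set b' := ‖v'‖⁻¹ • v'
  have e : inner ℝ a' b' - inner ℝ a b = inner ℝ (a' - a) b' + inner ℝ a (b' - b) := by
    rw [inner_sub_left, inner_sub_right]; ring
  have h1 : |inner ℝ (a' - a) b'| ≤ 2 * η := by
    refine (abs_real_inner_le_norm _ _).trans ?_
    have := mul_le_mul_of_nonneg_left (hle v') (norm_nonneg (a' - a))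
    linarith [key hu hu']
  have h2 : |inner ℝ a (b' - b)| ≤ 2 * η := by
    refine (abs_real_inner_le_norm _ _).trans ?_
    have := mul_le_mul_of_nonneg_right (hle u) (norm_nonneg (b' - b))
    linarith [key hv hv']
  rw [e]
  linarith [abs_add_le (inner ℝ (a' - a) b') (inner ℝ a (b' - b))]

variable {n m : ℕ}

lemma inner_colVec_proj {X : Matrix (Fin n) (Fin m) ℝ} (h : Xᵀ * X = 1) (i j : Fin n) :
    inner ℝ (colVec (X * Xᵀ) i) (colVec (X * Xᵀ) j) = X i ⬝ᵥ X j := by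
  have h1 : (X * Xᵀ)ᵀ * (X * Xᵀ) = X * Xᵀ := by
    rw [Matrix.transpose_mul, Matrix.transpose_transpose]
    calc _ = X * (Xᵀ * X) * Xᵀ := by simp only [Matrix.mul_assoc]
      _ = _ := by rw [h, Matrix.mul_one]
  have h2 := congrFun (congrFun h1 i) j
  rw [Matrix.mul_apply] at h2
  have h3 : (X * Xᵀ) i j = X i ⬝ᵥ X j := rfl
  rw [← h3, ← h2, PiLp.inner_apply]
  exact Finset.sum_congr rfl fun l _ => by simp [colVec, mul_comm]

/-- The similarity of two rows of an orthonormal matrix only depends on the projection on its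
range. -/
lemma tau_eq {X : Matrix (Fin n) (Fin m) ℝ} (h : Xᵀ * X = 1) (i j : Fin n) :
    tau X i j = |inner ℝ (colVec (X * Xᵀ) i) (colVec (X * Xᵀ) j) /
      (‖colVec (X * Xᵀ) i‖ * ‖colVec (X * Xᵀ) j‖)| := by
  rw [tau, cosine, inner_colVec_proj h, ← inner_colVec_proj h i i, ← inner_colVec_proj h j j,
    real_inner_self_eq_norm_sq, real_inner_self_eq_norm_sq, Real.sqrt_sq (norm_nonneg _),
    Real.sqrt_sq (norm_nonneg _)]

lemma abs_tau_sub_le {X Y : Matrix (Fin n) (Fin m) ℝ} (hX : Xᵀ * X = 1) (hY : Yᵀ * Y = 1)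
    {η : ℝ} {i j : Fin n} (hi : 0 < ‖colVec (X * Xᵀ) i‖) (hj : 0 < ‖colVec (X * Xᵀ) j‖)
    (hi' : ‖colVec (Y * Yᵀ - X * Xᵀ) i‖ ≤ η * ‖colVec (X * Xᵀ) i‖)
    (hj' : ‖colVec (Y * Yᵀ - X * Xᵀ) j‖ ≤ η * ‖colVec (X * Xᵀ) j‖) :
    |tau Y i j - tau X i j| ≤ 4 * η := by
  rw [tau_eq hX, tau_eq hY]
  exact (abs_abs_sub_abs_le_abs_sub _ _).trans (abs_inner_div_sub_le hi hj hi' hj')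

end Cosine

section KMeans

variable {n K : ℕ}

/-- The ideal value of the thresholded similarities: the indicators of the communities. -/
def idealPoint (c : Fin n → Fin K) (i j : Fin n) : ℝ := if c j = c i then 1 else 0

lemma kmeansCost_le (x : Fin n → Fin n → ℝ) (c : Fin n → Fin K) (ν : Fin K → Fin n → ℝ) :
    kmeansCost x c ≤ ∑ i, ∑ j, (x i j - ν (c i) j) ^ 2 := by
  rw [kmeansCost, ← Finset.sum_fiberwise Finset.univ c]
  refine Finset.sum_le_sum fun k _ => ?_
  refine (ciInf_le ⟨0, ?_⟩ (ν k)).trans (le_of_eq ?_)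
  · rintro _ ⟨ν, rfl⟩
    exact Finset.sum_nonneg fun i _ => Finset.sum_nonneg fun j _ => sq_nonneg _
  · refine Finset.sum_congr rfl fun i hi => ?_
    rw [(Finset.mem_filter.1 hi).2]

/-- Centres that are optimal up to `t` in each cluster, as the infimum in the K-means cost is not
known to be attained. -/
lemma exists_centres (x : Fin n → Fin n → ℝ) (c : Fin n → Fin K) {t : ℝ} (ht : 0 < t) :
    ∃ ν : Fin K → Fin n → ℝ, ∑ i, ∑ j, (x i j - ν (c i) j) ^ 2 ≤ kmeansCost x c + K * t := by
  have h : ∀ k, ∃ ν : Fin n → ℝ, ∑ i ∈ Finset.univ.filter (fun i => c i = k),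
      ∑ j, (x i j - ν j) ^ 2 < (⨅ ν : Fin n → ℝ, ∑ i ∈ Finset.univ.filter (fun i => c i = k),
        ∑ j, (x i j - ν j) ^ 2) + t := fun k =>
    exists_lt_of_ciInf_lt (lt_add_of_pos_right _ ht)
  choose ν hν using h
  refine ⟨ν, ?_⟩
  rw [kmeansCost, ← Finset.sum_fiberwise Finset.univ c]
  have e : (K : ℝ) * t = ∑ _k : Fin K, t := by simp
  rw [e, ← Finset.sum_add_distrib]
  refine Finset.sum_le_sum fun k _ => le_trans (le_of_eq ?_) (hν k).le
  refine Finset.sum_congr rfl fun i hi => ?_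
  rw [(Finset.mem_filter.1 hi).2]

lemma sq_dist_idealPoint {c : Fin n → Fin K} {i j : Fin n} (h : c i ≠ c j) :
    ∑ l, (idealPoint c i l - idealPoint c j l) ^ 2 =
      communitySize c (c i) + communitySize c (c j) := by
  have : ∀ l, (idealPoint c i l - idealPoint c j l) ^ 2 =
      (if c l = c i then 1 else 0) + if c l = c j then 1 else 0 := by
    intro l
    unfold idealPoint
    by_cases h1 : c l = c i
    · rw [if_pos h1, if_neg (by rw [h1]; exact h)]; ring
    · rw [if_neg h1]; split_ifs <;> ring
  simp only [this, Finset.sum_add_distrib, Finset.sum_boole, communitySize]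

/-- Approximate K-means on points that are close, in total squared distance, to the indicators of
the communities recovers most of the communities. -/
lemma loss_le_of_kmeans {x : Fin n → Fin n → ℝ} {c chat : Fin n → Fin K} {ε m S : ℝ} (hε : 0 < ε)
    (hopt : ∀ c' : Fin n → Fin K, kmeansCost x chat ≤ (1 + ε) * kmeansCost x c')
    (hm : 0 < m) (hsize : ∀ k, m ≤ communitySize c k) (hS : 0 < S)
    (hclose : ∑ i, ∑ j, (x i j - idealPoint c i j) ^ 2 ≤ S)
    (hsmall : (12 + 4 * ε) * S < m ^ 2) : loss c chat ≤ (12 + 4 * ε) * S / m / n := by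
  -- the estimated centres are nearly as good for the data as the true communities
  obtain ⟨ν, hν⟩ : ∃ ν : Fin K → Fin n → ℝ,
      ∑ i, ∑ j, (x i j - ν (chat i) j) ^ 2 ≤ (2 + ε) * S := by
    have hcost : kmeansCost x c ≤ S := by
      exact le_trans (kmeansCost_le x c fun k j => if c j = k then 1 else 0) hclose
    have hK : (K : ℝ) * (S / (K + 1)) ≤ S := by
      rw [← mul_div_assoc, div_le_iff₀ (by positivity)]
      nlinarith
    obtain ⟨ν, hν⟩ := exists_centres x chat (t := S / (K + 1)) (by positivity)
    refine ⟨ν, hν.trans ?_⟩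
    have h1 := hopt c
    have h2 := mul_le_mul_of_nonneg_left hcost (show 0 ≤ 1 + ε by linarith)
    linarith
  set dist : Fin n → ℝ := fun i => ∑ j, (idealPoint c i j - ν (chat i) j) ^ 2 with hdist
  have hdist0 : ∀ i, 0 ≤ dist i := fun i => Finset.sum_nonneg fun j _ => sq_nonneg _
  have hsum : ∑ i, dist i ≤ (6 + 2 * ε) * S := by
    have : ∑ i, dist i ≤ ∑ i, ∑ j, (2 * (x i j - idealPoint c i j) ^ 2 +
        2 * (x i j - ν (chat i) j) ^ 2) := by
      refine Finset.sum_le_sum fun i _ => Finset.sum_le_sum fun j _ => ?_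
      nlinarith [sq_nonneg ((x i j - idealPoint c i j) + (x i j - ν (chat i) j))]
    simp only [Finset.sum_add_distrib, ← Finset.mul_sum] at this
    linarith
  -- the nodes whose ideal points are far from their estimated centres
  set B := Finset.univ.filter fun i => m / 2 ≤ dist i with hB
  have hBcard : (B.card : ℝ) ≤ (12 + 4 * ε) * S / m := by
    have h1 : (B.card : ℝ) * (m / 2) ≤ ∑ i, dist i := by
      calc _ = ∑ _i ∈ B, m / 2 := by rw [Finset.sum_const, nsmul_eq_mul]
        _ ≤ ∑ i ∈ B, dist i := Finset.sum_le_sum fun i hi => (Finset.mem_filter.1 hi).2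
        _ ≤ _ := Finset.sum_le_sum_of_subset_of_nonneg (Finset.subset_univ B) fun i _ _ => hdist0 i
    rw [le_div_iff₀ hm]
    linarith
  have hBm : (B.card : ℝ) < m := by
    refine hBcard.trans_lt ?_
    rw [div_lt_iff₀ hm, ← sq]
    exact hsmall
  have hgood : ∀ i, i ∉ B → dist i < m / 2 := by
    intro i hi
    simpa [hB] using hi
  -- good nodes of different communities are in different clusters
  have hsep : ∀ i j, i ∉ B → j ∉ B → chat i = chat j → c i = c j := by
    intro i j hi hj hij
    by_contra hne
    have h1 := sq_dist_idealPoint hne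
    have h2 : ∑ l, (idealPoint c i l - idealPoint c j l) ^ 2 ≤ 2 * dist i + 2 * dist j := by
      simp only [hdist, Finset.mul_sum, ← Finset.sum_add_distrib, ← hij]
      refine Finset.sum_le_sum fun l _ => ?_
      nlinarith [sq_nonneg ((idealPoint c i l - ν (chat i) l) + (idealPoint c j l - ν (chat i) l))]
    linarith [hsize (c i), hsize (c j), hgood i hi, hgood j hj]
  -- every community has a good node, which makes the relabelling a permutation
  have hrep : ∀ k, ∃ i, i ∉ B ∧ c i = k := by
    intro k
    by_contra! hcon
    have hsub : (Finset.univ.filter fun i => c i = k) ⊆ B := by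
      intro i hi
      by_contra h
      exact hcon i h (Finset.mem_filter.1 hi).2
    have h1 : (communitySize c k : ℝ) ≤ B.card := by
      exact_mod_cast Finset.card_le_card hsub
    linarith [hsize k]
  choose g hgB hgc using hrep
  have hinj : Function.Injective fun k => chat (g k) := by
    intro k k' h
    have := hsep _ _ (hgB k) (hgB k') h
    rwa [hgc, hgc] at this
  set f : Equiv.Perm (Fin K) := Equiv.ofBijective _ (Finite.injective_iff_bijective.1 hinj) with hf
  have hlabel : ∀ i, i ∉ B → c i = f.symm (chat i) := by
    intro i hi
    rw [Equiv.eq_symm_apply]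
    obtain ⟨k, hk⟩ := f.surjective (chat i)
    have h1 : chat (g k) = chat i := hk
    have h2 := hsep _ _ (hgB k) hi h1
    rw [hgc] at h2
    rw [← h2, hk]
  have hn : (Finset.univ.filter fun i => c i ≠ f.symm (chat i)) ⊆ B := by
    intro i hi
    by_contra h
    exact (Finset.mem_filter.1 hi).2 (hlabel i h)
  refine (ciInf_le (Set.finite_range _).bddBelow f.symm).trans ?_
  have h1 : ((Finset.univ.filter fun i => c i ≠ f.symm (chat i)).card : ℝ) ≤ B.card := by
    exact_mod_cast Finset.card_le_card hn
  exact div_le_div_of_nonneg_right (h1.trans hBcard) (Nat.cast_nonneg n)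

lemma loss_le_one (c chat : Fin n → Fin K) : loss c chat ≤ 1 := by
  refine (ciInf_le (Set.finite_range _).bddBelow (1 : Equiv.Perm (Fin K))).trans ?_
  refine div_le_one_of_le₀ ?_ (Nat.cast_nonneg n)
  exact_mod_cast (Finset.card_filter_le _ _).trans (by simp)

/-- If thresholding is correct between the nodes of a set `I`, except for the pairs of nodes of one
community with a similarity below `φ`, then the thresholded similarities are close to the indicators
of the communities. -/
lemma sum_sq_thresholded_sub_le {m : ℕ} {c : Fin n → Fin K} {X Y : Matrix (Fin n) (Fin m) ℝ}
    {d φ η b : ℝ} (I : Set (Fin n))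
    (hI : ∀ i ∈ I, ∀ j ∈ I, c j = c i → φ ≤ tau X i j → d ≤ tau Y i j)
    (hI' : ∀ i ∈ I, ∀ j ∈ I, c j ≠ c i → tau Y i j < d)
    (hb : ∀ k, communitySize c k * η ≤ b) (hb0 : 0 ≤ b) :
    ∑ i, ∑ j, (thresholded Y d i j - idealPoint c i j) ^ 2 ≤
      n * (2 * (Iᶜ.ncard : ℝ) + ((clearNodes c X φ η)ᶜ.ncard : ℝ) + b) := by
  classical
  set H := clearNodes c X φ η with hH
  have hle1 : ∀ i j, (thresholded Y d i j - idealPoint c i j) ^ 2 ≤ 1 := by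
    intro i j
    unfold thresholded idealPoint
    by_cases h1 : j ∈ {j | d ≤ tau Y i j} <;> by_cases h2 : c j = c i <;> simp [h1, h2]
  have hcard : ∀ s : Set (Fin n), (s.ncard : ℝ) = ∑ j, if j ∈ s then 1 else 0 := by
    intro s
    rw [Set.ncard_eq_toFinset_card', Finset.sum_boole]
    congr 2
    ext j
    simp
  have hcard' : ∀ s : Set (Fin n), ∑ j, (if j ∈ sᶜ then (1 : ℝ) else 0) = (sᶜ.ncard : ℝ) := by
    intro s
    rw [hcard]
    refine Finset.sum_congr rfl fun j _ => ?_
    congr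
  have hn0 : (0 : ℝ) ≤ n := Nat.cast_nonneg n
  have hrow : ∀ i, ∑ j, (thresholded Y d i j - idealPoint c i j) ^ 2 ≤
      ((Iᶜ.ncard : ℝ) + b) + n * ((if i ∈ Iᶜ then 1 else 0) + if i ∈ Hᶜ then 1 else 0) := by
    intro i
    by_cases hgood : i ∈ I ∧ i ∈ H
    · obtain ⟨hiI, hiH⟩ := hgood
      have h1 : ∀ j, (thresholded Y d i j - idealPoint c i j) ^ 2 ≤ (if j ∈ Iᶜ then 1 else 0) +
          ((if c j = c i then 1 else 0) - if j ∈ similarNodes c X φ i then 1 else 0) := by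
        intro j
        have hsub : ∀ h : j ∈ similarNodes c X φ i, c j = c i := fun h => h.1
        have hnn : (0 : ℝ) ≤ (if c j = c i then 1 else 0) -
            if j ∈ similarNodes c X φ i then 1 else 0 := by
          by_cases hs : j ∈ similarNodes c X φ i
          · simp [hs, hsub hs]
          · simp only [hs, if_false, sub_zero]; split_ifs <;> simp
        by_cases hjI : j ∈ I
        · by_cases hc : c j = c i
          · by_cases hs : φ ≤ tau X i j
            · have : j ∈ {j | d ≤ tau Y i j} := hI i hiI j hjI hc hs
              have h2 : thresholded Y d i j = 1 := by
                rw [thresholded, Set.indicator_of_mem this]; rfl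
              rw [if_pos hc] at hnn
              rw [h2, idealPoint, if_pos hc, sub_self, zero_pow two_ne_zero]
              exact add_nonneg (by split_ifs <;> simp) hnn
            · have hns : j ∉ similarNodes c X φ i := fun h => hs h.2
              refine (hle1 i j).trans ?_
              simp [hc, hns, hjI]
          · have : j ∉ {j | d ≤ tau Y i j} := not_le.2 (hI' i hiI j hjI hc)
            have h2 : thresholded Y d i j = 0 := by
              rw [thresholded, Set.indicator_of_notMem this]
            rw [if_neg hc] at hnn
            rw [h2, idealPoint, if_neg hc, sub_self, zero_pow two_ne_zero]
            exact add_nonneg (by split_ifs <;> simp) hnn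
        · refine (hle1 i j).trans ?_
          rw [if_pos (show j ∈ Iᶜ from hjI)]
          linarith
      have h2 := Finset.sum_le_sum fun j (_ : j ∈ Finset.univ) => h1 j
      rw [Finset.sum_add_distrib, Finset.sum_sub_distrib, hcard', ← hcard] at h2
      have h3 : ∑ j, (if c j = c i then (1 : ℝ) else 0) = communitySize c (c i) := by
        rw [Finset.sum_boole, communitySize]
      rw [h3] at h2
      have h4 : (communitySize c (c i) : ℝ) * (1 - η) ≤ ((similarNodes c X φ i).ncard : ℝ) := hiH
      have h5 := hb (c i)
      have h6 : (0 : ℝ) ≤ n * ((if i ∈ Iᶜ then 1 else 0) + if i ∈ Hᶜ then 1 else 0) :=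
        mul_nonneg hn0 (add_nonneg (by split_ifs <;> simp) (by split_ifs <;> simp))
      linarith
    · have h1 : ∑ j, (thresholded Y d i j - idealPoint c i j) ^ 2 ≤ n := by
        calc _ ≤ ∑ _j : Fin n, (1 : ℝ) := Finset.sum_le_sum fun j _ => hle1 i j
          _ = n := by simp
      have h2 : (1 : ℝ) ≤ (if i ∈ Iᶜ then 1 else 0) + if i ∈ Hᶜ then 1 else 0 := by
        by_cases h3 : i ∈ I
        · have h4 : i ∉ H := fun h => hgood ⟨h3, h⟩
          simp [h3, h4]
        · simp only [Set.mem_compl_iff, h3, not_false_iff, if_true]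
          have : (0 : ℝ) ≤ if i ∉ H then 1 else 0 := by split_ifs <;> simp
          linarith
      have h3 := mul_le_mul_of_nonneg_left h2 hn0
      have h4 : (0 : ℝ) ≤ (Iᶜ.ncard : ℝ) := Nat.cast_nonneg _
      linarith
  refine (Finset.sum_le_sum fun i _ => hrow i).trans (le_of_eq ?_)
  rw [Finset.sum_add_distrib, ← Finset.mul_sum, Finset.sum_add_distrib, Finset.sum_add_distrib,
    hcard', hcard']
  simp only [Finset.sum_const, Finset.card_univ, Fintype.card_fin, nsmul_eq_mul]
  ring

end KMeans

end PABM

/-! ### Weak consistency -/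

namespace PABM

open scoped Matrix.Norms.L2Operator

section Consistency

variable {n K : ℕ} {Λ : Matrix (Fin n) (Fin K) ℝ} {c chat : Fin n → Fin K}
  {A Θ : Matrix (Fin n) (Fin n) ℝ} {Ξ Ξhat : Matrix (Fin n) (Fin (K ^ 2)) ℝ} {δ : Fin (K ^ 2) → ℝ}

lemma IsEigendecomposition.norm_colVec_eq_sqrt (h : IsEigendecomposition (edgeProb Λ c) Ξ δ)
    (hm : (singVal (edgeProb Λ c)).support.card = K ^ 2) (i : Fin n) :
    ‖colVec (Ξ * Ξᵀ) i‖ = Real.sqrt (selfForm Λ c i) := by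
  rw [← h.proj_apply_self hm, ← norm_colVec_proj_sq h.1, Real.sqrt_sq (norm_nonneg _)]

/-- Nodes of different communities have orthogonal rows in the eigenvector matrix. -/
lemma IsEigendecomposition.tau_of_ne (h : IsEigendecomposition (edgeProb Λ c) Ξ δ)
    (hm : (singVal (edgeProb Λ c)).support.card = K ^ 2) {i j : Fin n} (hij : c i ≠ c j) :
    tau Ξ i j = 0 := by
  have h1 : Ξ i ⬝ᵥ Ξ j = 0 := h.proj_apply_of_ne hm hij
  rw [tau, cosine, h1, zero_div, abs_zero]

/-- If the projections on the leading eigenvectors of `A` and of `Θ` differ by less than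
`φ₁ * φ₂ / 16` in each column, then the loss of TCSC is controlled by the proportions of the
exceptional nodes. -/
lemma loss_le_of_norm_colVec_sub_le {φ₁ φ₂ η₀ η₁ η₂ ε C₀ : ℝ} (hn : 0 < n) (hK : 0 < K)
    (hC₀ : 0 < C₀) (hε : 0 < ε) (hφ₁ : 0 < φ₁) (hφ₂ : 0 < φ₂)
    (h : IsEigendecomposition (edgeProb Λ c) Ξ δ)
    (hm : (singVal (edgeProb Λ c)).support.card = K ^ 2) (hlead : IsLeadingEigenvectors A Ξhat)
    (hdiff : ∀ i, ‖colVec (Ξhat * Ξhatᵀ - Ξ * Ξᵀ) i‖ ≤ φ₁ * φ₂ / 16)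
    (hsize : ∀ k, (n : ℝ) / (C₀ * K) ≤ communitySize c k ∧ (communitySize c k : ℝ) ≤ C₀ * n / K)
    (hclear : ((clearNodes c Ξ φ₁ η₀)ᶜ.ncard : ℝ) ≤ η₁ * n)
    (hstrong : (n : ℝ) * (1 - η₂) < ((strongNodes Λ c φ₂).ncard : ℝ))
    (hopt : ∀ c' : Fin n → Fin K, kmeansCost (thresholded Ξhat (φ₁ / 2)) chat ≤
      (1 + ε) * kmeansCost (thresholded Ξhat (φ₁ / 2)) c') {r : ℝ} (hr : 0 < r)
    (hηr : 2 * |η₂| + |η₁| + C₀ * |η₀| / K ≤ r)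
    (hsmall : (12 + 4 * ε) * C₀ ^ 2 * K ^ 2 * r < 1) :
    loss c chat ≤ (12 + 4 * ε) * C₀ * K * r := by
  have hn' : (0 : ℝ) < n := by exact_mod_cast hn
  have hK' : (0 : ℝ) < K := by exact_mod_cast hK
  have hcos : ∀ i ∈ strongNodes Λ c φ₂, ∀ j ∈ strongNodes Λ c φ₂,
      |tau Ξhat i j - tau Ξ i j| ≤ φ₁ / 4 := by
    have hpos : ∀ i ∈ strongNodes Λ c φ₂, φ₂ ≤ ‖colVec (Ξ * Ξᵀ) i‖ := by
      intro i hi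
      rw [h.norm_colVec_eq_sqrt hm]
      exact hi
    have hle : ∀ i ∈ strongNodes Λ c φ₂, ‖colVec (Ξhat * Ξhatᵀ - Ξ * Ξᵀ) i‖ ≤
        φ₁ / 16 * ‖colVec (Ξ * Ξᵀ) i‖ := by
      intro i hi
      have := mul_le_mul_of_nonneg_left (hpos i hi) (show 0 ≤ φ₁ / 16 by positivity)
      linarith [hdiff i]
    intro i hi j hj
    have := abs_tau_sub_le h.1 hlead.orthonormal (hφ₂.trans_le (hpos i hi))
      (hφ₂.trans_le (hpos j hj)) (hle i hi) (hle j hj)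
    linarith
  have hclose := sum_sq_thresholded_sub_le (c := c) (X := Ξ) (Y := Ξhat) (d := φ₁ / 2) (φ := φ₁)
    (η := η₀) (b := C₀ * n / K * |η₀|) (strongNodes Λ c φ₂)
    (fun i hi j hj _ hτ => by linarith [(abs_le.1 (hcos i hi j hj)).1])
    (fun i hi j hj hc => by
      have h1 := (abs_le.1 (hcos i hi j hj)).2
      rw [h.tau_of_ne hm (Ne.symm hc)] at h1
      linarith)
    (fun k => (mul_le_mul_of_nonneg_left (le_abs_self η₀) (Nat.cast_nonneg _)).trans
      (mul_le_mul_of_nonneg_right (hsize k).2 (abs_nonneg η₀))) (by positivity)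
  have hI : ((strongNodes Λ c φ₂)ᶜ.ncard : ℝ) ≤ |η₂| * n := by
    have h1 : ((strongNodes Λ c φ₂).ncard : ℝ) + (strongNodes Λ c φ₂)ᶜ.ncard = n := by
      have := Set.ncard_add_ncard_compl (strongNodes Λ c φ₂)
      rw [Nat.card_fin] at this
      exact_mod_cast this
    have h2 := mul_le_mul_of_nonneg_right (le_abs_self η₂) hn'.le
    linarith
  have hH : ((clearNodes c Ξ φ₁ η₀)ᶜ.ncard : ℝ) ≤ |η₁| * n :=
    hclear.trans (mul_le_mul_of_nonneg_right (le_abs_self η₁) hn'.le)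
  have hS : ∑ i, ∑ j, (thresholded Ξhat (φ₁ / 2) i j - idealPoint c i j) ^ 2 ≤ n ^ 2 * r := by
    refine hclose.trans ?_
    have e' : (n : ℝ) ^ 2 * r = n * (n * r) := by ring
    rw [e']
    refine mul_le_mul_of_nonneg_left ?_ hn'.le
    have e : C₀ * n / K * |η₀| = n * (C₀ * |η₀| / K) := by ring
    rw [e]
    linarith [mul_le_mul_of_nonneg_left hηr hn'.le]
  refine (loss_le_of_kmeans (m := n / (C₀ * K)) hε hopt (by positivity) (fun k => (hsize k).1)
    (show 0 < (n : ℝ) ^ 2 * r by positivity) hS ?_).trans (le_of_eq ?_)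
  · rw [div_pow, lt_div_iff₀ (by positivity)]
    calc _ = n ^ 2 * ((12 + 4 * ε) * C₀ ^ 2 * K ^ 2 * r) := by ring
      _ < n ^ 2 * 1 := mul_lt_mul_of_pos_left hsmall (by positivity)
      _ = _ := mul_one _
  · field_simp

/-- On regular graphs, TCSC is accurate: the lower bound on `φ₁ * φ₂` makes the leave-one-out bound
on the projections as small as `loss_le_of_norm_colVec_sub_le` requires. -/
lemma IsRegularGraph.loss_le {φ₁ φ₂ η₀ η₁ η₂ ε C₀ C₁ C₂ C₃ C₄ ρ κ : ℝ}
    (hreg : IsRegularGraph K ρ κ (edgeProb Λ c) A) (hκ : 0 < κ) (hn : 0 < n) (hK : 0 < K)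
    (hρ : 0 < ρ) (hL : 1 ≤ Real.log n) (hsparse : Real.log n ^ 2 ≤ n * ρ ^ 2 / (K : ℝ) ^ 2)
    (hC₀ : 0 < C₀) (hC₁ : 0 ≤ C₁) (hC₃ : 0 < C₃) (hC₄ : 0 ≤ C₄) (hε : 0 < ε) (hφ₁ : 0 < φ₁)
    (h : IsEigendecomposition (edgeProb Λ c) Ξ δ)
    (hm : (singVal (edgeProb Λ c)).support.card = K ^ 2)
    (hcond : singVal (edgeProb Λ c) 0 / singVal (edgeProb Λ c) (K ^ 2 - 1) ≤
      C₁ * Real.sqrt (Real.log n))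
    (hself : ∀ i, selfForm Λ c i ≤ C₄ * ((K : ℝ) ^ 2 / n))
    (hup : φ₁ * φ₂ ≤ C₃ * (K / Real.sqrt n))
    (hlow : C₂ * (ρ * K * Real.sqrt (Real.log n) / singVal (edgeProb Λ c) (K ^ 2 - 1)) ≤ φ₁ * φ₂)
    (hC₂ : 32 * κ * C₃ ≤ C₂)
    (hC₂' : 16 * (κ * (36 * Real.sqrt C₄ + 6 + 192 * C₁ * Real.sqrt C₄)) ≤ C₂)
    (hsize : ∀ k, (n : ℝ) / (C₀ * K) ≤ communitySize c k ∧ (communitySize c k : ℝ) ≤ C₀ * n / K)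
    (hclear : ((clearNodes c Ξ φ₁ η₀)ᶜ.ncard : ℝ) ≤ η₁ * n)
    (hstrong : (n : ℝ) * (1 - η₂) < ((strongNodes Λ c φ₂).ncard : ℝ))
    (hout : IsTCSCOutput A (φ₁ / 2) ε chat) {r : ℝ} (hr : 0 < r)
    (hηr : 2 * |η₂| + |η₁| + C₀ * |η₀| / K ≤ r)
    (hsmall : (12 + 4 * ε) * C₀ ^ 2 * K ^ 2 * r < 1) :
    loss c chat ≤ (12 + 4 * ε) * C₀ * K * r := by
  obtain ⟨Ξhat, hlead, hopt⟩ := hout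
  have hn' : (0 : ℝ) < n := by exact_mod_cast hn
  have hK' : (0 : ℝ) < K := by exact_mod_cast hK
  have hK1 : (1 : ℝ) ≤ K := by exact_mod_cast hK
  have hN : 0 < Real.sqrt n := Real.sqrt_pos.2 hn'
  have hl : 0 < Real.sqrt (Real.log n) := Real.sqrt_pos.2 (by linarith)
  set σ := singVal (edgeProb Λ c) (K ^ 2 - 1) with hσ
  have hσ0 : 0 < σ := singVal_pred_pos (by positivity) hm
  have hpos : 0 < ρ * K * Real.sqrt (Real.log n) / σ := by positivity
  have hC₂0 : 0 < C₂ := lt_of_lt_of_le (by positivity) hC₂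
  have hφ₂ : 0 < φ₂ := pos_of_mul_pos_right ((mul_pos hC₂0 hpos).trans_le hlow) hφ₁.le
  have hLρ : Real.log n ≤ ρ * Real.sqrt n := by
    refine (sq_le_sq₀ (by linarith) (by positivity)).1 ?_
    rw [mul_pow, Real.sq_sqrt hn'.le]
    refine hsparse.trans ((div_le_self (by positivity) (one_le_pow₀ hK1)).trans (le_of_eq ?_))
    ring
  -- the two bounds on `φ₁ * φ₂` force the eigengap to dominate the noise
  have hgap : 32 * (κ * (ρ * Real.sqrt (n * Real.log n))) ≤ σ := by
    have h1 := hlow.trans hup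
    have h2 := (mul_le_mul_of_nonneg_right hC₂ hpos.le).trans h1
    rw [← mul_div_assoc, ← mul_div_assoc, div_le_div_iff₀ hσ0 hN] at h2
    rw [Real.sqrt_mul hn'.le]
    refine le_of_mul_le_mul_left (le_trans (le_of_eq ?_) h2) (mul_pos hC₃ hK')
    ring
  have hdiff := hreg.norm_colVec_sub_le hn hρ hκ (Real.sqrt_nonneg C₄) hC₁ hL hLρ hσ0 hgap h
    (fun r => (h.singVal_bounds hm r).1)
    ((h.norm_le_singVal hm).trans ((div_le_iff₀ hσ0).1 hcond))
    (fun i => by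
      rw [h.norm_colVec_eq_sqrt hm]
      refine (Real.sqrt_le_sqrt (hself i)).trans (le_of_eq ?_)
      rw [Real.sqrt_mul hC₄, Real.sqrt_div (sq_nonneg _), Real.sqrt_sq hK'.le]) hlead
  refine loss_le_of_norm_colVec_sub_le hn hK hC₀ hε hφ₁ hφ₂ h hm hlead (fun i => ?_) hsize hclear
    hstrong hopt hr hηr hsmall
  have h1 := (mul_le_mul_of_nonneg_right hC₂' hpos.le).trans hlow
  linarith [hdiff i]

lemma tendsto_mul_abs_of_isLittleO {a f g : ℕ → ℝ} (h : f =o[atTop] g)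
    (hb : ∀ᶠ n in atTop, |a n * g n| ≤ 1) : Tendsto (fun n => a n * |f n|) atTop (𝓝 0) := by
  have h1 : (fun n => a n * |f n|) =o[atTop] fun n => a n * g n :=
    (isBigO_refl a atTop).mul_isLittleO h.abs_left
  have h2 : (fun n => a n * g n) =O[atTop] fun _ => (1 : ℝ) :=
    IsBigO.of_bound 1 (by simpa using hb)
  exact (isLittleO_one_iff ℝ).1 (h1.trans_isBigO h2)

end Consistency

end PABM

theorem mainTheorem3
    -- the constants in the hypotheses, and the accuracy `ε` of the K-means step
    (C₀ C₁ C₃ C₄ ε : ℝ) (hC₀ : 1 ≤ C₀) (hC₁ : 0 < C₁) (hC₃ : 0 < C₃) (hC₄ : 0 < C₄) (hε : 0 < ε) :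
    -- the large constants `C₂`, `C₅` of the hypotheses and the constant `C` of the conclusion
    ∃ C₂ > 0, ∃ C₅ > 0, ∃ C > 0,
    -- a sequence of models, indexed by the number `n` of nodes
    ∀ (K : ℕ → ℕ) (c : ∀ n, Fin n → Fin (K n)) (ρ : ℕ → ℝ)
      (Λ₀ Λ : ∀ n, Matrix (Fin n) (Fin (K n)) ℝ)
      (Θ : ∀ n, Matrix (Fin n) (Fin n) ℝ)
      (Ξ : ∀ n, Matrix (Fin n) (Fin (K n ^ 2)) ℝ) (D : ∀ n, Fin (K n ^ 2) → ℝ)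
      (Ω : ℕ → Type*) [∀ n, MeasurableSpace (Ω n)]
      (P : ∀ n, Measure (Ω n)) [∀ n, IsProbabilityMeasure (P n)]
      (A : ∀ n, Ω n → Matrix (Fin n) (Fin n) ℝ)
      (φ₁ φ₂ η₀ η₁ η₂ : ℕ → ℝ) (N₀ : ℕ),
    -- the PABM with sparsity parameter `ρ n`, from some `N₀` on
    (∀ n ≥ N₀, 2 ≤ K n) →
    (∀ n ≥ N₀, 0 < ρ n ∧ ρ n ≤ 1) →
    (∀ n ≥ N₀, ∀ i k, 0 < Λ₀ n i k ∧ Λ₀ n i k < 1) →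
    (∀ n ≥ N₀, Λ n = ρ n • Λ₀ n) →
    (∀ n ≥ N₀, Θ n = PABM.edgeProb (Λ n) (c n)) →
    (∀ n ≥ N₀, PABM.IsRandomGraph (P n) (Θ n) (A n)) →
    -- `Θ` has `K ^ 2` nonzero singular values, with bounded condition number
    (∀ n ≥ N₀, (PABM.singVal (Θ n)).support.card = K n ^ 2) →
    (∀ n ≥ N₀, PABM.singVal (Θ n) 0 / PABM.singVal (Θ n) (K n ^ 2 - 1)
      ≤ C₁ * Real.sqrt (Real.log n)) →
    -- `Ξ` is the matrix of eigenvectors of `Θ` for its `K ^ 2` nonzero eigenvalues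
    (∀ n ≥ N₀, PABM.IsEigendecomposition (Θ n) (Ξ n) (D n)) →
    -- balanced communities
    (∀ n ≥ N₀, ∀ k, (n : ℝ) / (C₀ * K n) ≤ PABM.communitySize (c n) k ∧
      (PABM.communitySize (c n) k : ℝ) ≤ C₀ * n / K n) →
    -- sparsity
    (∀ n ≥ N₀, C₅ * Real.log n ^ 2 ≤ n * ρ n ^ 2 / (K n : ℝ) ^ 2) →
    -- similarity within the communities
    (∀ n ≥ N₀, 0 < φ₁ n ∧ φ₁ n ≤ 1) →
    (∀ n ≥ N₀, ((PABM.clearNodes (c n) (Ξ n) (φ₁ n) (η₀ n))ᶜ.ncard : ℝ) ≤ η₁ n * n) →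
    η₁ =o[atTop] (fun n : ℕ => ((n : ℝ) * ρ n ^ 2)⁻¹ * Real.log n ^ 2) →
    η₀ =o[atTop] (fun n : ℕ => (Real.sqrt ((n : ℝ) * ρ n ^ 2))⁻¹ * Real.log n) →
    -- size of the rows of the eigenvector matrix
    (∀ n ≥ N₀, (n : ℝ) * (1 - η₂ n) < ((PABM.strongNodes (Λ n) (c n) (φ₂ n)).ncard : ℝ)) →
    η₂ =o[atTop] (fun n : ℕ => Real.log n ^ 2 * ((n : ℝ) * ρ n ^ 2)⁻¹) →
    (∀ n ≥ N₀, ∀ i, PABM.selfForm (Λ n) (c n) i ≤ C₄ * ((K n : ℝ) ^ 2 / n)) →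
    -- the range of `φ₁ * φ₂`
    (∀ n ≥ N₀, φ₁ n * φ₂ n ≤ C₃ * (K n / Real.sqrt n)) →
    (∀ n ≥ N₀, C₂ * (ρ n * K n * Real.sqrt (Real.log n) / PABM.singVal (Θ n) (K n ^ 2 - 1))
      ≤ φ₁ n * φ₂ n) →
    -- weak consistency of every TCSC estimator with threshold `φ₁ / 2`
    ∃ η : ℕ → ℝ, Tendsto η atTop (𝓝 0) ∧
      ∀ n ≥ N₀, ∀ chat : Ω n → Fin n → Fin (K n),
        (∀ ω, PABM.IsTCSCOutput (A n ω) (φ₁ n / 2) ε (chat ω)) →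
        1 - C / (n : ℝ) ^ 4 ≤ (P n).real {ω | PABM.loss (c n) (chat ω) ≤ η n} := by
  -- the constant in the deviation bound for the noise
  set κ : ℝ := 2 * Real.exp 5
  have hκ : 0 < κ := by positivity
  have hC₂ : 0 < 32 * κ * C₃ := by positivity
  have hC₂' : 0 ≤ 16 * (κ * (36 * Real.sqrt C₄ + 6 + 192 * C₁ * Real.sqrt C₄)) := by positivity
  -- the first term of `C₂` makes the eigengap dominate the noise, the second one makes the error of
  -- the projections at most `φ₁ * φ₂ / 16`
  refine ⟨32 * κ * C₃ + 16 * (κ * (36 * Real.sqrt C₄ + 6 + 192 * C₁ * Real.sqrt C₄)), by linarith,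
    1, one_pos, 3, three_pos, ?_⟩
  intro K c ρ Λ₀ Λ Θ Ξ D Ω _ P _ A φ₁ φ₂ η₀ η₁ η₂ N₀ hK hρ hΛ₀ hΛ hΘ hA hm hcond hΞ hsize hsparse
    hφ₁ hclear hη₁ hη₀ hstrong hη₂ hself hup hlow
  -- a positive bound on the proportions of exceptional nodes, and the resulting bound on the loss
  set r : ℕ → ℝ := fun n =>
    2 * |η₂ n| + |η₁ n| + C₀ * |η₀ n| / K n + ((n : ℝ) * (K n : ℝ) ^ 2)⁻¹ with hr
  set w : ℕ → ℝ := fun n => (12 + 4 * ε) * C₀ ^ 2 * (K n : ℝ) ^ 2 * r n with hw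
  have hlog : ∀ᶠ n : ℕ in atTop, 1 ≤ Real.log n :=
    (Real.tendsto_log_atTop.comp tendsto_natCast_atTop_atTop).eventually_ge_atTop 1
  have hlarge : ∀ᶠ n : ℕ in atTop, 0 < n ∧ N₀ ≤ n ∧ 1 ≤ Real.log n := by
    filter_upwards [hlog, eventually_gt_atTop 0, eventually_ge_atTop N₀] with n h1 h2 h3
    exact ⟨h2, h3, h1⟩
  -- the sparsity condition makes the `o` bounds negligible with respect to powers of `K`
  have hKL : ∀ n ≥ N₀, (K n : ℝ) ^ 2 * Real.log n ^ 2 ≤ n * ρ n ^ 2 := by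
    intro n hn
    have h1 := hsparse n hn
    have h2 : (0 : ℝ) < (K n : ℝ) ^ 2 := by
      have : 0 < K n := by linarith [hK n hn]
      positivity
    rw [one_mul, le_div_iff₀ h2] at h1
    linarith
  have hw0 : Tendsto w atTop (𝓝 0) := by
    have hb : ∀ᶠ n in atTop, |(K n : ℝ) ^ 2 * (((n : ℝ) * ρ n ^ 2)⁻¹ * Real.log n ^ 2)| ≤ 1 := by
      filter_upwards [hlarge] with n hn
      have h1 : (0 : ℝ) < n * ρ n ^ 2 :=
        mul_pos (by exact_mod_cast hn.1) (pow_pos (hρ n hn.2.1).1 2)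
      rw [abs_of_nonneg (by positivity), mul_left_comm, inv_mul_le_iff₀ h1, mul_one]
      exact hKL n hn.2.1
    have hb' : ∀ᶠ n in atTop,
        |(K n : ℝ) * ((Real.sqrt ((n : ℝ) * ρ n ^ 2))⁻¹ * Real.log n)| ≤ 1 := by
      filter_upwards [hlarge] with n hn
      have h1 : (0 : ℝ) < n * ρ n ^ 2 :=
        mul_pos (by exact_mod_cast hn.1) (pow_pos (hρ n hn.2.1).1 2)
      have h2 : 0 ≤ Real.log n := by linarith [hn.2.2]
      rw [abs_of_nonneg (by positivity), mul_left_comm, inv_mul_le_iff₀ (Real.sqrt_pos.2 h1),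
        mul_one]
      refine Real.le_sqrt_of_sq_le ?_
      rw [mul_pow]
      exact hKL n hn.2.1
    have t1 := PABM.tendsto_mul_abs_of_isLittleO hη₁ hb
    have t2 := PABM.tendsto_mul_abs_of_isLittleO hη₂
      (a := fun n => (K n : ℝ) ^ 2) (by simpa only [mul_comm] using hb)
    have t0 := PABM.tendsto_mul_abs_of_isLittleO hη₀ hb'
    have t3 : Tendsto (fun n : ℕ => ((n : ℝ))⁻¹) atTop (𝓝 0) :=
      tendsto_inv_atTop_zero.comp tendsto_natCast_atTop_atTop
    have t := ((((t2.const_mul 2).add t1).add (t0.const_mul C₀)).add t3).const_mul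
      ((12 + 4 * ε) * C₀ ^ 2)
    simp only [mul_zero, add_zero] at t
    refine t.congr' ?_
    filter_upwards [hlarge] with n hn
    have h1 : (0 : ℝ) < n := by exact_mod_cast hn.1
    have h2 : (0 : ℝ) < K n := by
      have := hK n hn.2.1
      exact_mod_cast (by omega : 0 < K n)
    simp only [hw, hr]
    field_simp
  classical
  -- where the bound does not apply, the loss is bounded by one
  refine ⟨fun n => if (0 < n ∧ N₀ ≤ n ∧ 1 ≤ Real.log n) ∧ w n < 1 then w n else 1, ?_, ?_⟩
  · refine hw0.congr' ?_
    filter_upwards [hlarge, hw0.eventually_lt_const one_pos] with n h1 h2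
    rw [if_pos ⟨h1, h2⟩]
  intro n hn chat hchat
  by_cases hgood : (0 < n ∧ N₀ ≤ n ∧ 1 ≤ Real.log n) ∧ w n < 1
  swap
  · simp only [if_neg hgood]
    have h1 : {ω | PABM.loss (c n) (chat ω) ≤ 1} = Set.univ :=
      Set.eq_univ_of_forall fun ω => PABM.loss_le_one _ _
    rw [h1, probReal_univ]
    have : (0 : ℝ) ≤ 3 / (n : ℝ) ^ 4 := by positivity
    linarith
  simp only [if_pos hgood]
  obtain ⟨⟨hn0, -, hL⟩, hw1⟩ := hgood
  have hn' : (0 : ℝ) < n := by exact_mod_cast hn0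
  have hK2 : (2 : ℝ) ≤ K n := by exact_mod_cast hK n hn
  have hK0 : 0 < K n := by linarith [hK n hn]
  have hr0 : 0 < ((n : ℝ) * (K n : ℝ) ^ 2)⁻¹ := by positivity
  have hrpos : 0 < r n := by
    have : 0 ≤ C₀ * |η₀ n| / K n := by positivity
    simp only [hr]
    linarith [abs_nonneg (η₂ n), abs_nonneg (η₁ n)]
  have hloss : ∀ ω, PABM.IsRegularGraph (K n) (ρ n) κ (Θ n) (A n ω) →
      PABM.loss (c n) (chat ω) ≤ w n := by
    intro ω hreg
    have hΘn := hΘ n hn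
    have h1 := PABM.IsRegularGraph.loss_le (hΘn ▸ hreg) hκ hn0 hK0 (hρ n hn).1 hL
      (by simpa using hsparse n hn) (one_pos.trans_le hC₀) hC₁.le hC₃ hC₄.le hε (hφ₁ n hn).1
      (hΘn ▸ hΞ n hn) (hΘn ▸ hm n hn) (hΘn ▸ hcond n hn) (hself n hn) (hup n hn)
      (hΘn ▸ hlow n hn) (by linarith) (by linarith) (hsize n hn) (hclear n hn) (hstrong n hn)
      (hchat ω) hrpos (by simp only [hr]; linarith) hw1
    refine h1.trans ?_
    have h2 : 1 ≤ C₀ * K n := by nlinarith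
    calc _ = (12 + 4 * ε) * C₀ * K n * r n * 1 := (mul_one _).symm
      _ ≤ (12 + 4 * ε) * C₀ * K n * r n * (C₀ * K n) :=
        mul_le_mul_of_nonneg_left h2 (by positivity)
      _ = w n := by simp only [hw]; ring
  have hentry : ∀ i k, 0 < Λ n i k ∧ Λ n i k ≤ ρ n := by
    intro i k
    have h1 := hΛ₀ n hn i k
    have h2 := (hρ n hn).1
    rw [hΛ n hn, Matrix.smul_apply, smul_eq_mul]
    exact ⟨mul_pos h2 h1.1, mul_le_of_le_one_right h2.le h1.2.le⟩
  have hfail : (P n).real {ω | ¬ PABM.IsRegularGraph (K n) (ρ n) κ (Θ n) (A n ω)} ≤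
      3 / (n : ℝ) ^ 4 := by
    refine PABM.IsRandomGraph.measureReal_not_isRegularGraph_le (hA n hn) ?_ (fun i j => ?_)
      (fun i j => ?_) (hρ n hn).1 (hρ n hn).2 hK0 hL ?_
    · rw [hΘ n hn, PABM.edgeProb_transpose]
    · rw [hΘ n hn]
      exact (mul_pos (hentry _ _).1 (hentry _ _).1).le
    · rw [hΘ n hn, sq]
      exact mul_le_mul (hentry _ _).2 (hentry _ _).2 (hentry _ _).1.le (hρ n hn).1.le
    · have h1 := hKL n hn
      have h2 : (4 : ℝ) ≤ (K n : ℝ) ^ 2 := by nlinarith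
      have h3 : Real.log n ≤ Real.log n ^ 2 := by nlinarith
      nlinarith [mul_le_mul_of_nonneg_right h2 (sq_nonneg (Real.log n))]
  -- the complement of a possibly non-measurable event, by subadditivity
  have hunion : (1 : ℝ) ≤ (P n).real {ω | PABM.loss (c n) (chat ω) ≤ w n} +
      (P n).real {ω | ¬ PABM.IsRegularGraph (K n) (ρ n) κ (Θ n) (A n ω)} := by
    refine le_trans (le_of_eq ?_) (measureReal_union_le _ _)
    rw [← probReal_univ (μ := P n)]
    congr 1
    refine (Set.eq_univ_of_forall fun ω => ?_).symm
    by_cases hreg : PABM.IsRegularGraph (K n) (ρ n) κ (Θ n) (A n ω)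
    · exact Or.inl (hloss ω hreg)
    · exact Or.inr hreg
  linarith
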